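/- Let $(\Omega,\Sigma,\mu)$ be a $\sigma$-finite measure space, put $\gamma=\mu(\Omega)\in(0,\infty]$, and let $\psi:[0,\gamma)\to[0,\infty)$ be a non-zero increasing (i.e. nondecreasing) concave function with $\psi(0)=0$. Suppose that one of the following two conditions holds: (A) $\gamma=\infty$ and $$\liminf_{t\downarrow 0}\frac{\psi(2t)}{\psi(t)}>1,\qquad \liminf_{t\to\infty}\frac{\psi(2t)}{\psi(t)}>1;$$ (B) $\gamma<\infty$ and $$\liminf_{t\downarrow 0}\frac{\psi(2t)}{\psi(t)}>1.$$ Let $L_0(\mu)$ be the space of all ($\mu$-a.e. equivalence classes of) measurable functions $f:\Omega\to\mathbb{R}$. For $f\in L_0(\mu)$ let $f^*(t)=\inf\{s\ge 0:\mu(\{x\in\Omega:|f(x)|>s\})\le t\}$, $t\ge 0$, be its decreasing rearrangement (with $\inf\emptyset=\infty$), and let $$\|f\|_{M_\psi(\mu)}=\sup_{0<t<\gamma}\frac{1}{\psi(t)}\int_0^t f^*(s)\,ds,\qquad M_\psi(\mu)=\{f\in L_0(\mu):\|f\|_{M_\psi(\mu)}<\infty\}.$$ Then the Marcinkiewicz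 space $(M_\psi(\mu),\|\cdot\|_{M_\psi(\mu)})$ is a Grothendieck space, i.e. it is a real Banach space such that every weak-$*$ convergent sequence in its dual $M_\psi(\mu)^*$ is weakly convergent, that is, convergent in the topology $\sigma(M_\psi(\mu)^*,M_\psi(\mu)^{**})$. -/

import Mathlib

open MeasureTheory Set Filter Topology
open scoped ENNReal NNReal

noncomputable section

namespace Marcinkiewicz

/-- A (real) Banach space `X` is a Grothendieck space if every weak-* convergent sequence in the
dual `X*` converges in the weak topology `σ(X*, X**)` of `X*`. -/
structure IsGrothendieckSpace (X : Type*) [NormedAddCommGroup X] [NormedSpace ℝ X] : Prop where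
  complete : CompleteSpace X
  tendsto_weak : ∀ (φ : ℕ → StrongDual ℝ X) (φ₀ : StrongDual ℝ X),
    Tendsto (fun n => StrongDual.toWeakDual (φ n)) atTop (𝓝 (StrongDual.toWeakDual φ₀)) →
    Tendsto (fun n => toWeakSpace ℝ (StrongDual ℝ X) (φ n)) atTop
      (𝓝 (toWeakSpace ℝ (StrongDual ℝ X) φ₀))

/-- The interval `[0, γ)`, where `0 ≤ γ ≤ ∞`. -/
def halfOpen (γ : ℝ≥0∞) : Set ℝ := {t | 0 ≤ t ∧ ENNReal.ofReal t < γ}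

/-- `ψ : [0, γ) → [0, ∞)` is a non-zero increasing (i.e. nondecreasing) concave function with
`ψ 0 = 0`. The values of `ψ` outside `[0, γ)` play no role. -/
structure IsWeight (γ : ℝ≥0∞) (ψ : ℝ → ℝ) : Prop where
  nonneg : ∀ t ∈ halfOpen γ, 0 ≤ ψ t
  mono : MonotoneOn ψ (halfOpen γ)
  concave : ConcaveOn ℝ (halfOpen γ) ψ
  map_zero : ψ 0 = 0
  ne_zero : ∃ t ∈ halfOpen γ, ψ t ≠ 0

/-- `γ = ∞`, `liminf_{t ↓ 0} ψ(2t)/ψ(t) > 1` and `liminf_{t → ∞} ψ(2t)/ψ(t) > 1`. -/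
def ConditionA (γ : ℝ≥0∞) (ψ : ℝ → ℝ) : Prop :=
  γ = ∞ ∧
  1 < liminf (fun t : ℝ => ((ψ (2 * t) / ψ t : ℝ) : EReal)) (𝓝[>] 0) ∧
  1 < liminf (fun t : ℝ => ((ψ (2 * t) / ψ t : ℝ) : EReal)) atTop

/-- `γ < ∞` and `liminf_{t ↓ 0} ψ(2t)/ψ(t) > 1`. -/
def ConditionB (γ : ℝ≥0∞) (ψ : ℝ → ℝ) : Prop :=
  γ < ∞ ∧
  1 < liminf (fun t : ℝ => ((ψ (2 * t) / ψ t : ℝ) : EReal)) (𝓝[>] 0)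

variable {Ω : Type*} [MeasurableSpace Ω]

/-- The distribution function `d_{|f|}(s) = μ {x : |f x| > s}`, `s ≥ 0`. -/
def distribution (μ : Measure Ω) (f : Ω → ℝ) (s : ℝ≥0) : ℝ≥0∞ := μ {x | (s : ℝ) < |f x|}

/-- The decreasing rearrangement `f*(t) = inf {s ≥ 0 : d_{|f|}(s) ≤ t}`, `t ≥ 0`, with values
in `[0, ∞]`. -/
def rearrangement (μ : Measure Ω) (f : Ω → ℝ) (t : ℝ) : ℝ≥0∞ :=
  ⨅ (s : ℝ≥0) (_ : distribution μ f s ≤ ENNReal.ofReal t), (s : ℝ≥0∞)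

/-- `∫₀ᵗ f*(s) ds`. -/
def primitive (μ : Measure Ω) (f : Ω → ℝ) (t : ℝ) : ℝ≥0∞ :=
  ∫⁻ s in Ioo 0 t, rearrangement μ f s

/-- `‖f‖ = sup_{0 < t < γ} (1 / ψ(t)) ∫₀ᵗ f*(s) ds`, with values in `[0, ∞]`, where
`γ = μ(Ω)`. -/
def eNorm (ψ : ℝ → ℝ) (μ : Measure Ω) (f : Ω → ℝ) : ℝ≥0∞ :=
  ⨆ (t : ℝ) (_ : 0 < t) (_ : ENNReal.ofReal t < μ univ),
    primitive μ f t / ENNReal.ofReal (ψ t)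

/-! Facts on rearrangements needed to see that `eNorm` defines a norm. -/

variable {μ : Measure Ω} {f g : Ω → ℝ} {ψ : ℝ → ℝ}

lemma exists_coe_eq {x : ℝ≥0∞} (h : x ≠ ∞) : ∃ a : ℝ≥0, (a : ℝ≥0∞) = x :=
  ⟨x.toNNReal, ENNReal.coe_toNNReal h⟩

lemma distribution_anti {a b : ℝ≥0} (h : a ≤ b) : distribution μ f b ≤ distribution μ f a := by
  refine measure_mono fun x hx => ?_
  exact lt_of_le_of_lt (NNReal.coe_le_coe.2 h) hx

lemma distribution_congr (h : f =ᵐ[μ] g) (s : ℝ≥0) : distribution μ f s = distribution μ g s := by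
  refine measure_congr ?_
  filter_upwards [h] with x hx
  change (_ < |f x|) = (_ < |g x|)
  rw [hx]

lemma eNorm_congr (h : f =ᵐ[μ] g) : eNorm ψ μ f = eNorm ψ μ g := by
  simp only [eNorm, primitive, rearrangement, distribution_congr h]

lemma distribution_add (a b : ℝ≥0) :
    distribution μ (f + g) (a + b) ≤ distribution μ f a + distribution μ g b := by
  refine (measure_mono fun x hx => ?_).trans (measure_union_le _ _)
  simp only [mem_ofPred_eq, Pi.add_apply, NNReal.coe_add, mem_union] at hx ⊢
  by_contra! hc
  linarith [abs_add_le (f x) (g x)]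

lemma rearrangement_anti {s t : ℝ} (h : s ≤ t) : rearrangement μ f t ≤ rearrangement μ f s :=
  le_iInf₂ fun a ha => iInf₂_le a (ha.trans (ENNReal.ofReal_le_ofReal h))

lemma rearrangement_le_iff {t : ℝ} {a : ℝ≥0} :
    rearrangement μ f t ≤ a ↔ distribution μ f a ≤ ENNReal.ofReal t := by
  refine ⟨fun h => ?_, fun h => iInf₂_le a h⟩
  have key : ∀ b : ℝ≥0, a < b → distribution μ f b ≤ ENNReal.ofReal t := by
    intro b hb
    have : rearrangement μ f t < b := h.trans_lt (ENNReal.coe_lt_coe.2 hb)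
    simp only [rearrangement, iInf_lt_iff] at this
    obtain ⟨c, hc, hcb⟩ := this
    exact (distribution_anti (ENNReal.coe_lt_coe.1 hcb).le).trans hc
  have hU : {x | (a : ℝ) < |f x|} =
      ⋃ n : ℕ, {x | ((a + 1 / ((n : ℝ≥0) + 1) : ℝ≥0) : ℝ) < |f x|} := by
    ext x
    simp only [mem_ofPred_eq, mem_iUnion]
    constructor
    · intro hx
      obtain ⟨n, hn⟩ := exists_nat_one_div_lt (sub_pos.2 hx)
      exact ⟨n, by push_cast; linarith⟩
    · rintro ⟨n, hn⟩
      refine lt_trans ?_ hn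
      push_cast
      have : (0 : ℝ) < 1 / ((n : ℝ) + 1) := by positivity
      linarith
  have hm : Monotone fun n : ℕ => {x | ((a + 1 / ((n : ℝ≥0) + 1) : ℝ≥0) : ℝ) < |f x|} := by
    intro n m hnm x hx
    simp only [mem_ofPred_eq] at hx ⊢
    refine lt_of_le_of_lt ?_ hx
    push_cast
    gcongr
  rw [distribution, hU, hm.measure_iUnion]
  refine iSup_le fun n => key _ ?_
  exact lt_add_of_pos_right a (by positivity)

lemma lt_rearrangement_iff {t : ℝ} {a : ℝ≥0} :
    (a : ℝ≥0∞) < rearrangement μ f t ↔ ENNReal.ofReal t < distribution μ f a := by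
  rw [← not_le, rearrangement_le_iff, not_le]

lemma measurable_rearrangement : Measurable (rearrangement μ f) :=
  Antitone.measurable fun _ _ h => rearrangement_anti h

lemma volume_pos_lt (c : ℝ≥0∞) : volume {s : ℝ | 0 < s ∧ ENNReal.ofReal s < c} = c := by
  rcases eq_or_ne c ∞ with rfl | hc
  · simp [Ioi_def]
  · have : {s : ℝ | 0 < s ∧ ENNReal.ofReal s < c} = Ioo 0 c.toReal := by
      ext s
      simp only [mem_ofPred_eq, mem_Ioo, and_congr_right_iff]
      intro hs
      rw [ENNReal.ofReal_lt_iff_lt_toReal hs.le hc]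
    rw [this, Real.volume_Ioo, sub_zero, ENNReal.ofReal_toReal hc]

/-- `f*` and `|f|` are equimeasurable, hence `∫₀^∞ (f* - a)⁺ ds = ∫ (|f| - a)⁺ dμ`. -/
lemma lintegral_rearrangement_sub (hf : AEMeasurable f μ)
    (hfin : ∀ s, 0 < s → rearrangement μ f s < ∞) (a : ℝ≥0) :
    ∫⁻ s in Ioi 0, (rearrangement μ f s - a) = ∫⁻ x, ENNReal.ofReal (|f x| - a) ∂μ := by
  have h1 : ∫⁻ s in Ioi 0, (rearrangement μ f s - a) =
      ∫⁻ s in Ioi 0, ENNReal.ofReal (max ((rearrangement μ f s).toReal - a) 0) := by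
    refine setLIntegral_congr_fun measurableSet_Ioi fun s hs => ?_
    have := (hfin s hs).ne
    lift rearrangement μ f s to ℝ≥0 using this with r
    rw [ENNReal.ofReal_max, ENNReal.ofReal_zero, max_eq_left zero_le,
      ENNReal.ofReal_sub _ a.coe_nonneg]
    simp
  have h2 : ∫⁻ x, ENNReal.ofReal (|f x| - a) ∂μ =
      ∫⁻ x, ENNReal.ofReal (max (|f x| - a) 0) ∂μ := by
    refine lintegral_congr fun x => ?_
    rw [ENNReal.ofReal_max, ENNReal.ofReal_zero, max_eq_left zero_le]
  rw [h1, h2, lintegral_eq_lintegral_meas_lt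
      (f := fun s => max ((rearrangement μ f s).toReal - a) 0) _
      (ae_of_all _ fun _ => le_max_right _ _)
      (((measurable_rearrangement.ennreal_toReal.sub_const _).max measurable_const).aemeasurable),
    lintegral_eq_lintegral_meas_lt (f := fun x => max (|f x| - a) 0) _
      (ae_of_all _ fun _ => le_max_right _ _) ((hf.abs.sub_const _).max aemeasurable_const)]
  refine setLIntegral_congr_fun measurableSet_Ioi fun r hr => ?_
  have hr' : (0 : ℝ) < r := hr
  lift r to ℝ≥0 using hr'.le
  have e1 : {x | (r : ℝ) < max (|f x| - a) 0} = {x | ((a + r : ℝ≥0) : ℝ) < |f x|} := by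
    ext x
    simp only [mem_ofPred_eq, lt_max_iff, not_lt.2 r.coe_nonneg, or_false, NNReal.coe_add]
    exact lt_sub_iff_add_lt'
  rw [e1, Measure.restrict_apply' measurableSet_Ioi]
  rw [← volume_pos_lt (μ {x | ((a + r : ℝ≥0) : ℝ) < |f x|})]
  congr 1
  ext s
  simp only [mem_inter_iff, mem_ofPred_eq, mem_Ioi, lt_max_iff, not_lt.2 r.coe_nonneg, or_false]
  rw [and_comm]
  refine and_congr_right fun hs => ?_
  have hl := lt_rearrangement_iff (μ := μ) (f := f) (t := s) (a := a + r)
  rw [distribution] at hl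
  rw [← hl]
  have := (hfin s hs).ne
  lift rearrangement μ f s to ℝ≥0 using this with q
  rw [ENNReal.coe_lt_coe, ENNReal.coe_toReal, ← NNReal.coe_lt_coe, NNReal.coe_add]
  exact lt_sub_iff_add_lt'

lemma primitive_le (hf : AEMeasurable f μ) (hfin : ∀ s, 0 < s → rearrangement μ f s < ∞)
    (a : ℝ≥0) (t : ℝ) :
    primitive μ f t ≤ a * ENNReal.ofReal t + ∫⁻ x, ENNReal.ofReal (|f x| - a) ∂μ := by
  rw [← lintegral_rearrangement_sub hf hfin]
  calc primitive μ f t ≤ ∫⁻ s in Ioo 0 t, ((a : ℝ≥0∞) + (rearrangement μ f s - a)) :=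
        lintegral_mono fun s => le_add_tsub
    _ = a * ENNReal.ofReal t + ∫⁻ s in Ioo 0 t, (rearrangement μ f s - a) := by
        rw [lintegral_add_left measurable_const]; simp
    _ ≤ _ := by
        gcongr
        exact Ioo_subset_Ioi_self

lemma exists_le_primitive (hf : AEMeasurable f μ) (hfin : ∀ s, 0 < s → rearrangement μ f s < ∞)
    {t : ℝ} (ht : 0 < t) :
    ∃ a : ℝ≥0, a * ENNReal.ofReal t + ∫⁻ x, ENNReal.ofReal (|f x| - a) ∂μ ≤ primitive μ f t := by
  obtain ⟨a, ha⟩ := exists_coe_eq (hfin t ht).ne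
  refine ⟨a, ?_⟩
  rw [← lintegral_rearrangement_sub hf hfin]
  have h0 : ∫⁻ s in Ici t, (rearrangement μ f s - a) = 0 := by
    rw [setLIntegral_congr_fun (g := fun _ => 0) measurableSet_Ici]
    · simp
    · intro s hs
      have : rearrangement μ f s ≤ a := ha ▸ rearrangement_anti hs
      exact tsub_eq_zero_of_le this
  rw [← Ioo_union_Ici_eq_Ioi ht, lintegral_union measurableSet_Ici
    (Set.disjoint_left.2 fun s hs hs' => not_lt.2 hs' hs.2), h0, add_zero]
  have : (a : ℝ≥0∞) * ENNReal.ofReal t = ∫⁻ _ in Ioo 0 t, (a : ℝ≥0∞) := by simp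
  rw [this, ← lintegral_add_left measurable_const]
  refine setLIntegral_mono measurable_rearrangement fun s hs => ?_
  rw [add_tsub_cancel_of_le]
  rw [ha]
  exact rearrangement_anti hs.2.le

lemma rearrangement_lt_top {t : ℝ} (ht : 0 < t) (h : primitive μ f t ≠ ∞) {s : ℝ} (hs : 0 < s) :
    rearrangement μ f s < ∞ := by
  refine lt_top_iff_ne_top.2 fun hc => h ?_
  refine eq_top_iff.2 ?_
  calc (∞ : ℝ≥0∞) = ∫⁻ _ in Ioo 0 (min s t), ∞ := by
        rw [setLIntegral_const, Real.volume_Ioo, ENNReal.top_mul]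
        simpa using ⟨hs, ht⟩
    _ ≤ ∫⁻ r in Ioo 0 (min s t), rearrangement μ f r := by
        refine setLIntegral_mono measurable_rearrangement fun r hr => ?_
        rw [← hc]
        exact rearrangement_anti (hr.2.le.trans (min_le_left _ _))
    _ ≤ primitive μ f t := by
        rw [primitive]
        exact lintegral_mono_set (Ioo_subset_Ioo_right (min_le_right _ _))

lemma rearrangement_add_lt_top (hf : ∀ s, 0 < s → rearrangement μ f s < ∞)
    (hg : ∀ s, 0 < s → rearrangement μ g s < ∞) {s : ℝ} (hs : 0 < s) :
    rearrangement μ (f + g) s < ∞ := by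
  have hs2 : 0 < s / 2 := by positivity
  obtain ⟨a, ha⟩ := exists_coe_eq (hf _ hs2).ne
  obtain ⟨b, hb⟩ := exists_coe_eq (hg _ hs2).ne
  have : rearrangement μ (f + g) s ≤ (a + b : ℝ≥0) := by
    rw [rearrangement_le_iff]
    refine (distribution_add a b).trans ?_
    calc _ ≤ ENNReal.ofReal (s / 2) + ENNReal.ofReal (s / 2) :=
          add_le_add (rearrangement_le_iff.1 ha.ge) (rearrangement_le_iff.1 hb.ge)
      _ = ENNReal.ofReal s := by rw [← ENNReal.ofReal_add hs2.le hs2.le, add_halves]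
  exact this.trans_lt ENNReal.coe_lt_top

lemma primitive_add_le (hf : AEMeasurable f μ) (hg : AEMeasurable g μ) {t : ℝ} (ht : 0 < t) :
    primitive μ (f + g) t ≤ primitive μ f t + primitive μ g t := by
  by_cases h1 : primitive μ f t = ∞
  · simp [h1]
  by_cases h2 : primitive μ g t = ∞
  · simp [h2]
  have F := fun s => rearrangement_lt_top ht h1 (s := s)
  have G := fun s => rearrangement_lt_top ht h2 (s := s)
  obtain ⟨a, ha⟩ := exists_le_primitive hf F ht
  obtain ⟨b, hb⟩ := exists_le_primitive hg G ht
  refine (primitive_le (hf.add hg) (fun s => rearrangement_add_lt_top F G) (a + b) t).trans ?_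
  refine le_trans ?_ (add_le_add ha hb)
  have hm : AEMeasurable (fun x => ENNReal.ofReal (|f x| - a)) μ :=
    (hf.abs.sub_const _).ennreal_ofReal
  calc ((a + b : ℝ≥0) : ℝ≥0∞) * ENNReal.ofReal t +
        ∫⁻ x, ENNReal.ofReal (|(f + g) x| - (a + b : ℝ≥0)) ∂μ
      ≤ ((a + b : ℝ≥0) : ℝ≥0∞) * ENNReal.ofReal t +
        ∫⁻ x, (ENNReal.ofReal (|f x| - a) + ENNReal.ofReal (|g x| - b)) ∂μ := by
        gcongr with x
        refine le_trans (ENNReal.ofReal_le_ofReal ?_) ENNReal.ofReal_add_le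
        push_cast
        rw [Pi.add_apply]
        linarith [abs_add_le (f x) (g x)]
    _ = _ := by
        rw [lintegral_add_left' hm, ENNReal.coe_add]
        ring

lemma eNorm_add_le (hf : AEMeasurable f μ) (hg : AEMeasurable g μ) :
    eNorm ψ μ (f + g) ≤ eNorm ψ μ f + eNorm ψ μ g := by
  refine iSup_le fun t => iSup₂_le fun ht hγ => ?_
  refine (ENNReal.div_le_div_right (primitive_add_le hf hg ht) _).trans ?_
  rw [ENNReal.add_div]
  exact add_le_add (le_iSup_of_le t (le_iSup₂_of_le ht hγ le_rfl))
    (le_iSup_of_le t (le_iSup₂_of_le ht hγ le_rfl))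

lemma rearrangement_zero (t : ℝ) : rearrangement μ (0 : Ω → ℝ) t = 0 := by
  refine le_antisymm ?_ zero_le
  have := (rearrangement_le_iff (μ := μ) (f := (0 : Ω → ℝ)) (t := t) (a := 0)).2
    (by simp [distribution])
  simpa using this

lemma eNorm_zero : eNorm ψ μ (0 : Ω → ℝ) = 0 := by
  simp [eNorm, primitive, rearrangement_zero]

lemma rearrangement_smul_le (c : ℝ) (t : ℝ) :
    rearrangement μ (c • f) t ≤ ‖c‖ₑ * rearrangement μ f t := by
  rcases eq_or_ne c 0 with rfl | hc
  · simp [rearrangement_zero]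
  have hc' : 0 < |c| := abs_pos.2 hc
  by_cases htop : rearrangement μ f t = ∞
  · rw [htop, ENNReal.mul_top (by simpa using hc)]
    exact le_top
  obtain ⟨a, ha⟩ := exists_coe_eq htop
  have h := rearrangement_le_iff.1 ha.ge
  rw [← ha, enorm_eq_nnnorm, ← ENNReal.coe_mul, rearrangement_le_iff]
  refine le_trans (measure_mono fun x hx => ?_) h
  simp only [mem_ofPred_eq, NNReal.coe_mul, coe_nnnorm, Real.norm_eq_abs, Pi.smul_apply,
    smul_eq_mul, abs_mul] at hx ⊢
  exact lt_of_mul_lt_mul_left hx hc'.le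

lemma eNorm_smul_le (c : ℝ) : eNorm ψ μ (c • f) ≤ ‖c‖ₑ * eNorm ψ μ f := by
  refine iSup_le fun t => iSup₂_le fun ht hγ => ?_
  calc primitive μ (c • f) t / ENNReal.ofReal (ψ t)
      ≤ (‖c‖ₑ * primitive μ f t) / ENNReal.ofReal (ψ t) := by
        refine ENNReal.div_le_div_right ?_ _
        rw [primitive, primitive, ← lintegral_const_mul _ measurable_rearrangement]
        exact lintegral_mono fun s => rearrangement_smul_le c s
    _ = ‖c‖ₑ * (primitive μ f t / ENNReal.ofReal (ψ t)) := mul_div_assoc _ _ _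
    _ ≤ _ := by
        gcongr
        exact le_iSup_of_le t (le_iSup₂_of_le ht hγ le_rfl)

lemma ae_eq_zero_of_eNorm_eq_zero (h : eNorm ψ μ f = 0) : f =ᵐ[μ] 0 := by
  rcases eq_or_ne (μ univ) 0 with hμ | hμ
  · rw [Measure.measure_univ_eq_zero.1 hμ]
    simp [Filter.EventuallyEq]
  have hz : distribution μ f 0 = 0 := by
    by_contra hd
    obtain ⟨c, hc0, hc⟩ := ENNReal.lt_iff_exists_nnreal_btwn.1
      (lt_min (pos_iff_ne_zero.2 hμ) (pos_iff_ne_zero.2 hd))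
    have hc0' : (0 : ℝ) < c := by exact_mod_cast hc0
    have h1 := h
    simp only [eNorm, ENNReal.iSup_eq_zero] at h1
    have h2 := h1 c hc0' (by simpa using hc.trans_le (min_le_left _ _))
    rw [ENNReal.div_eq_zero_iff, or_iff_left ENNReal.ofReal_ne_top, primitive,
      setLIntegral_eq_zero_iff measurableSet_Ioo measurable_rearrangement] at h2
    have h3 : volume (Ioo (0 : ℝ) c) = 0 := by
      refine measure_mono_null (fun s hs => ?_) h2
      simp only [mem_compl_iff, mem_ofPred_eq, Classical.not_imp]
      refine ⟨hs, ?_⟩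
      refine ne_of_gt ?_
      have := (lt_rearrangement_iff (μ := μ) (f := f) (t := s) (a := 0)).2 ?_
      · simpa using this
      · refine lt_of_lt_of_le ?_ (hc.le.trans (min_le_right _ _))
        rw [← ENNReal.ofReal_coe_nnreal]
        exact (ENNReal.ofReal_lt_ofReal_iff hc0').2 hs.2
    simp at h3
    exact absurd h3 (by simpa using hc0'.ne')
  rw [Filter.EventuallyEq, ae_iff]
  refine measure_mono_null (fun x hx => ?_) hz
  simpa using hx

/-! The space itself. -/

/-- The Marcinkiewicz space `M_ψ(μ)`, the linear subspace of `L₀(μ)` of all (classes of) functions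
`f` with `‖f‖ < ∞`. -/
def space (ψ : ℝ → ℝ) (μ : Measure Ω) : Submodule ℝ (Ω →ₘ[μ] ℝ) where
  carrier := {f | eNorm ψ μ f < ∞}
  add_mem' := by
    intro f g hf hg
    change eNorm ψ μ _ < ∞
    rw [eNorm_congr (AEEqFun.coeFn_add f g)]
    exact (eNorm_add_le f.aemeasurable g.aemeasurable).trans_lt (ENNReal.add_lt_top.2 ⟨hf, hg⟩)
  zero_mem' := by
    change eNorm ψ μ _ < ∞
    rw [eNorm_congr AEEqFun.coeFn_zero, eNorm_zero]
    exact ENNReal.zero_lt_top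
  smul_mem' := by
    intro c f hf
    change eNorm ψ μ _ < ∞
    rw [eNorm_congr (AEEqFun.coeFn_smul c f)]
    exact (eNorm_smul_le c).trans_lt (ENNReal.mul_lt_top enorm_lt_top hf)

instance (ψ : ℝ → ℝ) (μ : Measure Ω) : Norm (space ψ μ) where
  norm f := (eNorm ψ μ (f : Ω →ₘ[μ] ℝ)).toReal

lemma norm_def (f : space ψ μ) : ‖f‖ = (eNorm ψ μ (f : Ω →ₘ[μ] ℝ)).toReal := rfl

lemma norm_smul_le' (c : ℝ) (f : space ψ μ) : ‖c • f‖ ≤ ‖c‖ * ‖f‖ := by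
  rw [norm_def, norm_def, Submodule.coe_smul, eNorm_congr (AEEqFun.coeFn_smul c _),
    ← toReal_enorm c, ← ENNReal.toReal_mul]
  exact ENNReal.toReal_mono (ENNReal.mul_lt_top enorm_lt_top f.2).ne (eNorm_smul_le c)

instance (ψ : ℝ → ℝ) (μ : Measure Ω) : NormedAddCommGroup (space ψ μ) :=
  AddGroupNorm.toNormedAddCommGroup
    { toFun := fun f => ‖f‖
      map_zero' := by
        rw [norm_def, Submodule.coe_zero, eNorm_congr AEEqFun.coeFn_zero, eNorm_zero]
        rfl
      add_le' := by
        intro f g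
        rw [norm_def, norm_def, norm_def, ← ENNReal.toReal_add f.2.ne g.2.ne, Submodule.coe_add,
          eNorm_congr (AEEqFun.coeFn_add _ _)]
        exact ENNReal.toReal_mono (ENNReal.add_lt_top.2 ⟨f.2, g.2⟩).ne
          (eNorm_add_le (AEEqFun.aemeasurable _) (AEEqFun.aemeasurable _))
      neg' := by
        have key : ∀ f : space ψ μ, ‖-f‖ ≤ ‖f‖ := fun f => by
          have h := norm_smul_le' (-1) f
          have e : (-1 : ℝ) • f = -f := neg_one_smul ℝ f
          rwa [e, norm_neg, norm_one, one_mul] at h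
        intro f
        exact le_antisymm (key f) (by simpa using key (-f))
      eq_zero_of_map_eq_zero' := by
        intro f hf
        rw [norm_def, ENNReal.toReal_eq_zero_iff, or_iff_left f.2.ne] at hf
        refine Subtype.ext (AEEqFun.ext ?_)
        exact (ae_eq_zero_of_eNorm_eq_zero hf).trans AEEqFun.coeFn_zero.symm }

instance (ψ : ℝ → ℝ) (μ : Measure Ω) : NormedSpace ℝ (space ψ μ) where
  norm_smul_le := norm_smul_le'

end Marcinkiewicz

end

noncomputable section

namespace Marcinkiewicz

/-! ### Uniformly exhaustive families of set functions -/

/-! Let φ_n be weak-* null and F in the bidual. If F(φ_n) ≥ ε along a subsequence, Helly's theorem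
supplies a bounded sequence f_k with φ_n(f_k) > ε/2 whenever n ≤ k, so it suffices to refute such a
triangular pattern (`IsDyadicGauge.not_forall_le`). The pattern survives convex blocking: if g_i is
in the convex hull of {f_k : k ≥ i}, the lower bound persists at (n, g_i) for n ≤ i.

The engine is a Hilbert space argument for moduli. The modulus of a functional over a ball of
sections is additive in the multiplier, so moduli of pointwise quadratic expressions obey the
parallelogram law, and near-minimisers over the hulls of the tails are Cauchy for every φ_n
(`exists_convexHull_forall_tendsto`). By Rosenthal's lemma the moduli of a weak-* null sequence are
uniformly exhaustive (`IsSectionBall.uniformlyExhaustive`), and for such families convergence to 0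
for each n is uniform in n (`UniformlyExhaustive.eventually_forall_le`). Hence consecutive blocks
are close off sets that are small for all φ_n at once (`IsSectionBall.exists_convex_blocks`).

This is used twice. On an order interval, an image of the unit ball of the bounded measurable
functions, the quadratic expression is the pointwise square; then φ_n(g_i) exceeds φ_n(g_0) by at
most a small constant, uniformly in n and i, while φ_n(g_0) → 0, a contradiction
(`not_forall_le_of_order_bounded`). In general, f is cut at the levels v_j into layers indexed by ℤ
plus a bounded remainder, and the quadratic expression is the energy of a layer, with base ℤ. Off a
set of layers negligible for all φ_n, the block differences have energies at most a multiple of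
4^{-i}, so in layer j the common envelope of all blocks costs at t = 2^l only a factor l - j. The
liminf hypotheses make 2^j v_j grow geometrically, so these factors are summable
(`IsDyadicGauge.exists_tsum_layerBound_le`): the envelope lies in M_ψ, and the blocks fall into the
order bounded case. -/

/-- **Rosenthal's lemma** for a bounded sequence of superadditive set functions. -/
lemma exists_infinite_forall_diff_singleton_lt (v : ℕ → Set ℕ → ℝ) {C δ : ℝ} (hδ : 0 < δ)
    (hmono : ∀ k, Monotone (v k))
    (hadd : ∀ k A B, Disjoint A B → v k A + v k B ≤ v k (A ∪ B))
    (hC : ∀ k A, v k A ≤ C) :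
    ∃ M : Set ℕ, M.Infinite ∧ ∀ k ∈ M, v k (M \ {k}) < δ := by
  have key : ∀ N : ℕ, ∀ M : Set ℕ, M.Infinite → (∀ k ∈ M, v k M < N * δ) →
      ∃ M : Set ℕ, M.Infinite ∧ ∀ k ∈ M, v k (M \ {k}) < δ := by
    intro N
    induction N with
    | zero =>
      intro M hM h
      refine ⟨M, hM, fun k hk => ?_⟩
      have h1 := h k hk
      have h2 := hmono k (sdiff_subset : M \ {k} ⊆ M)
      simp only [Nat.cast_zero, zero_mul] at h1
      linarith
    | succ N ih =>
      intro M hM h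
      let e := hM.natEmbedding
      -- The pairing function gives infinitely many disjoint infinite subsets of M.
      let P : ℕ → Set ℕ := fun p => range fun i => (e (Nat.pair p i) : ℕ)
      have hPM : ∀ p, P p ⊆ M := by
        rintro p _ ⟨i, rfl⟩
        exact (e _).2
      have hPinf : ∀ p, (P p).Infinite := fun p =>
        infinite_range_of_injective fun i j hij => by
          have := e.injective (Subtype.ext hij)
          simpa using this
      have hPd : ∀ p p' k, k ∈ P p → k ∈ P p' → p = p' := by
        rintro p p' k ⟨i, hi⟩ ⟨j, hj⟩
        have := e.injective (Subtype.ext (hi.trans hj.symm))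
        simp only [Nat.pair_eq_pair] at this
        exact this.1
      by_cases hex : ∃ p, ∀ k ∈ P p, v k (P p \ {k}) < δ
      · obtain ⟨p, hp⟩ := hex
        exact ⟨P p, hPinf p, hp⟩
      push Not at hex
      choose k hk hkδ using hex
      -- If every part fails, pass to the transversal of bad points. It is disjoint from P p \ {k
      -- p}, which carries at least δ of v (k p), so superadditivity lowers the bound from (N + 1)δ
      -- to Nδ.
      refine ih (range k) (infinite_range_of_injective fun p p' hpp => ?_) ?_
      · exact hPd p p' (k p) (hk p) (hpp ▸ hk p')
      · rintro _ ⟨p, rfl⟩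
        have hd : Disjoint (range k) (P p \ {k p}) := by
          rw [Set.disjoint_left]
          rintro _ ⟨p', rfl⟩ ⟨h1, h2⟩
          exact h2 (by rw [hPd p' p _ (hk p') h1]; rfl)
        have h1 := hadd (k p) _ _ hd
        have h2 : v (k p) (range k ∪ P p \ {k p}) ≤ v (k p) M := by
          refine hmono _ (union_subset ?_ (sdiff_subset.trans (hPM p)))
          rintro _ ⟨p', rfl⟩
          exact hPM _ (hk p')
        have h3 := h (k p) (hPM p (hk p))
        have h4 := hkδ p
        push_cast at h3
        linarith
  obtain ⟨N, hN⟩ := exists_nat_gt (C / δ)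
  refine key N univ infinite_univ fun k _ => (hC k _).trans_lt ?_
  rwa [div_lt_iff₀ hδ] at hN

/-- A family of monotone subadditive set functions on the measurable sets which is uniformly
exhaustive. -/
structure UniformlyExhaustive {T : Type*} [MeasurableSpace T] (p : ℕ → Set T → ℝ) : Prop where
  mono : ∀ n A B, MeasurableSet A → MeasurableSet B → A ⊆ B → p n A ≤ p n B
  subadd : ∀ n A B, MeasurableSet A → MeasurableSet B → p n (A ∪ B) ≤ p n A + p n B
  empty : ∀ n, p n ∅ = 0
  exhaustive : ∀ E : ℕ → Set T, (∀ i, MeasurableSet (E i)) → (∀ i j, i < j → Disjoint (E i) (E j)) →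
    ∀ δ : ℝ, 0 < δ → ∃ i, ∀ n, p n (E i) ≤ δ

namespace UniformlyExhaustive

variable {T : Type*} [MeasurableSpace T] {p : ℕ → Set T → ℝ}

lemma nonneg (hp : UniformlyExhaustive p) (n : ℕ) {A : Set T} (hA : MeasurableSet A) :
    0 ≤ p n A := by
  rw [← hp.empty n]
  exact hp.mono n _ _ MeasurableSet.empty hA (empty_subset _)

/-- Uniform Cauchy property along increasing sets: otherwise iterating the bad choice gives disjoint
differences, on each of which some `p n` exceeds δ. -/
lemma exists_forall_diff_le (hp : UniformlyExhaustive p) {F : ℕ → Set T}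
    (hF : ∀ i, MeasurableSet (F i)) (hm : Monotone F) {δ : ℝ} (hδ : 0 < δ) :
    ∃ l, ∀ l' ≥ l, ∀ n, p n (F l' \ F l) ≤ δ := by
  by_contra! h
  choose s hs n hn using h
  let l : ℕ → ℕ := fun i => s^[i] 0
  have hl : Monotone l := monotone_nat_of_le_succ fun i => by
    simp only [l, Function.iterate_succ_apply']
    exact hs _
  obtain ⟨i, hi⟩ := hp.exhaustive (fun i => F (l (i + 1)) \ F (l i))
    (fun i => (hF _).diff (hF _)) (fun i j hij => by
      rw [Set.disjoint_left]
      rintro x ⟨hx, -⟩ ⟨-, hx'⟩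
      exact hx' (hm (hl hij) hx)) δ hδ
  have h1 := hi (n (l i))
  have h2 := hn (l i)
  simp only [l, Function.iterate_succ_apply'] at h1 h2
  linarith

lemma exists_forall_diff_le_of_antitone (hp : UniformlyExhaustive p) {F : ℕ → Set T}
    (hF : ∀ i, MeasurableSet (F i)) (hm : Antitone F) {δ : ℝ} (hδ : 0 < δ) :
    ∃ l, ∀ l' ≥ l, ∀ n, p n (F l \ F l') ≤ δ := by
  obtain ⟨l, hl⟩ := hp.exists_forall_diff_le (F := fun i => (F i)ᶜ) (fun i => (hF i).compl)
    (fun i j hij => compl_subset_compl.2 (hm hij)) hδ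
  refine ⟨l, fun l' hl' n => ?_⟩
  have := hl l' hl' n
  rwa [compl_sdiff_compl] at this

/-- The union of `A i` over `a ≤ i ≤ b`. -/
def block (A : ℕ → Set T) (a b : ℕ) : Set T := ⋃ i ∈ Icc a b, A i

lemma measurableSet_block {A : ℕ → Set T} (hA : ∀ i, MeasurableSet (A i)) (a b : ℕ) :
    MeasurableSet (block A a b) :=
  MeasurableSet.biUnion (to_countable _) fun i _ => hA i

lemma exists_forall_diff_block_le (hp : UniformlyExhaustive p) {A : ℕ → Set T}
    (hA : ∀ i, MeasurableSet (A i)) (a : ℕ) {δ : ℝ} (hδ : 0 < δ) :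
    ∃ b ≥ a, ∀ i ≥ a, ∀ n, p n (A i \ block A a b) ≤ δ := by
  obtain ⟨l, hl⟩ := hp.exists_forall_diff_le (F := fun l => block A a (a + l))
    (fun l => measurableSet_block hA _ _)
    (fun i j hij => biUnion_subset_biUnion_left (Icc_subset_Icc_right (by omega))) hδ
  refine ⟨a + l, by omega, fun i hi n => ?_⟩
  refine le_trans ?_ (hl (max l (i - a)) (le_max_left _ _) n)
  refine hp.mono n _ _ ((hA i).diff (measurableSet_block hA _ _))
    ((measurableSet_block hA _ _).diff (measurableSet_block hA _ _)) ?_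
  refine sdiff_subset_sdiff_left (subset_biUnion_of_mem (u := A) ⟨hi, ?_⟩)
  have := le_max_right l (i - a)
  omega

lemma block_le (hp : UniformlyExhaustive p) {A : ℕ → Set T} (hA : ∀ i, MeasurableSet (A i))
    (n a b : ℕ) (h : ∀ i ≥ a, p n (A i) ≤ (1 / 2) ^ i) : p n (block A a b) ≤ 2 * (1 / 2) ^ a := by
  have key : ∀ l : ℕ, p n (block A a (a + l)) ≤ 2 * (1 / 2) ^ a - (1 / 2) ^ (a + l) := by
    intro l
    induction l with
    | zero =>
      have h1 : block A a (a + 0) = A a := by simp [block]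
      rw [h1]
      refine (h a le_rfl).trans ?_
      rw [add_zero]
      linarith
    | succ l ih =>
      have h1 : block A a (a + (l + 1)) ⊆ block A a (a + l) ∪ A (a + (l + 1)) := by
        intro x hx
        simp only [block, mem_iUnion, exists_prop, mem_union, mem_Icc] at hx ⊢
        obtain ⟨i, hi, hx⟩ := hx
        rcases eq_or_lt_of_le hi.2 with h2 | h2
        · exact Or.inr (h2 ▸ hx)
        · exact Or.inl ⟨i, ⟨hi.1, by omega⟩, hx⟩
      have h2 := hp.mono n _ _ (measurableSet_block hA _ _)
        ((measurableSet_block hA _ _).union (hA _)) h1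
      have h3 := hp.subadd n _ _ (measurableSet_block hA a (a + l)) (hA (a + (l + 1)))
      have h4 := h (a + (l + 1)) (by omega)
      have h5 : (1 / 2 : ℝ) ^ (a + (l + 1)) = (1 / 2) ^ (a + l) / 2 := by
        rw [← add_assoc, pow_succ]; ring
      rw [h5] at h4 ⊢
      linarith
  rcases le_or_gt a b with hab | hab
  · obtain ⟨l, rfl⟩ := Nat.exists_eq_add_of_le hab
    have := key l
    have h2 : (0 : ℝ) < (1 / 2) ^ (a + l) := by positivity
    linarith
  · have : block A a b = ∅ := by simp [block, Icc_eq_empty (not_le.2 hab)]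
    rw [this, hp.empty]
    positivity

/-- Finite blocks U s of the A i absorb all later A i up to δ 2^{-s-1}, uniformly in n. So A i is,
up to δ, inside the decreasing intersections G r, whose differences are eventually uniformly small.
For fixed n, G r lies in a block far out, whose `p n` is a geometric tail. The three errors are each
at most δ = ε / 3. -/
lemma exists_forall_le_of_geometric (hp : UniformlyExhaustive p) {A : ℕ → Set T}
    (hA : ∀ i, MeasurableSet (A i)) (h : ∀ n, ∀ i ≥ n, p n (A i) ≤ (1 / 2) ^ i)
    {ε : ℝ} (hε : 0 < ε) : ∃ i, ∀ n, p n (A i) ≤ ε := by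
  set δ := ε / 3 with hδ
  have hδ0 : 0 < δ := by positivity
  have hb := fun a s : ℕ => hp.exists_forall_diff_block_le hA a
    (δ := δ / 2 * (1 / 2) ^ s) (by positivity)
  choose b hab hb using hb
  obtain ⟨a, ha_succ⟩ : ∃ a : ℕ → ℕ, ∀ s, a (s + 1) = b (a s) s + 1 :=
    ⟨fun s => Nat.rec 0 (fun s a => b a s + 1) s, fun s => rfl⟩
  have ha : StrictMono a := strictMono_nat_of_lt_succ fun s => by
    rw [ha_succ]
    exact Nat.lt_succ_of_le (hab _ _)
  obtain ⟨U, hUdef⟩ : ∃ U : ℕ → Set T, ∀ s, U s = block A (a s) (b (a s) s) :=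
    ⟨_, fun s => rfl⟩
  have hU : ∀ s, MeasurableSet (U s) := fun s => hUdef s ▸ measurableSet_block hA _ _
  obtain ⟨G, hG_zero, hG_succ⟩ :
      ∃ G : ℕ → Set T, G 0 = U 0 ∧ ∀ r, G (r + 1) = G r ∩ U (r + 1) :=
    ⟨fun r => Nat.rec (U 0) (fun r G => G ∩ U (r + 1)) r, rfl, fun r => rfl⟩
  have hG : ∀ r, MeasurableSet (G r) := fun r => by
    induction r with
    | zero => rw [hG_zero]; exact hU 0
    | succ r ih => rw [hG_succ]; exact ih.inter (hU _)
  have hGa : Antitone G := antitone_nat_of_succ_le fun r => by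
    rw [hG_succ]; exact inter_subset_left
  have hGU : ∀ r, G r ⊆ U r := fun r => by
    cases r with
    | zero => rw [hG_zero]
    | succ r => rw [hG_succ]; exact inter_subset_right
  have hAG : ∀ r, ∀ i ≥ a r, ∀ n, p n (A i \ G r) ≤ δ - δ / 2 * (1 / 2) ^ r := by
    intro r
    induction r with
    | zero =>
      intro i hi n
      rw [hG_zero, hUdef]
      refine (hb (a 0) 0 i hi n).trans ?_
      simp only [pow_zero]
      linarith
    | succ r ih =>
      intro i hi n
      have h1 := ih i ((ha (Nat.lt_succ_self r)).le.trans hi) n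
      have h2 := hb (a (r + 1)) (r + 1) i hi n
      have h3 : A i \ G (r + 1) = (A i \ G r) ∪ (A i \ U (r + 1)) := by
        rw [hG_succ, sdiff_inter]
      rw [h3]
      refine (hp.subadd n _ _ ((hA i).diff (hG r)) ((hA i).diff (hU _))).trans ?_
      rw [← hUdef] at h2
      have h5 : (1 / 2 : ℝ) ^ (r + 1) = (1 / 2) ^ r / 2 := by rw [pow_succ]; ring
      rw [h5] at h2 ⊢
      linarith
  obtain ⟨r, hr⟩ := hp.exists_forall_diff_le_of_antitone hG hGa hδ0
  refine ⟨a r, fun n => ?_⟩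
  -- Only this choice depends on n; the index a r in the conclusion does not.
  obtain ⟨m, hm⟩ := exists_pow_lt_of_lt_one (show 0 < δ / 2 by positivity)
    (show (1 / 2 : ℝ) < 1 by norm_num)
  set r' := max r (max n m) with hr'
  have h1 := hAG r (a r) le_rfl n
  have h2 := hr r' (le_max_left _ _) n
  have hr'a : r' ≤ a r' := ha.id_le r'
  have hnr : n ≤ r' := (le_max_left _ _).trans (le_max_right _ _)
  have hmr : m ≤ r' := (le_max_right _ _).trans (le_max_right _ _)
  have h3 : p n (G r') ≤ 2 * (1 / 2) ^ a r' :=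
    (hp.mono n _ _ (hG _) (hU _) (hGU r')).trans
      (hUdef r' ▸ hp.block_le hA n _ _ fun i hi => h n i (hnr.trans (hr'a.trans hi)))
  have h4 : (1 / 2 : ℝ) ^ a r' ≤ (1 / 2) ^ m :=
    pow_le_pow_of_le_one (by norm_num) (by norm_num) (hmr.trans hr'a)
  have h5 : A (a r) ⊆ (A (a r) \ G r) ∪ ((G r \ G r') ∪ G r') := by
    intro x hx
    by_cases h1 : x ∈ G r <;> by_cases h2 : x ∈ G r' <;> simp [hx, h1, h2]
  have h6 := hp.mono n _ _ (hA (a r))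
    (((hA _).diff (hG r)).union (((hG r).diff (hG r')).union (hG r'))) h5
  have h7 := hp.subadd n _ _ ((hA (a r)).diff (hG r)) (((hG r).diff (hG r')).union (hG r'))
  have h8 := hp.subadd n _ _ ((hG r).diff (hG r')) (hG r')
  have h9 : 0 < δ / 2 * (1 / 2) ^ r := by positivity
  linarith

/-- For a uniformly exhaustive family, pointwise convergence to `0` along a sequence of sets is
uniform. -/
lemma eventually_forall_le (hp : UniformlyExhaustive p) {A : ℕ → Set T}
    (hA : ∀ i, MeasurableSet (A i)) (h : ∀ n, Tendsto (fun i => p n (A i)) atTop (𝓝 0))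
    {ε : ℝ} (hε : 0 < ε) : ∀ᶠ i in atTop, ∀ n, p n (A i) ≤ ε := by
  by_contra hc
  rw [not_eventually] at hc
  -- Along a subsequence of bad indices, impose 2^{-i} on the first i + 1 set functions; this is the
  -- hypothesis of the geometric case.
  have h1 : ∀ i : ℕ, ∃ᶠ k in atTop,
      (¬ ∀ n, p n (A k) ≤ ε) ∧ ∀ n ≤ i, p n (A k) ≤ (1 / 2) ^ i := by
    intro i
    refine hc.and_eventually ?_
    have h2 : ∀ n ∈ Finset.range (i + 1), ∀ᶠ k in atTop, p n (A k) ≤ (1 / 2) ^ i := fun n _ =>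
      (h n).eventually_le_const (by positivity)
    filter_upwards [(Finset.eventually_all _).2 h2] with k hk n hn
    exact hk n (Finset.mem_range.2 (Nat.lt_succ_of_le hn))
  obtain ⟨σ, -, hσ⟩ := extraction_forall_of_frequently h1
  obtain ⟨i, hi⟩ := hp.exists_forall_le_of_geometric (A := fun i => A (σ i)) (fun i => hA _)
    (fun n i hin => (hσ i).2 n hin) hε
  exact (hσ i).1 hi

end UniformlyExhaustive

/-! ### Balls of sections and moduli of functionals -/

/-- `B` is a set of functions on `S`, thought of as sections of the fibration `π : S → T`, which is
stable under multiplication with and convex combinations by measurable functions on the base `T`,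
and under glueing along countable measurable partitions of `T`. -/
structure IsSectionBall {S T : Type*} [MeasurableSpace T] (π : S → T) (B : Set (S → ℝ)) :
    Prop where
  zero_mem : (0 : S → ℝ) ∈ B
  mul_mem : ∀ w : T → ℝ, Measurable w → (∀ t, |w t| ≤ 1) → ∀ H ∈ B, (fun s => w (π s) * H s) ∈ B
  convex_mem : ∀ w : T → ℝ, Measurable w → (∀ t, 0 ≤ w t) → (∀ t, w t ≤ 1) → ∀ H ∈ B, ∀ K ∈ B,
    (fun s => w (π s) * H s + (1 - w (π s)) * K s) ∈ B
  glue_mem : ∀ E : ℕ → Set T, (∀ i, MeasurableSet (E i)) → (∀ i j, i < j → Disjoint (E i) (E j)) →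
    ∀ H : ℕ → S → ℝ, (∀ i, H i ∈ B) → ∀ K : S → ℝ, (∀ i s, π s ∈ E i → K s = H i s) →
    (∀ s, (∀ i, π s ∉ E i) → K s = 0) → K ∈ B

/-- Bounded measurable nonnegative functions. -/
structure IsMultiplier {T : Type*} [MeasurableSpace T] (w : T → ℝ) : Prop where
  measurable : Measurable w
  nonneg : ∀ t, 0 ≤ w t
  bounded : ∃ c : ℝ, 0 < c ∧ ∀ t, w t ≤ c

/-- The modulus of a linear functional, evaluated at a multiplier `w`. -/
def modulus {S T : Type*} (π : S → T) (B : Set (S → ℝ)) (ζ : (S → ℝ) →ₗ[ℝ] ℝ) (w : T → ℝ) : ℝ :=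
  sSup ((fun H : S → ℝ => ζ fun s => w (π s) * H s) '' B)

/-- The modulus of a linear functional as a set function. -/
def setModulus {S T : Type*} (π : S → T) (B : Set (S → ℝ)) (ζ : (S → ℝ) →ₗ[ℝ] ℝ) (A : Set T) : ℝ :=
  modulus π B ζ (A.indicator 1)

section Modulus

variable {S T : Type*} [MeasurableSpace T] {π : S → T} {B : Set (S → ℝ)}
  {ζ : (S → ℝ) →ₗ[ℝ] ℝ} {C : ℝ} {w w' : T → ℝ}

lemma IsMultiplier.add (hw : IsMultiplier w) (hw' : IsMultiplier w') :
    IsMultiplier fun t => w t + w' t := by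
  obtain ⟨c, hc, hwc⟩ := hw.bounded
  obtain ⟨c', hc', hwc'⟩ := hw'.bounded
  exact ⟨hw.measurable.add hw'.measurable, fun t => add_nonneg (hw.nonneg t) (hw'.nonneg t),
    c + c', add_pos hc hc', fun t => add_le_add (hwc t) (hwc' t)⟩

lemma IsMultiplier.const_mul (hw : IsMultiplier w) {c : ℝ} (hc : 0 ≤ c) :
    IsMultiplier fun t => c * w t := by
  obtain ⟨c', hc', hwc'⟩ := hw.bounded
  refine ⟨hw.measurable.const_mul c, fun t => mul_nonneg hc (hw.nonneg t), c * c' + 1,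
    by positivity, fun t => ?_⟩
  have := mul_le_mul_of_nonneg_left (hwc' t) hc
  linarith

lemma isMultiplier_indicator {A : Set T} (hA : MeasurableSet A) :
    IsMultiplier (A.indicator (1 : T → ℝ)) :=
  ⟨measurable_one.indicator hA, fun t => indicator_nonneg (fun _ _ => zero_le_one) t, 1, one_pos,
    fun t => indicator_le_self' (fun _ _ => zero_le_one) t⟩

lemma IsSectionBall.apply_mul_le (hB : IsSectionBall π B) (hζ : ∀ H ∈ B, ζ H ≤ C)
    (hw : IsMultiplier w) {c : ℝ} (hc : 0 < c) (hwc : ∀ t, w t ≤ c) {H : S → ℝ} (hH : H ∈ B) :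
    ζ (fun s => w (π s) * H s) ≤ c * C := by
  have h1 := hζ _ (hB.mul_mem (fun t => w t / c) (hw.measurable.div_const c) (fun t => by
    rw [abs_of_nonneg (div_nonneg (hw.nonneg t) hc.le)]
    exact (div_le_one hc).2 (hwc t)) H hH)
  have h2 : (fun s => w (π s) * H s) = c • fun s => w (π s) / c * H s := by
    ext s
    simp only [Pi.smul_apply, smul_eq_mul]
    field_simp
  rw [h2, map_smul, smul_eq_mul]
  exact mul_le_mul_of_nonneg_left h1 hc.le

lemma IsSectionBall.le_modulus (hB : IsSectionBall π B) (hζ : ∀ H ∈ B, ζ H ≤ C)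
    (hw : IsMultiplier w) {H : S → ℝ} (hH : H ∈ B) :
    ζ (fun s => w (π s) * H s) ≤ modulus π B ζ w := by
  obtain ⟨c, hc, hwc⟩ := hw.bounded
  refine le_csSup ⟨c * C, ?_⟩ ⟨H, hH, rfl⟩
  rintro _ ⟨H, hH, rfl⟩
  exact hB.apply_mul_le hζ hw hc hwc hH

lemma IsSectionBall.modulus_le (hB : IsSectionBall π B) {c : ℝ}
    (h : ∀ H ∈ B, ζ (fun s => w (π s) * H s) ≤ c) : modulus π B ζ w ≤ c := by
  refine csSup_le ⟨_, 0, hB.zero_mem, rfl⟩ ?_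
  rintro _ ⟨H, hH, rfl⟩
  exact h H hH

lemma IsSectionBall.modulus_nonneg (hB : IsSectionBall π B) (hζ : ∀ H ∈ B, ζ H ≤ C)
    (hw : IsMultiplier w) : 0 ≤ modulus π B ζ w := by
  have h := hB.le_modulus hζ hw hB.zero_mem
  have h2 : (fun s => w (π s) * (0 : S → ℝ) s) = 0 := by ext s; simp
  rwa [h2, map_zero] at h

lemma IsSectionBall.modulus_le_mul (hB : IsSectionBall π B) (hζ : ∀ H ∈ B, ζ H ≤ C)
    (hw : IsMultiplier w) {c : ℝ} (hc : 0 < c) (hwc : ∀ t, w t ≤ c) :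
    modulus π B ζ w ≤ c * C :=
  hB.modulus_le fun _ hH => hB.apply_mul_le hζ hw hc hwc hH

/-- Superadditivity is the point: extremal sections H for w and K for w' merge into one section of
the ball because convex combinations may vary measurably over the base. -/
lemma IsSectionBall.modulus_add (hB : IsSectionBall π B) (hζ : ∀ H ∈ B, ζ H ≤ C)
    (hw : IsMultiplier w) (hw' : IsMultiplier w') :
    modulus π B ζ (fun t => w t + w' t) = modulus π B ζ w + modulus π B ζ w' := by
  refine le_antisymm (hB.modulus_le fun H hH => ?_) ?_
  · have h : (fun s => (w (π s) + w' (π s)) * H s) =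
        (fun s => w (π s) * H s) + fun s => w' (π s) * H s := by
      ext s
      simp only [Pi.add_apply, add_mul]
    rw [h, map_add]
    exact add_le_add (hB.le_modulus hζ hw hH) (hB.le_modulus hζ hw' hH)
  · rw [← le_sub_iff_add_le]
    refine hB.modulus_le fun H hH => ?_
    rw [le_sub_comm]
    refine hB.modulus_le fun K hK => ?_
    rw [le_sub_iff_add_le']
    -- With θ = w / (w + w'), (w + w')(θH + (1 - θ)K) = wH + w'K; where w + w' = 0 both sides
    -- vanish, whatever θ is.
    have hθ := hB.convex_mem (fun t => w t / (w t + w' t))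
      (hw.measurable.div (hw.measurable.add hw'.measurable))
      (fun t => div_nonneg (hw.nonneg t) (add_nonneg (hw.nonneg t) (hw'.nonneg t)))
      (fun t => div_le_one_of_le₀ (by linarith [hw'.nonneg t])
        (add_nonneg (hw.nonneg t) (hw'.nonneg t))) H hH K hK
    refine le_trans (le_of_eq ?_) (hB.le_modulus hζ (hw.add hw') hθ)
    rw [← map_add]
    congr 1
    ext s
    simp only [Pi.add_apply]
    rcases (add_nonneg (hw.nonneg (π s)) (hw'.nonneg (π s))).eq_or_lt with h0 | h0
    · have h1 : w (π s) = 0 := by linarith [hw.nonneg (π s), hw'.nonneg (π s)]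
      have h2 : w' (π s) = 0 := by linarith [hw.nonneg (π s), hw'.nonneg (π s)]
      simp [h1, h2]
    · field_simp
      ring

lemma IsSectionBall.modulus_mono (hB : IsSectionBall π B) (hζ : ∀ H ∈ B, ζ H ≤ C)
    (hw : IsMultiplier w) (hw' : IsMultiplier w') (h : ∀ t, w t ≤ w' t) :
    modulus π B ζ w ≤ modulus π B ζ w' := by
  obtain ⟨c, hc, hwc⟩ := hw'.bounded
  have hd : IsMultiplier fun t => w' t - w t :=
    ⟨hw'.measurable.sub hw.measurable, fun t => sub_nonneg.2 (h t), c, hc, fun t => by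
      linarith [hwc t, hw.nonneg t]⟩
  have h1 := hB.modulus_add hζ hw hd
  have h2 := hB.modulus_nonneg hζ hd
  simp only [add_sub_cancel] at h1
  linarith

lemma IsSectionBall.modulus_const_mul (hB : IsSectionBall π B) (hζ : ∀ H ∈ B, ζ H ≤ C)
    (hw : IsMultiplier w) {c : ℝ} (hc : 0 < c) :
    modulus π B ζ (fun t => c * w t) = c * modulus π B ζ w := by
  have key : ∀ c : ℝ, 0 < c → ∀ w : T → ℝ, IsMultiplier w →
      modulus π B ζ (fun t => c * w t) ≤ c * modulus π B ζ w := by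
    intro c hc w hw
    refine hB.modulus_le fun H hH => ?_
    have h : (fun s => c * w (π s) * H s) = c • fun s => w (π s) * H s := by
      ext s
      simp only [Pi.smul_apply, smul_eq_mul, mul_assoc]
    rw [h, map_smul, smul_eq_mul]
    exact mul_le_mul_of_nonneg_left (hB.le_modulus hζ hw hH) hc.le
  refine le_antisymm (key c hc w hw) ?_
  have h := key c⁻¹ (inv_pos.2 hc) _ (hw.const_mul hc.le)
  simp only [inv_mul_cancel_left₀ hc.ne'] at h
  rwa [le_inv_mul_iff₀ hc] at h

lemma IsSectionBall.setModulus_union (hB : IsSectionBall π B) (hζ : ∀ H ∈ B, ζ H ≤ C)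
    {A A' : Set T} (hA : MeasurableSet A) (hA' : MeasurableSet A') (hd : Disjoint A A') :
    setModulus π B ζ (A ∪ A') = setModulus π B ζ A + setModulus π B ζ A' := by
  rw [setModulus, setModulus, setModulus,
    ← hB.modulus_add hζ (isMultiplier_indicator hA) (isMultiplier_indicator hA')]
  congr 1
  rw [indicator_union_of_disjoint hd]

lemma IsSectionBall.setModulus_mono (hB : IsSectionBall π B) (hζ : ∀ H ∈ B, ζ H ≤ C)
    {A A' : Set T} (hA : MeasurableSet A) (hA' : MeasurableSet A') (hd : A ⊆ A') :
    setModulus π B ζ A ≤ setModulus π B ζ A' :=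
  hB.modulus_mono hζ (isMultiplier_indicator hA) (isMultiplier_indicator hA') fun t =>
    indicator_le_indicator_of_subset hd (fun _ => zero_le_one) t

lemma IsSectionBall.setModulus_le (hB : IsSectionBall π B) (hζ : ∀ H ∈ B, ζ H ≤ C)
    {A : Set T} (hA : MeasurableSet A) : setModulus π B ζ A ≤ C := by
  have := hB.modulus_le_mul hζ (isMultiplier_indicator hA) one_pos
    fun t => indicator_le_self' (fun _ _ => zero_le_one) t
  rwa [one_mul] at this

lemma IsSectionBall.apply_le_setModulus (hB : IsSectionBall π B) (hζ : ∀ H ∈ B, ζ H ≤ C)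
    {A : Set T} (hA : MeasurableSet A) {H : S → ℝ} (hH : H ∈ B) (hHA : ∀ s, π s ∉ A → H s = 0) :
    ζ H ≤ setModulus π B ζ A := by
  refine le_trans (le_of_eq ?_) (hB.le_modulus hζ (isMultiplier_indicator hA) hH)
  congr 1
  ext s
  by_cases hs : π s ∈ A
  · simp [hs]
  · simp [hs, hHA s hs]

/-- The moduli of a sequence of functionals converging to `0` pointwise on `B` are uniformly
exhaustive. -/
lemma IsSectionBall.uniformlyExhaustive (hB : IsSectionBall π B) {ζ : ℕ → (S → ℝ) →ₗ[ℝ] ℝ}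
    (hζ : ∀ n, ∀ H ∈ B, ζ n H ≤ C) (hlim : ∀ H ∈ B, Tendsto (fun n => ζ n H) atTop (𝓝 0)) :
    UniformlyExhaustive fun n => setModulus π B (ζ n) where
  mono n A A' hA hA' h := hB.setModulus_mono (hζ n) hA hA' h
  subadd n A A' hA hA' := by
    rw [← union_sdiff_self, hB.setModulus_union (hζ n) hA (hA'.diff hA) disjoint_sdiff_right]
    gcongr
    exact hB.setModulus_mono (hζ n) (hA'.diff hA) hA' sdiff_subset
  empty n := by
    have h := hB.setModulus_union (hζ n) MeasurableSet.empty MeasurableSet.empty (disjoint_empty _)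
    rw [union_self] at h
    linarith
  exhaustive E hE hd δ hδ := by
    by_contra! hc
    choose n hn using hc
    have hex : ∀ i, ∃ H ∈ B, δ < ζ (n i) (fun s => (E i).indicator 1 (π s) * H s) := by
      intro i
      by_contra! h
      exact absurd (hB.modulus_le h) (not_le.2 (hn i))
    choose H hH hHδ using hex
    have hEU : ∀ M : Set ℕ, MeasurableSet (⋃ i ∈ M, E i) := fun M =>
      MeasurableSet.biUnion (to_countable _) fun i _ => hE i
    have hd' : ∀ i j, i ≠ j → Disjoint (E i) (E j) := fun i j hij =>
      hij.lt_or_gt.elim (hd i j) fun h => (hd j i h).symm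
    have hEq : ∀ i j t, t ∈ E i → t ∈ E j → i = j := fun i j t hi hj => by
      by_contra h
      exact Set.disjoint_left.1 (hd' i j h) hi hj
    -- Rosenthal's lemma makes the pieces E i, i ∈ M \ {k}, contribute less than δ/2 to the modulus
    -- of ζ (n k), so that the glued section K M still sees the piece E k.
    obtain ⟨M, hM, hMδ⟩ := exists_infinite_forall_diff_singleton_lt
      (fun k M => setModulus π B (ζ (n k)) (⋃ i ∈ M, E i)) (C := C) (δ := δ / 2) (by positivity)
      (fun k M M' hMM => hB.setModulus_mono (hζ _) (hEU M) (hEU M')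
        (biUnion_subset_biUnion_left hMM))
      (fun k M M' hMM => by
        rw [← hB.setModulus_union (hζ _) (hEU M) (hEU M'), biUnion_union]
        rw [Set.disjoint_left]
        intro t ht ht'
        simp only [mem_iUnion, exists_prop] at ht ht'
        obtain ⟨i, hi, hti⟩ := ht
        obtain ⟨j, hj, htj⟩ := ht'
        exact Set.disjoint_left.1 hMM hi (hEq i j t hti htj ▸ hj))
      (fun k M => hB.setModulus_le (hζ _) (hEU M))
    classical
    let K : Set ℕ → S → ℝ := fun M s =>
      if h : ∃ i ∈ M, π s ∈ E i then H h.choose s else 0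
    have hK1 : ∀ M, ∀ i ∈ M, ∀ s, π s ∈ E i → K M s = H i s := by
      intro M i hi s hs
      have h : ∃ i ∈ M, π s ∈ E i := ⟨i, hi, hs⟩
      have h2 : h.choose = i := hEq _ _ _ h.choose_spec.2 hs
      simp only [K, dif_pos h, h2]
    have hK0 : ∀ M s, (∀ i ∈ M, π s ∉ E i) → K M s = 0 := by
      intro M s h
      have : ¬ ∃ i ∈ M, π s ∈ E i := by push Not; exact h
      simp only [K, dif_neg this]
    have hKB : ∀ M, K M ∈ B := by
      intro M
      refine hB.glue_mem E hE hd (fun i => if i ∈ M then H i else 0) (fun i => ?_) (K M) ?_ ?_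
      · split_ifs
        exacts [hH i, hB.zero_mem]
      · intro i s hs
        by_cases hi : i ∈ M
        · simp [hi, hK1 M i hi s hs]
        · simp only [hi, if_false, Pi.zero_apply]
          exact hK0 M s fun j hj hsj => hi (hEq i j _ hs hsj ▸ hj)
      · exact fun s hs => hK0 M s fun i _ => hs i
    have hbig : ∀ k ∈ M, δ / 2 < ζ (n k) (K M) := by
      intro k hk
      -- This is K M = 1_{E k} H k + K (M \ {k}), with the last term added to both sides.
      have h1 : K M + K (M \ {k}) = (fun s => (E k).indicator 1 (π s) * H k s) +
          (2 : ℝ) • K (M \ {k}) := by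
        ext s
        simp only [Pi.add_apply, Pi.smul_apply, smul_eq_mul]
        by_cases hs : ∃ i ∈ M, π s ∈ E i
        · obtain ⟨i, hi, hsi⟩ := hs
          rw [hK1 M i hi s hsi]
          by_cases hik : i = k
          · subst hik
            rw [hK0 (M \ {i}) s fun j hj hsj => hj.2 (hEq j i _ hsj hsi)]
            simp [hsi]
          · rw [hK1 (M \ {k}) i ⟨hi, hik⟩ s hsi]
            have : π s ∉ E k := fun h => hik (hEq i k _ hsi h)
            simp only [this, not_false_eq_true, indicator_of_notMem]
            ring
        · push Not at hs
          rw [hK0 M s hs, hK0 (M \ {k}) s fun j hj => hs j hj.1]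
          simp [hs k hk]
      have h2 := congrArg (ζ (n k)) h1
      rw [map_add, map_add, map_smul, smul_eq_mul] at h2
      have hneg : (fun s => (-1 : ℝ) * K (M \ {k}) s) ∈ B :=
        hB.mul_mem (fun _ => -1) measurable_const (fun _ => by simp) _ (hKB _)
      have h3 := hB.apply_le_setModulus (hζ (n k)) (hEU (M \ {k})) hneg (fun s hs => by
        rw [hK0 (M \ {k}) s fun i hi hsi => hs (mem_biUnion hi hsi), mul_zero])
      have h4 : (fun s => (-1 : ℝ) * K (M \ {k}) s) = (-1 : ℝ) • K (M \ {k}) := rfl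
      rw [h4, map_smul, smul_eq_mul] at h3
      have h5 := hMδ k hk
      have h6 := hHδ k
      linarith
    obtain ⟨N, hN⟩ := eventually_atTop.1
      ((hlim (K M) (hKB M)).eventually_lt_const (show 0 < δ / 2 by positivity))
    have hmaps : MapsTo n M (Iio N) := fun k hk => by
      by_contra h
      exact absurd (hbig k hk) (not_lt.2 (hN (n k) (not_lt.1 h)).le)
    -- Since ζ n (K M) → 0, the values n k, k ∈ M, are bounded, so two distinct k, k' share one.
    -- Then E k' has modulus above δ for ζ (n k), although it is among the pieces other than E k.
    obtain ⟨k, hk, k', hk', hkk, hnn⟩ :=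
      hM.exists_ne_map_eq_of_mapsTo hmaps (finite_Iio N)
    have h1 := hMδ k hk
    have h2 := hB.setModulus_mono (hζ (n k)) (hE k') (hEU (M \ {k}))
      (subset_biUnion_of_mem (u := E) (show k' ∈ M \ {k} from ⟨hk', fun h => hkk h.symm⟩))
    have h3 := hn k'
    rw [← hnn] at h3
    linarith

end Modulus

/-! ### Convex blocks -/

section Blocks

/-- Minimising an averaged quadratic functional over the tails of a sequence yields convex blocks
which are Cauchy for each of the functionals. -/
lemma exists_convexHull_forall_tendsto {E : Type*} [AddCommGroup E] [Module ℝ E]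
    {K : Set E} (hK : Convex ℝ K) (hK' : ∀ g ∈ K, ∀ g' ∈ K, (1 / 2 : ℝ) • (g - g') ∈ K)
    {x : ℕ → E} (hx : ∀ i, x i ∈ K) {Q : ℕ → E → ℝ} {D : ℝ}
    (hQ0 : ∀ n, ∀ g ∈ K, 0 ≤ Q n g) (hQD : ∀ n, ∀ g ∈ K, Q n g ≤ D)
    (hQ : ∀ n, ∀ g ∈ K, ∀ g' ∈ K, Q n ((1 / 2 : ℝ) • (g + g')) + Q n ((1 / 2 : ℝ) • (g - g')) =
      (Q n g + Q n g') / 2) :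
    ∃ g : ℕ → E, (∀ i, g i ∈ convexHull ℝ (x '' Ici i)) ∧
      ∀ n, ∀ ε > 0, ∃ N, ∀ k ≥ N, ∀ l ≥ k, Q n ((1 / 2 : ℝ) • (g l - g k)) ≤ ε := by
  have hsum : ∀ g ∈ K, Summable fun n => (1 / 2 : ℝ) ^ n * Q n g := fun g hg =>
    Summable.of_nonneg_of_le (fun n => mul_nonneg (by positivity) (hQ0 n g hg))
      (fun n => mul_le_mul_of_nonneg_left (hQD n g hg) (by positivity))
      (summable_geometric_two.mul_right D)
  -- The weights 2^{-n} merge all the Q n into one bounded functional that still satisfies the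
  -- parallelogram law and controls each Q n.
  obtain ⟨J, hJ⟩ : ∃ J : E → ℝ, ∀ g, J g = ∑' n, (1 / 2 : ℝ) ^ n * Q n g := ⟨_, fun g => rfl⟩
  have hJ0 : ∀ g ∈ K, 0 ≤ J g := fun g hg => by
    rw [hJ]
    exact tsum_nonneg fun n => mul_nonneg (by positivity) (hQ0 n g hg)
  have hJD : ∀ g ∈ K, J g ≤ 2 * D := fun g hg => by
    have h := (hsum g hg).tsum_le_tsum
      (fun n => mul_le_mul_of_nonneg_left (hQD n g hg) (by positivity))
      (summable_geometric_two.mul_right D)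
    rwa [tsum_mul_right, tsum_geometric_two, ← hJ] at h
  have hQJ : ∀ n, ∀ g ∈ K, (1 / 2 : ℝ) ^ n * Q n g ≤ J g := fun n g hg => by
    rw [hJ]
    exact (hsum g hg).le_tsum n fun m _ => mul_nonneg (by positivity) (hQ0 m g hg)
  have hmid : ∀ g ∈ K, ∀ g' ∈ K, (1 / 2 : ℝ) • (g + g') ∈ K := fun g hg g' hg' => by
    rw [smul_add]
    exact hK hg hg' (by norm_num) (by norm_num) (by norm_num)
  have hJp : ∀ g ∈ K, ∀ g' ∈ K, J ((1 / 2 : ℝ) • (g + g')) + J ((1 / 2 : ℝ) • (g - g')) =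
      (J g + J g') / 2 := by
    intro g hg g' hg'
    rw [hJ, hJ, hJ, hJ, ← (hsum _ (hmid g hg g' hg')).tsum_add (hsum _ (hK' g hg g' hg')),
      ← (hsum g hg).tsum_add (hsum g' hg'), ← tsum_div_const]
    congr 1
    ext n
    rw [← mul_add, hQ n g hg g' hg']
    ring
  obtain ⟨c, hc⟩ : ∃ c : ℕ → Set E, ∀ i, c i = convexHull ℝ (x '' Ici i) := ⟨_, fun i => rfl⟩
  have hcc : ∀ i, Convex ℝ (c i) := fun i => hc i ▸ convex_convexHull ℝ _
  have hcK : ∀ i, c i ⊆ K := fun i => by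
    rw [hc]
    refine convexHull_min ?_ hK
    rintro _ ⟨k, -, rfl⟩
    exact hx k
  have hca : ∀ i k, i ≤ k → c k ⊆ c i := fun i k hik => by
    rw [hc, hc]
    exact convexHull_mono (image_mono (Ici_subset_Ici.2 hik))
  have hbdd : ∀ i, BddBelow (J '' c i) := fun i => ⟨0, by
    rintro _ ⟨g, hg, rfl⟩
    exact hJ0 g (hcK i hg)⟩
  have hne : ∀ i, (J '' c i).Nonempty := fun i =>
    ⟨_, x i, hc i ▸ subset_convexHull ℝ _ ⟨i, self_mem_Ici, rfl⟩, rfl⟩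
  obtain ⟨s, hs⟩ : ∃ s : ℕ → ℝ, ∀ i, s i = sInf (J '' c i) := ⟨_, fun i => rfl⟩
  have hsm : Monotone s := fun i k hik => by
    rw [hs, hs]
    exact csInf_le_csInf (hbdd i) (hne k) (image_mono (hca i k hik))
  have hsb : BddAbove (range s) := by
    refine ⟨2 * D, ?_⟩
    rintro _ ⟨i, rfl⟩
    obtain ⟨_, g, hg, rfl⟩ := hne i
    rw [hs]
    exact (csInf_le (hbdd i) ⟨g, hg, rfl⟩).trans (hJD g (hcK i hg))
  have hslim := tendsto_atTop_ciSup hsm hsb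
  have hex : ∀ i : ℕ, ∃ g ∈ c i, J g < s i + 1 / ((i : ℝ) + 1) := fun i => by
    obtain ⟨_, ⟨g, hg, rfl⟩, hlt⟩ := exists_lt_of_csInf_lt (hne i)
      (show sInf (J '' c i) < s i + 1 / ((i : ℝ) + 1) by
        rw [← hs]; exact lt_add_of_pos_right _ (by positivity))
    exact ⟨g, hg, hlt⟩
  choose g hgc hgs using hex
  refine ⟨g, fun i => hc i ▸ hgc i, fun n ε hε => ?_⟩
  have hlim : Tendsto (fun k : ℕ => ((⨆ i, s i) - s k) / 2 + 1 / ((k : ℝ) + 1)) atTop (𝓝 0) := by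
    have h := ((tendsto_const_nhds (x := ⨆ i, s i)).sub hslim).div_const 2
    simpa using h.add tendsto_one_div_add_atTop_nhds_zero_nat
  obtain ⟨N, hN⟩ := eventually_atTop.1
    (hlim.eventually_lt_const (show 0 < (1 / 2 : ℝ) ^ n * ε by positivity))
  refine ⟨N, fun k hk l hl => ?_⟩
  have hgk := hcK _ (hgc k)
  have hgl := hcK _ (hgc l)
  have h1 := hJp _ hgl _ hgk
  -- The midpoint lies in the k-th hull, so J there is at least the infimum s k; the parallelogram
  -- law then bounds J of the half difference by (sup s - s k)/2 + 1/(k + 1).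
  have h2 : s k ≤ J ((1 / 2 : ℝ) • (g l + g k)) := by
    rw [hs]
    refine csInf_le (hbdd k) ⟨_, ?_, rfl⟩
    rw [smul_add]
    exact hcc k (hca k l hl (hgc l)) (hgc k) (by norm_num) (by norm_num) (by norm_num)
  have h3 := hgs k
  have h4 := hgs l
  have h5 : s l ≤ ⨆ i, s i := le_ciSup hsb l
  have h6 : 1 / ((l : ℝ) + 1) ≤ 1 / ((k : ℝ) + 1) := by gcongr
  have h7 := hN k hk
  have h8 := hQJ n _ (hK' _ hgl _ hgk)
  refine le_of_mul_le_mul_left (h8.trans ?_) (show 0 < (1 / 2 : ℝ) ^ n by positivity)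
  linarith

variable {S T : Type*} [MeasurableSpace T] {π : S → T} {B : Set (S → ℝ)} {C : ℝ}

/-- Additivity of the modulus turns the pointwise parallelogram law for `q` into one for g ↦ modulus
of ζ n at q g, so minimising blocks are Cauchy for each n. Chebyshev's inequality makes the sets
where q of a half difference is large small for each ζ n, and uniform exhaustivity makes them small
for all n together. -/
lemma IsSectionBall.exists_convex_blocks (hB : IsSectionBall π B) {ζ : ℕ → (S → ℝ) →ₗ[ℝ] ℝ}
    (hζ : ∀ n, ∀ H ∈ B, ζ n H ≤ C) (hlim : ∀ H ∈ B, Tendsto (fun n => ζ n H) atTop (𝓝 0))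
    {E : Type*} [AddCommGroup E] [Module ℝ E]
    {K : Set E} (hK : Convex ℝ K) (hK' : ∀ g ∈ K, ∀ g' ∈ K, (1 / 2 : ℝ) • (g - g') ∈ K)
    {x : ℕ → E} (hx : ∀ i, x i ∈ K) {q : E → T → ℝ} {D : ℝ}
    (hqm : ∀ g ∈ K, Measurable (q g)) (hq0 : ∀ g ∈ K, ∀ t, 0 ≤ q g t)
    (hqD : ∀ g ∈ K, ∀ t, q g t ≤ D)
    (hq : ∀ g ∈ K, ∀ g' ∈ K, ∀ t, q ((1 / 2 : ℝ) • (g + g')) t + q ((1 / 2 : ℝ) • (g - g')) t =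
      (q g t + q g' t) / 2)
    {η : ℕ → ℝ} (hη : ∀ i, 0 < η i) :
    ∃ (g : ℕ → E) (A : ℕ → Set T), (∀ i, g i ∈ convexHull ℝ (x '' Ici i)) ∧
      (∀ i, MeasurableSet (A i)) ∧ (∀ n i, setModulus π B (ζ n) (A i) ≤ η i) ∧
      ∀ i, ∀ t ∉ A i, q ((1 / 2 : ℝ) • (g (i + 1) - g i)) t ≤ η i := by
  have hmult : ∀ g ∈ K, IsMultiplier (q g) := fun g hg =>
    ⟨hqm g hg, hq0 g hg, max D 1, by positivity, fun t => (hqD g hg t).trans (le_max_left _ _)⟩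
  have hmid : ∀ g ∈ K, ∀ g' ∈ K, (1 / 2 : ℝ) • (g + g') ∈ K := fun g hg g' hg' => by
    rw [smul_add]
    exact hK hg hg' (by norm_num) (by norm_num) (by norm_num)
  obtain ⟨g, hg, hgc⟩ := exists_convexHull_forall_tendsto hK hK' hx
    (Q := fun n g => modulus π B (ζ n) (q g)) (D := max D 1 * C)
    (fun n g hg => hB.modulus_nonneg (hζ n) (hmult g hg))
    (fun n g hg => hB.modulus_le_mul (hζ n) (hmult g hg) (by positivity)
      fun t => (hqD g hg t).trans (le_max_left _ _))
    (fun n g hg g' hg' => by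
      rw [← hB.modulus_add (hζ n) (hmult _ (hmid g hg g' hg')) (hmult _ (hK' g hg g' hg')),
        ← hB.modulus_add (hζ n) (hmult g hg) (hmult g' hg'),
        div_eq_inv_mul (modulus π B (ζ n) _) 2,
        ← hB.modulus_const_mul (hζ n) ((hmult g hg).add (hmult g' hg')) (by norm_num)]
      congr 1
      ext t
      rw [hq g hg g' hg' t]
      ring)
  have hgK : ∀ i, g i ∈ K := fun i => by
    refine convexHull_min ?_ hK (hg i)
    rintro _ ⟨k, -, rfl⟩
    exact hx k
  have hdK : ∀ k l, (1 / 2 : ℝ) • (g l - g k) ∈ K := fun k l => hK' _ (hgK l) _ (hgK k)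
  let A : ℝ → ℕ → ℕ → Set T := fun δ k l => {t | δ < q ((1 / 2 : ℝ) • (g l - g k)) t}
  have hAm : ∀ δ k l, MeasurableSet (A δ k l) := fun δ k l =>
    measurableSet_lt measurable_const (hqm _ (hdK k l))
  have hp := hB.uniformlyExhaustive hζ hlim
  have hunif : ∀ δ > 0, ∃ N, ∀ k ≥ N, ∀ l ≥ k, ∀ n, setModulus π B (ζ n) (A δ k l) ≤ δ := by
    intro δ hδ
    by_contra! h
    choose k hk l hl n hn using h
    have h1 := hp.eventually_forall_le (A := fun i => A δ (k i) (l i)) (fun i => hAm _ _ _)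
      (fun m => by
        rw [Metric.tendsto_atTop]
        intro ε hε
        obtain ⟨N, hN⟩ := hgc m (δ * (ε / 2)) (by positivity)
        refine ⟨N, fun i hi => ?_⟩
        have h2 := hN (k i) (hi.le.trans (hk i)) (l i) (hl i)
        -- Chebyshev's inequality for the modulus: δ times the indicator of {q > δ} is at most q.
        have h3 : δ * setModulus π B (ζ m) (A δ (k i) (l i)) ≤ δ * (ε / 2) := by
          refine le_trans ?_ h2
          rw [setModulus, ← hB.modulus_const_mul (hζ m) (isMultiplier_indicator (hAm _ _ _)) hδ]
          refine hB.modulus_mono (hζ m) ((isMultiplier_indicator (hAm _ _ _)).const_mul hδ.le)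
            (hmult _ (hdK _ _)) fun t => ?_
          by_cases ht : t ∈ A δ (k i) (l i)
          · simp only [ht, indicator_of_mem, Pi.one_apply, mul_one]
            exact ht.le
          · simp only [ht, not_false_eq_true, indicator_of_notMem, mul_zero]
            exact hq0 _ (hdK _ _) t
        have h4 := le_of_mul_le_mul_left h3 hδ
        rw [Real.dist_eq, sub_zero, abs_of_nonneg (hp.nonneg m (hAm _ _ _))]
        linarith) hδ
    obtain ⟨i, hi⟩ := h1.exists
    exact absurd (hi (n i)) (not_le.2 (hn i))
  choose N hN using fun i => hunif (η i) (hη i)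
  -- Strictly increasing indices, beyond both i and N i.
  let k : ℕ → ℕ := fun i => ∑ j ∈ Finset.range (i + 1), (N j + 1)
  have hks : ∀ i, k (i + 1) = k i + (N (i + 1) + 1) := fun i => Finset.sum_range_succ _ _
  have hkN : ∀ i, N i ≤ k i := fun i => by
    have : k i = ∑ j ∈ Finset.range i, (N j + 1) + (N i + 1) := Finset.sum_range_succ _ _
    omega
  have hki : ∀ i, i ≤ k i := fun i => by
    induction i with
    | zero => exact Nat.zero_le _
    | succ i ih => rw [hks]; omega
  refine ⟨fun i => g (k i), fun i => A (η i) (k i) (k (i + 1)), fun i => ?_, fun i => hAm _ _ _,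
    fun n i => hN i (k i) (hkN i) (k (i + 1)) (by rw [hks]; omega) n, fun i t ht => not_lt.1 ht⟩
  exact convexHull_mono (image_mono (Ici_subset_Ici.2 (hki i))) (hg (k i))

end Blocks

/-! ### Estimates for rearrangements -/

section Primitive

variable {Ω : Type*} [MeasurableSpace Ω] {μ : Measure Ω} {f g : Ω → ℝ} {ψ : ℝ → ℝ}

lemma rearrangement_mono (h : ∀ᵐ x ∂μ, |f x| ≤ |g x|) (t : ℝ) :
    rearrangement μ f t ≤ rearrangement μ g t := by
  refine le_iInf₂ fun a ha => ?_
  rw [rearrangement_le_iff]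
  refine le_trans (measure_mono_ae ?_) ha
  filter_upwards [h] with x hx hxa
  exact lt_of_lt_of_le hxa hx

lemma primitive_mono (h : ∀ᵐ x ∂μ, |f x| ≤ |g x|) (t : ℝ) :
    primitive μ f t ≤ primitive μ g t :=
  lintegral_mono fun s => rearrangement_mono h s

lemma primitive_mono_right {s t : ℝ} (h : s ≤ t) : primitive μ f s ≤ primitive μ f t :=
  lintegral_mono_set (Ioo_subset_Ioo_right h)

lemma eNorm_mono (h : ∀ᵐ x ∂μ, |f x| ≤ |g x|) : eNorm ψ μ f ≤ eNorm ψ μ g :=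
  iSup_mono fun t => iSup₂_mono fun _ _ => ENNReal.div_le_div_right (primitive_mono h t) _

lemma mul_rearrangement_le_primitive (t : ℝ) :
    ENNReal.ofReal t * rearrangement μ f t ≤ primitive μ f t := by
  calc ENNReal.ofReal t * rearrangement μ f t = ∫⁻ _ in Ioo 0 t, rearrangement μ f t := by
        simp [mul_comm]
    _ ≤ primitive μ f t :=
        setLIntegral_mono measurable_rearrangement fun s hs => rearrangement_anti hs.2.le

lemma rearrangement_le_of_bound {c : ℝ≥0} (h : ∀ᵐ x ∂μ, |f x| ≤ c) (t : ℝ) :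
    rearrangement μ f t ≤ c := by
  rw [rearrangement_le_iff]
  refine le_of_eq_of_le ?_ zero_le
  simpa only [not_le, distribution] using ae_iff.1 h

lemma primitive_le_of_bound {c : ℝ≥0} (h : ∀ᵐ x ∂μ, |f x| ≤ c) (t : ℝ) :
    primitive μ f t ≤ c * ENNReal.ofReal t := by
  calc primitive μ f t ≤ ∫⁻ _ in Ioo 0 t, (c : ℝ≥0∞) :=
        lintegral_mono fun s => rearrangement_le_of_bound h s
    _ = c * ENNReal.ofReal t := by simp

lemma rearrangement_lt_top_of_lintegral (hf : AEMeasurable f μ) (h : ∫⁻ x, ‖f x‖ₑ ∂μ ≠ ∞)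
    {s : ℝ} (hs : 0 < s) : rearrangement μ f s < ∞ := by
  obtain ⟨c, hc⟩ := exists_coe_eq (ENNReal.div_ne_top h (ENNReal.ofReal_pos.2 hs).ne')
  have h1 : rearrangement μ f s ≤ (c + 1 : ℝ≥0) := by
    rw [rearrangement_le_iff]
    have h2 := mul_meas_ge_le_lintegral₀ hf.enorm ((c + 1 : ℝ≥0) : ℝ≥0∞)
    have h3 : distribution μ f (c + 1) ≤ μ {x | ((c + 1 : ℝ≥0) : ℝ≥0∞) ≤ ‖f x‖ₑ} := by
      refine measure_mono fun x hx => ?_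
      simp only [mem_ofPred_eq] at hx ⊢
      rw [enorm_eq_nnnorm, ENNReal.coe_le_coe, ← NNReal.coe_le_coe, coe_nnnorm, Real.norm_eq_abs]
      exact hx.le
    have h4 : ((c + 1 : ℝ≥0) : ℝ≥0∞) * distribution μ f (c + 1) ≤
        ((c + 1 : ℝ≥0) : ℝ≥0∞) * ENNReal.ofReal s := by
      refine (mul_le_mul_right h3 _).trans (h2.trans ?_)
      rw [ENNReal.coe_add, hc, add_mul, ENNReal.div_mul_cancel (ENNReal.ofReal_pos.2 hs).ne'
        ENNReal.ofReal_ne_top]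
      exact le_self_add
    rwa [ENNReal.mul_le_mul_iff_right (by simp) ENNReal.coe_ne_top] at h4
  exact h1.trans_lt ENNReal.coe_lt_top

lemma primitive_le_lintegral (hf : AEMeasurable f μ) (t : ℝ) :
    primitive μ f t ≤ ∫⁻ x, ‖f x‖ₑ ∂μ := by
  by_cases h : ∫⁻ x, ‖f x‖ₑ ∂μ = ∞
  · rw [h]
    exact le_top
  have h1 := primitive_le hf (fun s => rearrangement_lt_top_of_lintegral hf h) 0 t
  simpa [Real.enorm_eq_ofReal_abs] using h1

/-- The primitive at t is the minimum over levels a of a t + ∫ (|f| - a)⁺ dμ; the level that is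
optimal for t is tested at 2t. -/
lemma primitive_two_mul_le (hf : AEMeasurable f μ) {t : ℝ} (ht : 0 < t) :
    primitive μ f (2 * t) ≤ 2 * primitive μ f t := by
  by_cases h : primitive μ f t = ∞
  · simp [h]
  have F := fun s => rearrangement_lt_top ht h (s := s)
  obtain ⟨a, ha⟩ := exists_le_primitive hf F ht
  calc primitive μ f (2 * t)
      ≤ a * ENNReal.ofReal (2 * t) + ∫⁻ x, ENNReal.ofReal (|f x| - a) ∂μ := primitive_le hf F a _
    _ ≤ 2 * (a * ENNReal.ofReal t + ∫⁻ x, ENNReal.ofReal (|f x| - a) ∂μ) := by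
        rw [ENNReal.ofReal_mul zero_le_two, mul_add, two_mul (∫⁻ x, _ ∂μ), ENNReal.ofReal_ofNat,
          mul_left_comm]
        gcongr
        exact le_self_add
    _ ≤ _ := by gcongr

lemma primitive_zero (t : ℝ) : primitive μ (0 : Ω → ℝ) t = 0 := by
  simp [primitive, rearrangement_zero]

lemma primitive_const_mul_le (c : ℝ) (t : ℝ) :
    primitive μ (fun x => c * f x) t ≤ ‖c‖ₑ * primitive μ f t := by
  rw [primitive, primitive, ← lintegral_const_mul _ measurable_rearrangement]
  exact lintegral_mono fun s => rearrangement_smul_le c s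

lemma primitive_sum_le {F : ℕ → Ω → ℝ} (hF : ∀ i, AEMeasurable (F i) μ) {t : ℝ} (ht : 0 < t)
    (N : ℕ) : primitive μ (fun x => ∑ i ∈ Finset.range N, |F i x|) t ≤
      ∑ i ∈ Finset.range N, primitive μ (F i) t := by
  induction N with
  | zero =>
    simp only [Finset.range_zero, Finset.sum_empty]
    exact (primitive_zero t).le
  | succ N ih =>
    simp only [Finset.sum_range_succ]
    refine (primitive_add_le (f := fun x => ∑ i ∈ Finset.range N, |F i x|)
      (Finset.aemeasurable_fun_sum _ fun i _ => (hF i).abs) (hF N).abs ht).trans ?_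
    exact add_le_add ih (primitive_mono (ae_of_all _ fun x => (abs_abs _).le) t)

lemma enorm_sum_abs (F : ℕ → ℝ) (N : ℕ) :
    ‖∑ i ∈ Finset.range N, |F i|‖ₑ = ∑ i ∈ Finset.range N, ‖F i‖ₑ := by
  rw [Real.enorm_of_nonneg (Finset.sum_nonneg fun i _ => abs_nonneg _),
    ENNReal.ofReal_sum_of_nonneg fun i _ => abs_nonneg _]
  simp only [Real.enorm_eq_ofReal_abs]

lemma coe_lt_enorm_iff {a : ℝ≥0} {y : ℝ} : (a : ℝ≥0∞) < ‖y‖ₑ ↔ (a : ℝ) < |y| := by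
  rw [enorm_eq_nnnorm, ENNReal.coe_lt_coe, ← NNReal.coe_lt_coe, coe_nnnorm, Real.norm_eq_abs]

lemma measure_lt_tsum_le {F : ℕ → Ω → ℝ} {a : ℝ≥0} {c : ℝ≥0∞}
    (h : ∀ N, distribution μ (fun x => ∑ i ∈ Finset.range N, |F i x|) a ≤ c) :
    μ {x | (a : ℝ≥0∞) < ∑' i, ‖F i x‖ₑ} ≤ c := by
  have hm : Monotone fun N : ℕ => {x | (a : ℝ≥0∞) < ∑ i ∈ Finset.range N, ‖F i x‖ₑ} := by
    intro N M hNM x hx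
    simp only [mem_ofPred_eq] at hx ⊢
    exact hx.trans_le (Finset.sum_le_sum_of_subset (Finset.range_mono hNM))
  have hU : {x | (a : ℝ≥0∞) < ∑' i, ‖F i x‖ₑ} =
      ⋃ N, {x | (a : ℝ≥0∞) < ∑ i ∈ Finset.range N, ‖F i x‖ₑ} := by
    ext x
    simp only [mem_ofPred_eq, mem_iUnion, ENNReal.tsum_eq_iSup_nat, lt_iSup_iff]
  rw [hU, hm.measure_iUnion]
  refine iSup_le fun N => le_of_eq_of_le ?_ (h N)
  rw [distribution]
  congr 1
  ext x
  simp only [mem_ofPred_eq]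
  rw [← enorm_sum_abs, coe_lt_enorm_iff]

/-- The Fatou property of the rearrangement: distribution functions of increasing partial sums are
continuous from below. -/
lemma rearrangement_le_iSup {F : ℕ → Ω → ℝ} (h : ∀ᵐ x ∂μ, ‖f x‖ₑ ≤ ∑' i, ‖F i x‖ₑ) (s : ℝ) :
    rearrangement μ f s ≤
      ⨆ N, rearrangement μ (fun x => ∑ i ∈ Finset.range N, |F i x|) s := by
  by_cases htop : ⨆ N, rearrangement μ (fun x => ∑ i ∈ Finset.range N, |F i x|) s = ∞
  · rw [htop]
    exact le_top
  obtain ⟨a, ha⟩ := exists_coe_eq htop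
  rw [← ha, rearrangement_le_iff]
  have h1 : ∀ N, distribution μ (fun x => ∑ i ∈ Finset.range N, |F i x|) a ≤ ENNReal.ofReal s :=
    fun N => rearrangement_le_iff.1 (ha ▸ le_iSup
      (fun N => rearrangement μ (fun x => ∑ i ∈ Finset.range N, |F i x|) s) N)
  refine (measure_mono_ae ?_).trans (measure_lt_tsum_le h1)
  filter_upwards [h] with x hx hxa
  exact (coe_lt_enorm_iff.2 hxa).trans_le hx

/-- Countable subadditivity of `f ↦ ∫₀ᵗ f*`. -/
lemma primitive_le_tsum_nat {F : ℕ → Ω → ℝ} (hF : ∀ i, AEMeasurable (F i) μ)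
    (h : ∀ᵐ x ∂μ, ‖f x‖ₑ ≤ ∑' i, ‖F i x‖ₑ) {t : ℝ} (ht : 0 < t) :
    primitive μ f t ≤ ∑' i, primitive μ (F i) t := by
  calc primitive μ f t
      ≤ ∫⁻ s in Ioo 0 t, ⨆ N, rearrangement μ (fun x => ∑ i ∈ Finset.range N, |F i x|) s :=
        lintegral_mono fun s => rearrangement_le_iSup h s
    _ = ⨆ N, primitive μ (fun x => ∑ i ∈ Finset.range N, |F i x|) t := by
        rw [lintegral_iSup (fun N => measurable_rearrangement)]
        · rfl
        · intro N M hNM s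
          refine rearrangement_mono (ae_of_all _ fun x => ?_) s
          refine abs_le_abs_of_nonneg (Finset.sum_nonneg fun i _ => abs_nonneg _) ?_
          exact Finset.sum_le_sum_of_subset_of_nonneg (Finset.range_mono hNM)
            fun i _ _ => abs_nonneg _
    _ ≤ ∑' i, primitive μ (F i) t :=
        iSup_le fun N => (primitive_sum_le hF ht N).trans (ENNReal.sum_le_tsum _)

lemma primitive_le_tsum {ι : Type*} [Denumerable ι] {F : ι → Ω → ℝ}
    (hF : ∀ i, AEMeasurable (F i) μ) (h : ∀ᵐ x ∂μ, ‖f x‖ₑ ≤ ∑' i, ‖F i x‖ₑ) {t : ℝ} (ht : 0 < t) :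
    primitive μ f t ≤ ∑' i, primitive μ (F i) t := by
  have e := (Denumerable.eqv ι).symm
  rw [← e.tsum_eq]
  refine primitive_le_tsum_nat (fun i => hF _) ?_ ht
  filter_upwards [h] with x hx
  rwa [← e.tsum_eq] at hx

/-- A weak type estimate: if the primitives at t sum to C, then for s ≤ t the sum of the series
exceeds C / s only on a set of measure at most s. -/
lemma ae_tsum_lt_top {ι : Type*} [Denumerable ι] {F : ι → Ω → ℝ}
    (hF : ∀ i, AEMeasurable (F i) μ) {t : ℝ} (ht : 0 < t)
    (hfin : ∑' i, primitive μ (F i) t ≠ ∞) : ∀ᵐ x ∂μ, ∑' i, ‖F i x‖ₑ < ∞ := by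
  let e := (Denumerable.eqv ι).symm
  rw [← e.tsum_eq] at hfin
  suffices ∀ᵐ x ∂μ, ∑' i, ‖F (e i) x‖ₑ < ∞ by
    filter_upwards [this] with x hx
    rwa [← e.tsum_eq]
  obtain ⟨C, hC⟩ := exists_coe_eq hfin
  rw [ae_iff]
  refine le_antisymm (ENNReal.le_of_forall_pos_le_add fun ε hε _ => ?_) zero_le
  rw [zero_add]
  set s : ℝ := min ε t with hs
  have hs0 : 0 < s := lt_min hε ht
  have hsn := ENNReal.ofReal_pos.2 hs0
  obtain ⟨a, ha⟩ := exists_coe_eq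
    (ENNReal.div_ne_top (ENNReal.coe_ne_top (r := C)) hsn.ne')
  have h1 : ∀ N, distribution μ (fun x => ∑ i ∈ Finset.range N, |F (e i) x|) a ≤
      ENNReal.ofReal s := fun N => by
    rw [← rearrangement_le_iff, ha, ENNReal.le_div_iff_mul_le (Or.inl hsn.ne')
      (Or.inl ENNReal.ofReal_ne_top), mul_comm]
    refine (mul_rearrangement_le_primitive s).trans ?_
    refine (primitive_mono_right (min_le_right _ _)).trans ?_
    rw [hC]
    exact (primitive_sum_le (fun i => hF _) ht N).trans (ENNReal.sum_le_tsum _)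
  calc μ {x | ¬ ∑' i, ‖F (e i) x‖ₑ < ∞} ≤ μ {x | (a : ℝ≥0∞) < ∑' i, ‖F (e i) x‖ₑ} := by
        refine measure_mono fun x hx => ?_
        simp only [mem_ofPred_eq, not_lt, top_le_iff] at hx
        simp only [mem_ofPred_eq, hx]
        exact ENNReal.coe_lt_top
    _ ≤ ENNReal.ofReal s := measure_lt_tsum_le h1
    _ ≤ ε := by
        rw [← ENNReal.ofReal_coe_nnreal]
        exact ENNReal.ofReal_le_ofReal (min_le_left _ _)

lemma ae_summable_abs {ι : Type*} [Denumerable ι] {F : ι → Ω → ℝ}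
    (hF : ∀ i, AEMeasurable (F i) μ) {t : ℝ} (ht : 0 < t)
    (hfin : ∑' i, primitive μ (F i) t ≠ ∞) : ∀ᵐ x ∂μ, Summable fun i => |F i x| := by
  filter_upwards [ae_tsum_lt_top hF ht hfin] with x hx
  have := ENNReal.summable_toReal hx.ne
  simpa using this

lemma aemeasurable_tsum_of_summable {ι : Type*} [Countable ι] {F : ι → Ω → ℝ}
    (hF : ∀ i, AEMeasurable (F i) μ) (h : ∀ᵐ x ∂μ, Summable fun i => F i x) :
    AEMeasurable (fun x => ∑' i, F i x) μ := by
  refine aemeasurable_of_tendsto_metrizable_ae (atTop : Filter (Finset ι))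
    (f := fun s x => ∑ i ∈ s, F i x) (fun s => Finset.aemeasurable_fun_sum _ fun i _ => hF i) ?_
  filter_upwards [h] with x hx
  exact hx.hasSum

/-! ### Completeness -/

/-- To the right of a point with ψ ≠ 0 this is monotonicity, to the left it is concavity together
with ψ 0 = 0. -/
lemma IsWeight.pos {γ : ℝ≥0∞} (hψ : IsWeight γ ψ) {t : ℝ} (ht : 0 < t)
    (htγ : ENNReal.ofReal t < γ) : 0 < ψ t := by
  obtain ⟨s, hs, hs0⟩ := hψ.ne_zero
  have hs1 : 0 < ψ s := lt_of_le_of_ne (hψ.nonneg s hs) (Ne.symm hs0)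
  have hst : 0 < s := lt_of_le_of_ne hs.1 fun h => hs0 (h ▸ hψ.map_zero)
  rcases le_total s t with h | h
  · exact hs1.trans_le (hψ.mono hs ⟨ht.le, htγ⟩ h)
  · have h1 := hψ.concave.2 ⟨le_rfl, by simpa using (zero_le.trans_lt htγ)⟩ hs
      (show 0 ≤ 1 - t / s by rw [sub_nonneg]; exact (div_le_one hst).2 h)
      (show 0 ≤ t / s by positivity) (by ring)
    simp only [hψ.map_zero, smul_eq_mul, mul_zero, zero_add, div_mul_cancel₀ _ hst.ne'] at h1
    exact lt_of_lt_of_le (by positivity) h1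

lemma primitive_le_eNorm_mul {t : ℝ} (ht : 0 < t) (htγ : ENNReal.ofReal t < μ univ)
    (hψt : 0 < ψ t) : primitive μ f t ≤ eNorm ψ μ f * ENNReal.ofReal (ψ t) := by
  rw [← ENNReal.div_le_iff (ENNReal.ofReal_pos.2 hψt).ne' ENNReal.ofReal_ne_top]
  exact le_iSup_of_le t (le_iSup₂_of_le ht htγ le_rfl)

lemma eNorm_le_tsum {ι : Type*} [Denumerable ι] {F : ι → Ω → ℝ}
    (hF : ∀ i, AEMeasurable (F i) μ) (h : ∀ᵐ x ∂μ, ‖f x‖ₑ ≤ ∑' i, ‖F i x‖ₑ) :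
    eNorm ψ μ f ≤ ∑' i, eNorm ψ μ (F i) := by
  refine iSup_le fun t => iSup₂_le fun ht hγ => ?_
  refine (ENNReal.div_le_div_right (primitive_le_tsum hF h ht) _).trans ?_
  rw [div_eq_mul_inv, ← ENNReal.tsum_mul_right]
  exact ENNReal.tsum_le_tsum fun i => le_iSup_of_le t (le_iSup₂_of_le ht hγ le_rfl)

lemma enorm_eq_eNorm (f : space ψ μ) : ‖f‖ₑ = eNorm ψ μ (f : Ω →ₘ[μ] ℝ) := by
  rw [← ofReal_norm, norm_def, ENNReal.ofReal_toReal f.2.ne]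

/-- The Riesz–Fischer argument: an absolutely convergent series converges a.e., and countable
subadditivity of the norm bounds the remainders by tails of the series of norms. -/
lemma completeSpace_space (hψ : IsWeight (μ univ) ψ) : CompleteSpace (space ψ μ) := by
  refine NormedAddCommGroup.completeSpace_of_summable_imp_tendsto fun u hu => ?_
  obtain ⟨t, ht, htψ⟩ := hψ.ne_zero
  have ht0 : 0 < t := lt_of_le_of_ne ht.1 fun h => htψ (h ▸ hψ.map_zero)
  have hfin : ∑' i, eNorm ψ μ (u i : Ω →ₘ[μ] ℝ) ≠ ∞ := by
    simp only [← enorm_eq_eNorm, ← ofReal_norm]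
    exact hu.tsum_ofReal_ne_top
  have hm : ∀ i, AEMeasurable (u i : Ω →ₘ[μ] ℝ) μ := fun i => AEEqFun.aemeasurable _
  have hprim : ∑' i, primitive μ (u i : Ω →ₘ[μ] ℝ) t ≠ ∞ := by
    refine ne_top_of_le_ne_top ?_ (ENNReal.tsum_le_tsum fun i =>
      primitive_le_eNorm_mul ht0 ht.2 (hψ.pos ht0 ht.2))
    rw [ENNReal.tsum_mul_right]
    exact ENNReal.mul_ne_top hfin ENNReal.ofReal_ne_top
  have hs : ∀ᵐ x ∂μ, Summable fun i => (u i : Ω →ₘ[μ] ℝ) x := by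
    filter_upwards [ae_summable_abs hm ht0 hprim] with x hx
    exact hx.of_abs
  have hFm := aemeasurable_tsum_of_summable hm hs
  let F : Ω →ₘ[μ] ℝ := AEEqFun.mk _ hFm.aestronglyMeasurable
  have hF : F =ᵐ[μ] fun x => ∑' i, (u i : Ω →ₘ[μ] ℝ) x := AEEqFun.coeFn_mk _ _
  have hFmem : F ∈ space ψ μ := by
    change eNorm ψ μ F < ∞
    refine (eNorm_le_tsum hm ?_).trans_lt hfin.lt_top
    filter_upwards [hF] with x hx
    rw [hx]
    exact enorm_tsum_le_tsum_enorm
  refine ⟨⟨F, hFmem⟩, ?_⟩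
  rw [tendsto_iff_edist_tendsto_0]
  refine tendsto_of_tendsto_of_tendsto_of_le_of_le tendsto_const_nhds
    (ENNReal.tendsto_sum_nat_add _ hfin) (fun _ => zero_le) fun N => ?_
  rw [edist_comm, edist_eq_enorm_sub, enorm_eq_eNorm]
  refine eNorm_le_tsum (fun i => hm (i + N)) ?_
  have hsum : ((∑ i ∈ Finset.range N, u i : space ψ μ) : Ω →ₘ[μ] ℝ) =ᵐ[μ]
      fun x => ∑ i ∈ Finset.range N, (u i : Ω →ₘ[μ] ℝ) x := by
    induction N with
    | zero =>
      simp only [Finset.range_zero, Finset.sum_empty, Submodule.coe_zero]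
      exact AEEqFun.coeFn_zero
    | succ N ih =>
      simp only [Finset.sum_range_succ, Submodule.coe_add]
      filter_upwards [ih, AEEqFun.coeFn_add ((∑ i ∈ Finset.range N, u i : space ψ μ) : Ω →ₘ[μ] ℝ)
        (u N : Ω →ₘ[μ] ℝ)] with x h1 h2
      rw [h2, Pi.add_apply, h1]
  filter_upwards [hF, hs, hsum, AEEqFun.coeFn_sub F
    ((∑ i ∈ Finset.range N, u i : space ψ μ) : Ω →ₘ[μ] ℝ)] with x h1 h2 h3 h4
  rw [AddSubgroupClass.coe_sub, h4, Pi.sub_apply, h1, h3, ← h2.sum_add_tsum_nat_add N,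
    add_sub_cancel_left]
  exact enorm_tsum_le_tsum_enorm

end Primitive

/-! ### Dyadic gauges -/

section Gauge

variable {Ω : Type*} [MeasurableSpace Ω] {μ : Measure Ω} {ψ : ℝ → ℝ}

/-- The sequence `v i`, `i ∈ ℤ`, replaces `ψ (2 ^ i) / 2 ^ i` in the definition of the norm of
`M_ψ(μ)`, up to constants. -/
structure IsDyadicGauge (ψ : ℝ → ℝ) (μ : Measure Ω) (v : ℤ → ℝ) (q : ℝ) (C : ℝ≥0) : Prop where
  pos : ∀ i, 0 < v i
  anti : Antitone v
  one_lt : 1 < q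
  growth : ∀ i, q * v i ≤ 2 * v (i + 1)
  primitive_le : ∀ f : Ω → ℝ, AEMeasurable f μ → ∀ i : ℤ,
    primitive μ f (2 ^ i) ≤ C * eNorm ψ μ f * ENNReal.ofReal (2 ^ i * v i)
  eNorm_le : ∀ (f : Ω → ℝ) (c : ℝ≥0∞),
    (∀ i : ℤ, primitive μ f (2 ^ i) ≤ c * ENNReal.ofReal (2 ^ i * v i)) → eNorm ψ μ f ≤ C * c

/-- Between 2^l and 2^{l+1} the primitive is at most its value at 2^{l+1}, and monotonicity of v
costs a factor 2. -/
lemma eNorm_le_of_dyadic {v : ℤ → ℝ} (hanti : Antitone v) {C : ℝ} (hC : 0 ≤ C)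
    (hpos : ∀ t, 0 < t → ENNReal.ofReal t < μ univ → 0 < ψ t)
    (h : ∀ t, 0 < t → ENNReal.ofReal t < μ univ → ∀ l : ℤ, (2 : ℝ) ^ l ≤ t → 2 ^ l * v l ≤ C * ψ t)
    {f : Ω → ℝ} {c : ℝ≥0∞}
    (hf : ∀ i : ℤ, primitive μ f (2 ^ i) ≤ c * ENNReal.ofReal (2 ^ i * v i)) :
    eNorm ψ μ f ≤ ENNReal.ofReal (2 * C) * c := by
  refine iSup_le fun t => iSup₂_le fun ht hγ => ?_
  have hl1 := Int.zpow_log_le_self (b := 2) one_lt_two ht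
  have hl2 := Int.lt_zpow_succ_log_self (b := 2) one_lt_two t
  set l := Int.log 2 t
  push_cast at hl1 hl2
  rw [ENNReal.div_le_iff (ENNReal.ofReal_pos.2 (hpos t ht hγ)).ne' ENNReal.ofReal_ne_top]
  calc primitive μ f t ≤ primitive μ f (2 ^ (l + 1)) := primitive_mono_right hl2.le
    _ ≤ c * ENNReal.ofReal (2 ^ (l + 1) * v (l + 1)) := hf _
    _ ≤ c * ENNReal.ofReal (2 * C * ψ t) := by
        refine mul_le_mul_right (ENNReal.ofReal_le_ofReal ?_) c
        have h1 := h t ht hγ l hl1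
        have h2 := hanti (show l ≤ l + 1 by omega)
        have h3 : (0 : ℝ) < 2 ^ l := by positivity
        rw [zpow_add_one₀ two_ne_zero]
        nlinarith [mul_le_mul_of_nonneg_left h2 h3.le]
    _ = ENNReal.ofReal (2 * C) * c * ENNReal.ofReal (ψ t) := by
        rw [ENNReal.ofReal_mul (by positivity)]
        ring

lemma IsWeight.div_anti {γ : ℝ≥0∞} (hψ : IsWeight γ ψ) {s t : ℝ} (hs : 0 < s) (hst : s ≤ t)
    (ht : ENNReal.ofReal t < γ) : ψ t / t ≤ ψ s / s := by
  have ht0 : 0 < t := hs.trans_le hst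
  have h1 := hψ.concave.2 ⟨le_rfl, by simpa using (zero_le.trans_lt ht)⟩ ⟨ht0.le, ht⟩
      (show 0 ≤ 1 - s / t by rw [sub_nonneg]; exact (div_le_one ht0).2 hst)
      (show 0 ≤ s / t by positivity) (by ring)
  simp only [hψ.map_zero, smul_eq_mul, mul_zero, zero_add, div_mul_cancel₀ _ ht0.ne'] at h1
  rw [le_div_iff₀ hs]
  calc ψ t / t * s = s / t * ψ t := by ring
    _ ≤ ψ s := h1

lemma exists_eventually_mul_le {l : Filter ℝ}
    (h : 1 < liminf (fun t : ℝ => ((ψ (2 * t) / ψ t : ℝ) : EReal)) l)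
    (hpos : ∀ᶠ t in l, 0 < ψ t) : ∃ q : ℝ, 1 < q ∧ ∀ᶠ t in l, q * ψ t ≤ ψ (2 * t) := by
  obtain ⟨q, hq1, hq⟩ := EReal.lt_iff_exists_real_btwn.1 h
  refine ⟨q, by exact_mod_cast hq1, ?_⟩
  filter_upwards [eventually_lt_of_lt_liminf hq, hpos] with t ht ht0
  have h1 : q < ψ (2 * t) / ψ t := by exact_mod_cast ht
  exact ((lt_div_iff₀ ht0).1 h1).le

/-- Take v i = ψ(2^i)/2^i. The two liminf conditions give growth for all but finitely many i; for
the rest ψ(2t) > ψ(t) suffices, and a common q > 1 exists. -/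
lemma exists_isDyadicGauge_of_conditionA (hψ : IsWeight (μ univ) ψ)
    (h : ConditionA (μ univ) ψ) : ∃ v q C, IsDyadicGauge ψ μ v q C := by
  obtain ⟨hγ, h0, hinf⟩ := h
  have hlt : ∀ t : ℝ, ENNReal.ofReal t < μ univ := fun t => by
    rw [hγ]; exact ENNReal.ofReal_lt_top
  have hpos : ∀ t, 0 < t → 0 < ψ t := fun t ht => hψ.pos ht (hlt t)
  have hmono : ∀ s t, 0 < s → s ≤ t → ψ s ≤ ψ t := fun s t hs hst =>
    hψ.mono ⟨hs.le, hlt s⟩ ⟨(hs.trans_le hst).le, hlt t⟩ hst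
  obtain ⟨q₀, hq₀, hev₀⟩ := exists_eventually_mul_le h0
    (eventually_mem_nhdsWithin.mono fun t ht => hpos t ht)
  obtain ⟨q₁, hq₁, hev₁⟩ := exists_eventually_mul_le hinf
    ((eventually_gt_atTop 0).mono fun t ht => hpos t ht)
  rw [eventually_nhdsWithin_iff, Metric.eventually_nhds_iff] at hev₀
  obtain ⟨ε, hε, hev₀⟩ := hev₀
  obtain ⟨R, hR⟩ := eventually_atTop.1 hev₁
  -- A concave function that gains between t and a far point 2s gains already between t and 2t, as
  -- 2t is a proper convex combination of t and 2s.
  have hstrict : ∀ t, 0 < t → ψ t < ψ (2 * t) := by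
    intro t ht
    set s := max R (2 * t) with hs
    have hst : 2 * t ≤ s := le_max_right _ _
    have hs0 : 0 < s := by linarith
    have h1 : ψ t < ψ (2 * s) := by
      have h2 := hR s (le_max_left _ _)
      have h3 := hmono t s ht (by linarith)
      have h4 := hpos s hs0
      nlinarith
    have hd : 0 < 2 * s - t := by linarith
    have hle : t / (2 * s - t) < 1 := (div_lt_one hd).2 (by linarith)
    have h5 := hψ.concave.2 ⟨ht.le, hlt t⟩ ⟨(by positivity : (0 : ℝ) ≤ 2 * s), hlt (2 * s)⟩
      (sub_nonneg.2 hle.le) (show 0 ≤ t / (2 * s - t) by positivity) (by ring)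
    have h6 : (1 - t / (2 * s - t)) • t + (t / (2 * s - t)) • (2 * s) = 2 * t := by
      simp only [smul_eq_mul]
      field_simp
      ring
    rw [h6] at h5
    simp only [smul_eq_mul] at h5
    have h7 : 0 < t / (2 * s - t) := by positivity
    nlinarith [mul_lt_mul_of_pos_left h1 h7]
  set m := Int.log 2 ε
  set M := Int.log 2 (max R 1) + 1
  have hfin : ∀ᶠ q in 𝓝[>] (1 : ℝ), ∀ i ∈ Finset.Icc m M,
      q ≤ ψ (2 * 2 ^ i) / ψ (2 ^ i) := by
    refine (Finset.eventually_all _).2 fun i _ => mem_nhdsWithin_of_mem_nhds (Iic_mem_nhds ?_)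
    have := hpos (2 ^ i) (by positivity)
    rw [lt_div_iff₀ this, one_mul]
    exact hstrict _ (by positivity)
  obtain ⟨q, ⟨⟨hq, hqq₀⟩, hqq₁⟩, hq1⟩ := (((hfin.and (mem_nhdsWithin_of_mem_nhds
    (Iic_mem_nhds hq₀))).and (mem_nhdsWithin_of_mem_nhds (Iic_mem_nhds hq₁))).and
    self_mem_nhdsWithin).exists
  replace hqq₀ : q ≤ q₀ := hqq₀
  replace hqq₁ : q ≤ q₁ := hqq₁
  have hgrow : ∀ i : ℤ, q * ψ (2 ^ i) ≤ ψ (2 * 2 ^ i) := by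
    intro i
    have h2i : (0 : ℝ) < 2 ^ i := by positivity
    have hψi := hpos _ h2i
    by_cases him : i < m
    · have h1 : (2 : ℝ) ^ i < ε := by
        refine (zpow_lt_zpow_right₀ one_lt_two him).trans_le ?_
        exact_mod_cast Int.zpow_log_le_self (b := 2) one_lt_two hε
      have h2 := hev₀ (y := 2 ^ i) (by rwa [Real.dist_eq, sub_zero, abs_of_pos h2i]) h2i
      exact (mul_le_mul_of_nonneg_right hqq₀ hψi.le).trans h2
    by_cases hiM : M < i
    · have h1 : R ≤ 2 ^ i := by
        have h2 := Int.lt_zpow_succ_log_self (b := 2) one_lt_two (max R 1)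
        push_cast at h2
        exact (le_max_left _ _).trans (h2.le.trans (zpow_le_zpow_right₀ one_le_two hiM.le))
      exact (mul_le_mul_of_nonneg_right hqq₁ hψi.le).trans (hR _ h1)
    · have := hq i (Finset.mem_Icc.2 ⟨not_lt.1 him, not_lt.1 hiM⟩)
      rwa [le_div_iff₀ hψi] at this
  have hmul : ∀ i : ℤ, (2 : ℝ) ^ i * (ψ (2 ^ i) / 2 ^ i) = ψ (2 ^ i) := fun i =>
    mul_div_cancel₀ _ (by positivity)
  have hanti : Antitone fun i : ℤ => ψ (2 ^ i) / 2 ^ i := fun i j hij =>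
    hψ.div_anti (by positivity) (zpow_le_zpow_right₀ one_le_two hij) (hlt _)
  refine ⟨fun i => ψ (2 ^ i) / 2 ^ i, q, 2, ?_, hanti, hq1, ?_, ?_, ?_⟩
  · intro i
    have := hpos (2 ^ i) (by positivity)
    positivity
  · intro i
    have := hgrow i
    have h2i : (0 : ℝ) < 2 ^ i := by positivity
    rw [zpow_add_one₀ two_ne_zero, mul_comm _ (2 : ℝ), ← mul_div_assoc, ← mul_div_assoc,
      mul_div_mul_left _ _ two_ne_zero]
    gcongr
  · intro f hf i
    rw [hmul]
    refine (primitive_le_eNorm_mul (by positivity) (hlt _) (hpos _ (by positivity))).trans ?_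
    gcongr
    refine le_mul_of_one_le_left zero_le ?_
    norm_num
  · intro f c hfc
    have := eNorm_le_of_dyadic hanti (C := 1) zero_le_one (fun t ht _ => hpos t ht)
      (fun t ht _ l hl => by
        rw [hmul, one_mul]
        exact hmono _ _ (by positivity) hl) hfc
    simpa using this

/-- The hypothesis only speaks of small t, so v is frozen beyond an index j₀ with 2^{j₀} below ε and
γ. There 2^i v i doubles at each step, which is growth with factor 2 and is matched by the doubling
bound for primitives, even beyond γ. -/
lemma exists_isDyadicGauge_of_conditionB (hψ : IsWeight (μ univ) ψ)
    (h : ConditionB (μ univ) ψ) : ∃ v q C, IsDyadicGauge ψ μ v q C := by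
  obtain ⟨hγ, h0⟩ := h
  set γ := (μ univ).toReal with hγdef
  have hγ0 : 0 < γ := by
    obtain ⟨s, hs, hs0⟩ := hψ.ne_zero
    exact ENNReal.toReal_pos (zero_le.trans_lt hs.2).ne' hγ.ne
  have hlt : ∀ t : ℝ, 0 < t → (ENNReal.ofReal t < μ univ ↔ t < γ) := fun t ht =>
    ENNReal.ofReal_lt_iff_lt_toReal ht.le hγ.ne
  have hpos : ∀ t, 0 < t → ENNReal.ofReal t < μ univ → 0 < ψ t := fun t ht h => hψ.pos ht h
  have hmono : ∀ s t, 0 < s → s ≤ t → t < γ → ψ s ≤ ψ t := fun s t hs hst ht =>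
    hψ.mono ⟨hs.le, (hlt s hs).2 (hst.trans_lt ht)⟩
      ⟨(hs.trans_le hst).le, (hlt t (hs.trans_le hst)).2 ht⟩ hst
  obtain ⟨q₀, hq₀, hev₀⟩ := exists_eventually_mul_le h0 (by
    filter_upwards [Ioo_mem_nhdsGT hγ0] with t ht
    exact hpos t ht.1 ((hlt t ht.1).2 ht.2))
  rw [eventually_nhdsWithin_iff, Metric.eventually_nhds_iff] at hev₀
  obtain ⟨ε, hε, hev₀⟩ := hev₀
  obtain ⟨j₀, hj₀ε, hj₀γ⟩ : ∃ j₀ : ℤ, (2 : ℝ) ^ j₀ < ε ∧ (2 : ℝ) ^ j₀ < γ := by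
    have h1 := Int.zpow_log_le_self (b := 2) one_lt_two (lt_min hε hγ0)
    push_cast at h1
    have h2 : (2 : ℝ) ^ (Int.log 2 (min ε γ) - 1) < min ε γ :=
      (zpow_lt_zpow_right₀ one_lt_two (by omega)).trans_le h1
    exact ⟨_, h2.trans_le (min_le_left _ _), h2.trans_le (min_le_right _ _)⟩
  have hjγ : ∀ i ≤ j₀, (2 : ℝ) ^ i < γ := fun i hi =>
    (zpow_le_zpow_right₀ one_le_two hi).trans_lt hj₀γ
  have hjpos : ∀ i ≤ j₀, 0 < ψ (2 ^ i) := fun i hi =>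
    hpos _ (by positivity) ((hlt _ (by positivity)).2 (hjγ i hi))
  obtain ⟨v, hv⟩ : ∃ v : ℤ → ℝ, ∀ i, v i = ψ (2 ^ min i j₀) / 2 ^ min i j₀ := ⟨_, fun i => rfl⟩
  have hv1 : ∀ i ≤ j₀, 2 ^ i * v i = ψ (2 ^ i) := fun i hi => by
    rw [hv, min_eq_left hi]
    exact mul_div_cancel₀ _ (by positivity)
  have hv2 : ∀ i, j₀ ≤ i → v i = v j₀ := fun i hi => by
    rw [hv, hv, min_eq_right hi, min_self]
  have hanti : Antitone v := fun i j hij => by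
    rw [hv, hv]
    refine hψ.div_anti (by positivity)
      (zpow_le_zpow_right₀ one_le_two (min_le_min_right _ hij)) ?_
    exact (hlt _ (by positivity)).2 (hjγ _ (min_le_right _ _))
  have hvpos : ∀ i, 0 < v i := fun i => by
    rw [hv]
    have := hjpos (min i j₀) (min_le_right _ _)
    positivity
  -- For 2^{j₀} ≤ 2^l ≤ t < γ, the frozen value 2^l v j₀ exceeds ψ(2^{j₀}) at most by the factor γ /
  -- 2^{j₀}.
  obtain ⟨C, hC⟩ : ∃ C : ℝ, C = max 1 (γ / 2 ^ j₀) := ⟨_, rfl⟩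
  have hC1 : 1 ≤ C := hC ▸ le_max_left _ _
  refine ⟨v, min q₀ 2, (2 * C).toNNReal, hvpos, hanti, lt_min hq₀ one_lt_two, ?_, ?_, ?_⟩
  · intro i
    rcases lt_or_ge i j₀ with hi | hi
    · have h2i : (0 : ℝ) < 2 ^ i := by positivity
      have h1 := hev₀ (y := 2 ^ i) (by
        rw [Real.dist_eq, sub_zero, abs_of_pos h2i]
        exact (zpow_le_zpow_right₀ one_le_two hi.le).trans_lt hj₀ε) h2i
      have h2 : (2 : ℝ) * 2 ^ i = 2 ^ (i + 1) := by rw [zpow_add_one₀ two_ne_zero, mul_comm]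
      rw [h2, ← hv1 i hi.le, ← hv1 (i + 1) hi, ← h2] at h1
      have h3 : 2 ^ i * (q₀ * v i) ≤ 2 ^ i * (2 * v (i + 1)) := by linarith
      have h4 := le_of_mul_le_mul_left h3 h2i
      exact (mul_le_mul_of_nonneg_right (min_le_left _ _) (hvpos i).le).trans h4
    · rw [hv2 i hi, hv2 (i + 1) (by omega)]
      exact mul_le_mul_of_nonneg_right (min_le_right _ _) (hvpos j₀).le
  · intro f hf i
    have h1 : ∀ i ≤ j₀, primitive μ f (2 ^ i) ≤ eNorm ψ μ f * ENNReal.ofReal (2 ^ i * v i) :=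
      fun i hi => by
        rw [hv1 i hi]
        exact primitive_le_eNorm_mul (by positivity) ((hlt _ (by positivity)).2 (hjγ i hi))
          (hjpos i hi)
    have h2 : ∀ n : ℕ, primitive μ f (2 ^ (j₀ + n)) ≤
        eNorm ψ μ f * ENNReal.ofReal (2 ^ (j₀ + n) * v (j₀ + n)) := by
      intro n
      induction n with
      | zero => simpa using h1 j₀ le_rfl
      | succ n ih =>
        have e : (2 : ℝ) ^ (j₀ + ((n + 1 : ℕ) : ℤ)) = 2 * 2 ^ (j₀ + (n : ℤ)) := by
          rw [Nat.cast_succ, ← add_assoc, zpow_add_one₀ two_ne_zero, mul_comm]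
        rw [e]
        refine (primitive_two_mul_le hf (by positivity)).trans ?_
        rw [hv2 (j₀ + ((n + 1 : ℕ) : ℤ)) (by omega), ← hv2 (j₀ + (n : ℤ)) (by omega), mul_assoc,
          ENNReal.ofReal_mul zero_le_two, ENNReal.ofReal_ofNat, mul_left_comm]
        gcongr
    have h3 : primitive μ f (2 ^ i) ≤ eNorm ψ μ f * ENNReal.ofReal (2 ^ i * v i) := by
      rcases le_total i j₀ with hi | hi
      · exact h1 i hi
      · obtain ⟨n, rfl⟩ := Int.le.dest hi
        exact h2 n
    refine h3.trans ?_
    gcongr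
    refine le_mul_of_one_le_left zero_le ?_
    rw [ENNReal.one_le_coe_iff, Real.one_le_toNNReal]
    linarith
  · intro f c hfc
    refine eNorm_le_of_dyadic hanti (by linarith) hpos (fun t ht htγ l hl => ?_) hfc
    rw [hlt t ht] at htγ
    have h2l : (0 : ℝ) < 2 ^ l := by positivity
    rcases le_total l j₀ with hlj | hlj
    · rw [hv1 l hlj]
      have h1 := hmono _ _ h2l hl htγ
      have h2 := hjpos l hlj
      nlinarith
    · rw [hv2 l hlj, hv, min_self]
      have h1 : (2 : ℝ) ^ j₀ ≤ t := (zpow_le_zpow_right₀ one_le_two hlj).trans hl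
      have h2 := hmono _ _ (by positivity) h1 htγ
      have h3 := hjpos j₀ le_rfl
      calc (2 : ℝ) ^ l * (ψ (2 ^ j₀) / 2 ^ j₀) = 2 ^ l / 2 ^ j₀ * ψ (2 ^ j₀) := by ring
        _ ≤ γ / 2 ^ j₀ * ψ t := by
            gcongr
            exact hl.trans htγ.le
        _ ≤ C * ψ t := by
            gcongr
            · linarith
            · exact hC ▸ le_max_right _ _

lemma exists_isDyadicGauge (hψ : IsWeight (μ univ) ψ)
    (h : ConditionA (μ univ) ψ ∨ ConditionB (μ univ) ψ) : ∃ v q C, IsDyadicGauge ψ μ v q C :=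
  h.elim (exists_isDyadicGauge_of_conditionA hψ) (exists_isDyadicGauge_of_conditionB hψ)

end Gauge

/-! ### Order intervals -/

section OrderInterval

variable {Ω : Type*} [MeasurableSpace Ω] {μ : Measure Ω} {ψ : ℝ → ℝ}

lemma norm_le_norm_of_ae_le {f g : space ψ μ}
    (h : ∀ᵐ y ∂μ, |(f : Ω →ₘ[μ] ℝ) y| ≤ |(g : Ω →ₘ[μ] ℝ) y|) : ‖f‖ ≤ ‖g‖ := by
  rw [norm_def, norm_def]
  exact ENNReal.toReal_mono g.2.ne (eNorm_mono h)

/-- The space of bounded measurable functions. -/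
def boundedMeasurable (Ω : Type*) [MeasurableSpace Ω] : Submodule ℝ (Ω → ℝ) where
  carrier := {h | Measurable h ∧ ∃ c : ℝ, ∀ y, |h y| ≤ c}
  zero_mem' := ⟨measurable_zero, 0, fun y => by simp⟩
  add_mem' := by
    rintro h k ⟨hm, c, hc⟩ ⟨km, d, hd⟩
    exact ⟨hm.add km, c + d, fun y => (abs_add_le _ _).trans (add_le_add (hc y) (hd y))⟩
  smul_mem' := by
    rintro a h ⟨hm, c, hc⟩
    refine ⟨hm.const_smul a, |a| * c, fun y => ?_⟩
    rw [Pi.smul_apply, smul_eq_mul, abs_mul]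
    exact mul_le_mul_of_nonneg_left (hc y) (abs_nonneg a)

/-- The element of `M_ψ(μ)` given by a measurable function of finite norm. -/
def toSpace (f : Ω → ℝ) (hf : AEMeasurable f μ) (hfin : eNorm ψ μ f < ∞) : space ψ μ :=
  ⟨AEEqFun.mk f hf.aestronglyMeasurable, by
    change eNorm ψ μ _ < ∞
    rwa [eNorm_congr (AEEqFun.coeFn_mk _ _)]⟩

lemma coe_toSpace {f : Ω → ℝ} (hf : AEMeasurable f μ) (hfin : eNorm ψ μ f < ∞) :
    (toSpace f hf hfin : Ω →ₘ[μ] ℝ) =ᵐ[μ] f :=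
  AEEqFun.coeFn_mk _ _

/-- The linear map into `M_ψ(μ)` given by a map into functions which is linear a.e. -/
def toSpaceLinear {Z : Type*} [AddCommGroup Z] [Module ℝ Z] (T : Z → Ω → ℝ)
    (hT : ∀ z, AEMeasurable (T z) μ) (hfin : ∀ z, eNorm ψ μ (T z) < ∞)
    (hadd : ∀ z w, T (z + w) =ᵐ[μ] T z + T w) (hsmul : ∀ (a : ℝ) z, T (a • z) =ᵐ[μ] a • T z) :
    Z →ₗ[ℝ] space ψ μ where
  toFun z := toSpace (T z) (hT z) (hfin z)
  map_add' z w := by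
    refine Subtype.ext (AEEqFun.ext ?_)
    rw [Submodule.coe_add]
    exact (coe_toSpace _ _).trans ((hadd z w).trans (((coe_toSpace (hT z) (hfin z)).symm.add
      (coe_toSpace (hT w) (hfin w)).symm).trans (AEEqFun.coeFn_add _ _).symm))
  map_smul' a z := by
    refine Subtype.ext (AEEqFun.ext ?_)
    rw [RingHom.id_apply, Submodule.coe_smul]
    exact (coe_toSpace _ _).trans ((hsmul a z).trans
      (((coe_toSpace (hT z) (hfin z)).symm.const_smul a).trans (AEEqFun.coeFn_smul _ _).symm))

lemma coe_toSpaceLinear {Z : Type*} [AddCommGroup Z] [Module ℝ Z] {T : Z → Ω → ℝ}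
    (hT : ∀ z, AEMeasurable (T z) μ) (hfin : ∀ z, eNorm ψ μ (T z) < ∞)
    (hadd : ∀ z w, T (z + w) =ᵐ[μ] T z + T w) (hsmul : ∀ (a : ℝ) z, T (a • z) =ᵐ[μ] a • T z)
    (z : Z) : ((toSpaceLinear T hT hfin hadd hsmul z : space ψ μ) : Ω →ₘ[μ] ℝ) =ᵐ[μ] T z :=
  coe_toSpace (hT z) (hfin z)

lemma eNorm_mul_lt_top (e : space ψ μ) {h : Ω → ℝ} {c : ℝ} (hc : ∀ y, |h y| ≤ c) :
    eNorm ψ μ (fun y => (e : Ω →ₘ[μ] ℝ) y * h y) < ∞ := by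
  refine lt_of_le_of_lt (eNorm_mono (g := c • ((e : Ω →ₘ[μ] ℝ) : Ω → ℝ)) (ae_of_all _ fun y => ?_))
    ((eNorm_smul_le c).trans_lt (ENNReal.mul_lt_top enorm_lt_top e.2))
  rw [Pi.smul_apply, smul_eq_mul, abs_mul, abs_mul, mul_comm]
  exact mul_le_mul_of_nonneg_right ((hc y).trans (le_abs_self c)) (abs_nonneg _)

/-- Multiplication of bounded measurable functions with an element of `M_ψ(μ)`. -/
def mulMap (e : space ψ μ) : boundedMeasurable Ω →ₗ[ℝ] space ψ μ :=
  toSpaceLinear (fun h y => (e : Ω →ₘ[μ] ℝ) y * (h : Ω → ℝ) y)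
    (fun h => (AEEqFun.aemeasurable _).mul h.2.1.aemeasurable)
    (fun h => eNorm_mul_lt_top e h.2.2.choose_spec)
    (fun _ _ => ae_of_all _ fun _ => mul_add _ _ _)
    (fun _ _ => ae_of_all _ fun _ => mul_left_comm _ _ _)

lemma coe_mulMap (e : space ψ μ) (h : boundedMeasurable Ω) :
    ((mulMap e h : space ψ μ) : Ω →ₘ[μ] ℝ) =ᵐ[μ]
      fun y => (e : Ω →ₘ[μ] ℝ) y * (h : Ω → ℝ) y :=
  coe_toSpaceLinear _ _ _ _ h

/-- The unit ball of the bounded measurable functions. -/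
def measurableBall (Ω : Type*) [MeasurableSpace Ω] : Set (Ω → ℝ) :=
  {h | Measurable h ∧ ∀ y, |h y| ≤ 1}

lemma isSectionBall_measurableBall : IsSectionBall id (measurableBall Ω) where
  zero_mem := ⟨measurable_zero, fun y => by simp⟩
  mul_mem w hw hw1 H hH := ⟨hw.mul hH.1, fun y => by
    rw [abs_mul]
    exact mul_le_one₀ (hw1 _) (abs_nonneg _) (hH.2 y)⟩
  convex_mem w hw hw0 hw1 H hH K hK := by
    refine ⟨(hw.mul hH.1).add ((measurable_const.sub hw).mul hK.1), fun y => ?_⟩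
    have h1 := abs_le.1 (hH.2 y)
    have h2 := abs_le.1 (hK.2 y)
    have h3 := hw0 y
    have h4 := hw1 y
    simp only [id]
    rw [abs_le]
    constructor <;> nlinarith
  glue_mem E hE hd H hH K hKE hK0 := by
    constructor
    · intro s hs
      have : K ⁻¹' s = (⋃ i, E i ∩ H i ⁻¹' s) ∪ ((⋃ i, E i)ᶜ ∩ {_y | (0 : ℝ) ∈ s}) := by
        ext y
        simp only [mem_preimage, mem_union, mem_iUnion, mem_inter_iff, mem_compl_iff, not_exists,
          mem_ofPred_eq]
        by_cases hy : ∃ i, y ∈ E i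
        · obtain ⟨i, hi⟩ := hy
          constructor
          · intro h
            exact Or.inl ⟨i, hi, hKE i y hi ▸ h⟩
          · rintro (⟨j, hj, h⟩ | ⟨h, -⟩)
            · rw [hKE j y hj]
              exact h
            · exact absurd hi (h i)
        · push Not at hy
          simp [hy, hK0 y hy]
      rw [this]
      refine (MeasurableSet.iUnion fun i => (hE i).inter ((hH i).1 hs)).union
        ((MeasurableSet.iUnion hE).compl.inter (MeasurableSet.const _))
    · intro y
      by_cases hy : ∃ i, y ∈ E i
      · obtain ⟨i, hi⟩ := hy
        rw [hKE i y hi]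
        exact (hH i).2 y
      · push Not at hy
        simp [hK0 y hy]

lemma apply_convexHull_ge {E : Type*} [AddCommGroup E] [Module ℝ E] (ζ : E →ₗ[ℝ] ℝ) {x : ℕ → E}
    {i : ℕ} {ε : ℝ} (h : ∀ k ≥ i, ε ≤ ζ (x k)) {g : E} (hg : g ∈ convexHull ℝ (x '' Ici i)) :
    ε ≤ ζ g := by
  refine convexHull_min (t := {g | ε ≤ ζ g}) ?_ (convex_halfSpace_ge ζ.isLinear ε) hg
  rintro _ ⟨k, hk, rfl⟩
  exact h k hk

/-- On an order interval, a weak* null sequence of functionals converges uniformly on suitable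
convex blocks of every sequence. -/
lemma not_forall_le_of_order_bounded {φ : ℕ → StrongDual ℝ (space ψ μ)}
    (hφ : ∀ f, Tendsto (fun n => φ n f) atTop (𝓝 0)) {C : ℝ} (hC : ∀ n, ‖φ n‖ ≤ C)
    (e : space ψ μ) {x : ℕ → space ψ μ}
    (hx : ∀ i, ∀ᵐ y ∂μ, |(x i : Ω →ₘ[μ] ℝ) y| ≤ |(e : Ω →ₘ[μ] ℝ) y|) {ε : ℝ} (hε : 0 < ε) :
    ¬ ∀ n i, n ≤ i → ε ≤ φ n (x i) := by
  intro hcon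
  -- Moduli are defined for functionals on all functions, so the multiplication map is extended
  -- algebraically; only its values on the ball matter.
  obtain ⟨R, hR⟩ := (mulMap e).exists_extend
  have hRe : ∀ h (hh : h ∈ measurableBall Ω), R h = mulMap e ⟨h, hh.1, 1, hh.2⟩ :=
    fun h hh => congrArg (fun L => L ⟨h, hh.1, 1, hh.2⟩) hR
  have hRn : ∀ h ∈ measurableBall Ω, ‖R h‖ ≤ ‖e‖ := fun h hh => by
    rw [hRe h hh]
    refine norm_le_norm_of_ae_le ?_
    filter_upwards [coe_mulMap e ⟨h, hh.1, 1, hh.2⟩] with y hy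
    rw [hy, abs_mul]
    exact mul_le_of_le_one_right (abs_nonneg _) (hh.2 y)
  have hC0 : 0 ≤ C := (norm_nonneg _).trans (hC 0)
  set D := C * ‖e‖ + 1 with hD
  have hD0 : 0 < D := by positivity
  let ζ : ℕ → (Ω → ℝ) →ₗ[ℝ] ℝ := fun n => (φ n : space ψ μ →ₗ[ℝ] ℝ) ∘ₗ R
  have hζ : ∀ n, ∀ h ∈ measurableBall Ω, ζ n h ≤ D := fun n h hh => by
    have h1 := (le_abs_self _).trans ((φ n).le_opNorm (R h))
    have h2 := mul_le_mul (hC n) (hRn h hh) (norm_nonneg _) hC0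
    change φ n (R h) ≤ D
    linarith
  have hlim : ∀ h ∈ measurableBall Ω, Tendsto (fun n => ζ n h) atTop (𝓝 0) := fun h _ => hφ (R h)
  -- The quotient x i / e; where e = 0 also x i = 0 a.e., and the truncation only makes the bound 1
  -- hold everywhere.
  let k : ℕ → Ω → ℝ := fun i y => max (-1) (min 1 ((x i : Ω →ₘ[μ] ℝ) y / (e : Ω →ₘ[μ] ℝ) y))
  have hk : ∀ i, k i ∈ measurableBall Ω := fun i => by
    refine ⟨measurable_const.max (measurable_const.min
      ((AEEqFun.measurable _).div (AEEqFun.measurable _))), fun y => abs_le.2 ⟨le_max_left _ _, ?_⟩⟩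
    exact max_le (by norm_num) (min_le_left _ _)
  have hRk : ∀ i, R (k i) = x i := fun i => by
    rw [hRe _ (hk i)]
    refine Subtype.ext (AEEqFun.ext ?_)
    filter_upwards [coe_mulMap e ⟨k i, (hk i).1, 1, (hk i).2⟩, hx i] with y h1 h2
    rw [h1]
    change (e : Ω →ₘ[μ] ℝ) y *
      max (-1) (min 1 ((x i : Ω →ₘ[μ] ℝ) y / (e : Ω →ₘ[μ] ℝ) y)) = _
    by_cases he : (e : Ω →ₘ[μ] ℝ) y = 0
    · rw [he, abs_zero, abs_nonpos_iff] at h2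
      rw [he, h2, zero_mul]
    · have h3 : |(x i : Ω →ₘ[μ] ℝ) y / (e : Ω →ₘ[μ] ℝ) y| ≤ 1 := by
        rw [abs_div]
        exact div_le_one_of_le₀ h2 (abs_nonneg _)
      rw [min_eq_right (abs_le.1 h3).2, max_eq_right (abs_le.1 h3).1, mul_div_cancel₀ _ he]
  set δ := min 1 (ε / (8 * (1 + D))) with hδ
  have hδ0 : 0 < δ := by positivity
  have hδε : 4 * (1 + D) * δ ≤ ε / 2 := by
    have h1 : δ ≤ ε / (8 * (1 + D)) := min_le_right _ _
    rw [le_div_iff₀ (by positivity)] at h1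
    linarith
  have hB := isSectionBall_measurableBall (Ω := Ω)
  have hhalf : ∀ g ∈ measurableBall Ω, ∀ g' ∈ measurableBall Ω,
      (1 / 2 : ℝ) • (g - g') ∈ measurableBall Ω := fun g hg g' hg' => by
    refine ⟨(hg.1.sub hg'.1).const_smul _, fun y => ?_⟩
    have h1 := abs_le.1 (hg.2 y)
    have h2 := abs_le.1 (hg'.2 y)
    rw [Pi.smul_apply, Pi.sub_apply, smul_eq_mul, abs_le]
    constructor <;> linarith
  have hconv : Convex ℝ (measurableBall Ω) := fun g hg g' hg' a b ha hb hab => by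
    have := hB.convex_mem (fun _ => a) measurable_const (fun _ => ha) (fun _ => by linarith)
      g hg g' hg'
    have e : b = 1 - a := by linarith
    rw [e]
    exact this
  -- The base is Ω itself. Since q is the square, squared tolerances make the half differences at
  -- most δ 2^{-i} off A i.
  obtain ⟨g, A, hg, hA, hAη, hgA⟩ := hB.exists_convex_blocks hζ hlim hconv hhalf hk
    (q := fun h y => h y ^ 2) (D := 1) (fun h hh => hh.1.pow_const 2)
    (fun h _ y => sq_nonneg _) (fun h hh y => (sq_le_one_iff_abs_le_one _).2 (hh.2 y))
    (fun h _ h' _ y => by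
      simp only [Pi.smul_apply, Pi.add_apply, Pi.sub_apply, smul_eq_mul]
      ring) (η := fun i => (δ * (1 / 2) ^ i) ^ 2) (fun i => by positivity)
  have hgB : ∀ i, g i ∈ measurableBall Ω := fun i => by
    refine convexHull_min ?_ hconv (hg i)
    rintro _ ⟨j, -, rfl⟩
    exact hk j
  -- The half difference splits into a part on A i, controlled by the modulus of A i, and a part
  -- which is r times an element of the ball. Both bounds are independent of n.
  have hstep : ∀ n i, ζ n (g (i + 1)) ≤ ζ n (g i) + 2 * ((1 + D) * (δ * (1 / 2) ^ i)) := by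
    intro n i
    set r := δ * (1 / 2) ^ i with hr
    have hr0 : 0 < r := by positivity
    have hr1 : r ≤ 1 := mul_le_one₀ (min_le_left _ _) (by positivity)
      (pow_le_one₀ (by norm_num) (by norm_num))
    have hd := hhalf _ (hgB (i + 1)) _ (hgB i)
    set d := (1 / 2 : ℝ) • (g (i + 1) - g i) with hdd
    have h1 : ζ n ((A i).indicator d) ≤ r := by
      have hi : (A i).indicator d ∈ measurableBall Ω := ⟨hd.1.indicator (hA i), fun y => by
        by_cases hy : y ∈ A i
        · simpa [hy] using hd.2 y
        · simp [hy]⟩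
      refine (hB.apply_le_setModulus (hζ n) (hA i) hi fun y hy =>
        indicator_of_notMem hy _).trans ((hAη n i).trans ?_)
      rw [← hr]
      nlinarith
    have h2 : ζ n ((A i)ᶜ.indicator d) ≤ r * D := by
      have hi : r⁻¹ • (A i)ᶜ.indicator d ∈ measurableBall Ω :=
        ⟨(hd.1.indicator (hA i).compl).const_smul _, fun y => by
          by_cases hy : y ∈ A i
          · simp [hy]
          · have h3 := hgA i y hy
            have h4 : |d y| ≤ r := abs_le_of_sq_le_sq h3 hr0.le
            simp only [Pi.smul_apply, smul_eq_mul, mem_compl_iff, hy, not_false_eq_true,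
              indicator_of_mem, abs_mul, abs_inv, abs_of_pos hr0]
            rwa [inv_mul_le_iff₀ hr0, mul_one]⟩
      have h5 := hζ n _ hi
      rwa [map_smul, smul_eq_mul, inv_mul_le_iff₀ hr0] at h5
    have h3 : g (i + 1) = g i + (2 : ℝ) • ((A i).indicator d + (A i)ᶜ.indicator d) := by
      rw [indicator_self_add_compl, hdd, smul_smul]
      simp
    rw [h3, map_add, map_smul, map_add, smul_eq_mul]
    linarith
  have hsum : ∀ n m, ζ n (g m) ≤ ζ n (g 0) + 4 * (1 + D) * δ * (1 - (1 / 2) ^ m) := by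
    intro n m
    induction m with
    | zero => simp
    | succ m ih =>
      refine (hstep n m).trans ?_
      rw [pow_succ]
      linarith
  -- The total drift from g 0 is at most ε/2 for all n, so an n with ζ n (g 0) < ε/2 contradicts ζ n
  -- (g n) ≥ ε.
  obtain ⟨n, hn⟩ := ((hlim _ (hgB 0)).eventually_lt_const (half_pos hε)).exists
  have h1 : ε ≤ ζ n (g n) := apply_convexHull_ge (ζ n) (fun i hi => by
    change ε ≤ φ n (R (k i))
    rw [hRk]
    exact hcon n i hi) (hg n)
  have h2 := hsum n n
  have h3 : 0 < 4 * (1 + D) * δ * (1 / 2) ^ n := by positivity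
  linarith

end OrderInterval

/-! ### Layers -/

section Layers

variable {Ω : Type*} [MeasurableSpace Ω] {μ : Measure Ω} {ψ : ℝ → ℝ} {v : ℤ → ℝ} {q : ℝ}
  {C : ℝ≥0}

/-- The bound, up to a constant, for the contribution of the `j`-th layer to `∫₀ᵗ f*` at
`t = 2 ^ l`. -/
def layerBound (v : ℤ → ℝ) (l j : ℤ) : ℝ :=
  if l ≤ j then 2 ^ l * (v j - v (j + 1)) else 2 ^ j * v j * ((l - j : ℤ) : ℝ)

lemma IsDyadicGauge.le_geometric (hv : IsDyadicGauge ψ μ v q C) (l : ℤ) (n : ℕ) :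
    2 ^ (l - n) * v (l - n) ≤ 2 ^ l * v l * q⁻¹ ^ n := by
  have hq : 0 < q := zero_lt_one.trans hv.one_lt
  induction n with
  | zero => simp
  | succ n ih =>
    have h1 := hv.growth (l - (n + 1 : ℕ))
    have e : l - ((n + 1 : ℕ) : ℤ) + 1 = l - n := by push_cast; ring
    have e2 : (2 : ℝ) ^ (l - (n : ℤ)) = 2 ^ (l - ((n + 1 : ℕ) : ℤ)) * 2 := by
      rw [← e, zpow_add_one₀ two_ne_zero]
    rw [e] at h1
    rw [e2] at ih
    have h2 : (0 : ℝ) < 2 ^ (l - ((n + 1 : ℕ) : ℤ)) := by positivity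
    rw [pow_succ, ← mul_assoc, le_mul_inv_iff₀ hq]
    nlinarith [mul_le_mul_of_nonneg_left h1 h2.le]

/-- Over j ≥ l the bounds telescope to at most 2^l v l. Over j = l - n < l they are at most 2^l v l
· n q^{-n}, summable because q > 1. This is where the growth of the gauge is used; the spare factor
l - j is needed later for envelopes. -/
lemma IsDyadicGauge.exists_tsum_layerBound_le (hv : IsDyadicGauge ψ μ v q C) :
    ∃ K : ℝ≥0, ∀ l, ∑' j, ENNReal.ofReal (layerBound v l j) ≤ K * ENNReal.ofReal (2 ^ l * v l) := by
  have hq : 0 < q := zero_lt_one.trans hv.one_lt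
  have hr : ‖q⁻¹‖ < 1 := by
    rw [Real.norm_eq_abs, abs_of_pos (inv_pos.2 hq)]
    exact inv_lt_one_of_one_lt₀ hv.one_lt
  have hs : Summable fun n : ℕ => ((n + 1 : ℕ) : ℝ) * q⁻¹ ^ (n + 1) := by
    have := summable_pow_mul_geometric_of_norm_lt_one 1 hr
    simp only [pow_one] at this
    exact (summable_nat_add_iff 1).2 this
  obtain ⟨K', hK'⟩ := exists_coe_eq hs.tsum_ofReal_ne_top
  refine ⟨1 + K', fun l => ?_⟩
  have hW : 0 ≤ 2 ^ l * v l := mul_nonneg (by positivity) (hv.pos l).le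
  rw [← (Equiv.addLeft l).tsum_eq, tsum_of_nat_of_neg_add_one ENNReal.summable ENNReal.summable,
    ENNReal.coe_add, add_mul]
  refine add_le_add ?_ ?_
  · rw [ENNReal.coe_one, one_mul]
    refine ENNReal.tsum_le_of_sum_range_le fun N => ?_
    have h0 : ∀ n : ℕ, layerBound v l (l + n) = 2 ^ l * v (l + n) - 2 ^ l * v (l + (n + 1 : ℕ)) :=
      fun n => by
        rw [layerBound, if_pos (by omega), mul_sub, Nat.cast_succ, add_assoc]
    simp only [Equiv.coe_addLeft]
    rw [← ENNReal.ofReal_sum_of_nonneg]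
    · refine ENNReal.ofReal_le_ofReal ?_
      simp only [h0]
      rw [Finset.sum_range_sub' (fun n : ℕ => (2 : ℝ) ^ l * v (l + n))]
      have := mul_nonneg (by positivity : (0 : ℝ) ≤ 2 ^ l) (hv.pos (l + N)).le
      simpa using this
    · intro n _
      rw [h0, ← mul_sub]
      exact mul_nonneg (by positivity) (sub_nonneg.2 (hv.anti (by push_cast; omega)))
  · rw [hK', mul_comm, ← ENNReal.tsum_mul_left]
    refine ENNReal.tsum_le_tsum fun n => ?_
    simp only [Equiv.coe_addLeft]
    rw [← ENNReal.ofReal_mul hW]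
    refine ENNReal.ofReal_le_ofReal ?_
    have e : l + -((n : ℤ) + 1) = l - ((n + 1 : ℕ) : ℤ) := by push_cast; ring
    rw [layerBound, if_neg (by omega), e]
    have e2 : l - (l - ((n + 1 : ℕ) : ℤ)) = ((n + 1 : ℕ) : ℤ) := by ring
    rw [e2, Int.cast_natCast]
    have := mul_le_mul_of_nonneg_right (hv.le_geometric l (n + 1))
      (Nat.cast_nonneg (α := ℝ) (n + 1))
    linarith

lemma IsDyadicGauge.exists_sum_layers (hv : IsDyadicGauge ψ μ v q C) :
    ∃ K : ℝ≥0, ∀ (F : ℤ → Ω → ℝ), (∀ j, AEMeasurable (F j) μ) → ∀ c : ℝ≥0,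
      (∀ l j, primitive μ (F j) (2 ^ l) ≤ c * ENNReal.ofReal (layerBound v l j)) →
      (∀ᵐ x ∂μ, Summable fun j => |F j x|) ∧
      ∀ f : Ω → ℝ, (∀ᵐ x ∂μ, ‖f x‖ₑ ≤ ∑' j, ‖F j x‖ₑ) → eNorm ψ μ f ≤ K * c := by
  obtain ⟨K, hK⟩ := hv.exists_tsum_layerBound_le
  refine ⟨C * K, fun F hF c hc => ?_⟩
  have h1 : ∀ l : ℤ, ∑' j, primitive μ (F j) (2 ^ l) ≤ c * K * ENNReal.ofReal (2 ^ l * v l) := by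
    intro l
    refine (ENNReal.tsum_le_tsum (hc l)).trans ?_
    rw [ENNReal.tsum_mul_left, mul_assoc]
    gcongr
    exact hK l
  refine ⟨?_, fun f hf => ?_⟩
  · refine ae_summable_abs hF (t := 2 ^ (0 : ℤ)) (by positivity) (ne_top_of_le_ne_top ?_ (h1 0))
    exact ENNReal.mul_ne_top (ENNReal.mul_ne_top ENNReal.coe_ne_top ENNReal.coe_ne_top)
      ENNReal.ofReal_ne_top
  · refine (hv.eNorm_le f (c * K) fun l =>
      (primitive_le_tsum hF hf (by positivity)).trans (h1 l)).trans (le_of_eq ?_)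
    push_cast
    ring

/-- The `c`-fold of the set of functions bounded by `1` and with integral at most `2 ^ (j + 1)`. -/
def sliceBall (μ : Measure Ω) (c : ℝ≥0) (j : ℤ) : Set (Ω → ℝ) :=
  {h | Measurable h ∧ (∀ x, |h x| ≤ c) ∧ ∫⁻ x, ‖h x‖ₑ ∂μ ≤ c * ENNReal.ofReal (2 * 2 ^ j)}

lemma zero_mem_sliceBall (c : ℝ≥0) (j : ℤ) : (fun _ => 0) ∈ sliceBall μ c j :=
  ⟨measurable_const, fun x => by simp, by simp⟩

lemma add_mem_sliceBall {c d : ℝ≥0} {j : ℤ} {h k : Ω → ℝ} (hh : h ∈ sliceBall μ c j)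
    (hk : k ∈ sliceBall μ d j) : (fun x => h x + k x) ∈ sliceBall μ (c + d) j := by
  refine ⟨hh.1.add hk.1, fun x => ?_, ?_⟩
  · rw [NNReal.coe_add]
    exact (abs_add_le _ _).trans (add_le_add (hh.2.1 x) (hk.2.1 x))
  · rw [ENNReal.coe_add, add_mul]
    refine le_trans ?_ (add_le_add hh.2.2 hk.2.2)
    rw [← lintegral_add_left hh.1.enorm]
    exact lintegral_mono fun x => enorm_add_le _ _

lemma const_mul_mem_sliceBall {c : ℝ≥0} {j : ℤ} {h : Ω → ℝ} (hh : h ∈ sliceBall μ c j) (a : ℝ) :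
    (fun x => a * h x) ∈ sliceBall μ (‖a‖₊ * c) j := by
  refine ⟨hh.1.const_mul a, fun x => ?_, ?_⟩
  · rw [abs_mul, NNReal.coe_mul, coe_nnnorm, Real.norm_eq_abs]
    exact mul_le_mul_of_nonneg_left (hh.2.1 x) (abs_nonneg a)
  · rw [ENNReal.coe_mul, mul_assoc]
    refine le_trans (le_of_eq ?_) (mul_le_mul_right hh.2.2 (‖a‖₊ : ℝ≥0∞))
    rw [← lintegral_const_mul _ hh.1.enorm]
    simp only [nnnorm_mul, ENNReal.coe_mul, enorm_eq_nnnorm]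

lemma sliceBall_mono {c d : ℝ≥0} (hcd : c ≤ d) (j : ℤ) : sliceBall μ c j ⊆ sliceBall μ d j :=
  fun _ hh => ⟨hh.1, fun x => (hh.2.1 x).trans hcd, hh.2.2.trans (by gcongr)⟩

/-- For l ≤ j the uniform bound on the slice is used, for l > j the bound on its integral. -/
lemma IsDyadicGauge.primitive_slice_le (hv : IsDyadicGauge ψ μ v q C) {c : ℝ≥0} {j : ℤ}
    {h : Ω → ℝ} (hh : h ∈ sliceBall μ c j) (l : ℤ) :
    primitive μ (fun x => (v j - v (j + 1)) * h x) (2 ^ l) ≤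
      ((2 * c : ℝ≥0) : ℝ≥0∞) * ENNReal.ofReal (layerBound v l j) := by
  have ha : 0 ≤ v j - v (j + 1) := sub_nonneg.2 (hv.anti (by omega))
  have hvj := hv.pos (j + 1)
  refine (primitive_const_mul_le _ _).trans ?_
  rw [Real.enorm_of_nonneg ha, layerBound]
  split_ifs with hlj
  · calc ENNReal.ofReal (v j - v (j + 1)) * primitive μ h (2 ^ l)
        ≤ ENNReal.ofReal (v j - v (j + 1)) * (c * ENNReal.ofReal (2 ^ l)) := by
          gcongr
          exact primitive_le_of_bound (ae_of_all _ hh.2.1) _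
      _ = c * ENNReal.ofReal (2 ^ l * (v j - v (j + 1))) := by
          rw [ENNReal.ofReal_mul (by positivity)]
          ring
      _ ≤ _ := by
          gcongr
          exact le_mul_of_one_le_left zero_le one_le_two
  · have h1 : (1 : ℝ) ≤ ((l - j : ℤ) : ℝ) := by exact_mod_cast (by omega : 1 ≤ l - j)
    calc ENNReal.ofReal (v j - v (j + 1)) * primitive μ h (2 ^ l)
        ≤ ENNReal.ofReal (v j) * (c * ENNReal.ofReal (2 * 2 ^ j)) := by
          gcongr
          · linarith
          · exact (primitive_le_lintegral hh.1.aemeasurable _).trans hh.2.2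
      _ = ((2 * c : ℝ≥0) : ℝ≥0∞) * ENNReal.ofReal (2 ^ j * v j) := by
          rw [ENNReal.ofReal_mul zero_le_two, ENNReal.ofReal_mul (by positivity),
            ENNReal.ofReal_ofNat]
          push_cast
          ring
      _ ≤ _ := by
          refine mul_le_mul_right (ENNReal.ofReal_le_ofReal ?_) _
          exact le_mul_of_one_le_right (mul_nonneg (by positivity) (hv.pos j).le) h1

/-- Families of functions indexed by the layers. -/
def layerBall (μ : Measure Ω) : Set (ℤ × Ω → ℝ) :=
  {H | ∀ j, (fun x => H (j, x)) ∈ sliceBall μ 1 j}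

lemma half_sub_mem_layerBall {G H : ℤ × Ω → ℝ} (hG : G ∈ layerBall μ) (hH : H ∈ layerBall μ) :
    (1 / 2 : ℝ) • (G - H) ∈ layerBall μ := by
  intro j
  have h := add_mem_sliceBall (const_mul_mem_sliceBall (hG j) (1 / 2))
    (const_mul_mem_sliceBall (hH j) (-(1 / 2)))
  have e : ‖(1 / 2 : ℝ)‖₊ * 1 + ‖(-(1 / 2) : ℝ)‖₊ * 1 = 1 := by
    rw [nnnorm_neg, ← NNReal.coe_inj]
    norm_num
  rw [e] at h
  convert h using 2
  simp only [Pi.smul_apply, Pi.sub_apply, smul_eq_mul]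
  ring

lemma isSectionBall_layerBall : IsSectionBall (Prod.fst : ℤ × Ω → ℤ) (layerBall μ) where
  zero_mem := fun j => zero_mem_sliceBall 1 j
  mul_mem w _ hw1 H hH := fun j => by
    refine sliceBall_mono ?_ j (const_mul_mem_sliceBall (hH j) (w j))
    rw [mul_one, ← NNReal.coe_le_coe, coe_nnnorm]
    exact hw1 j
  convex_mem w _ hw0 hw1 H hH K hK := fun j => by
    have h := add_mem_sliceBall (const_mul_mem_sliceBall (hH j) (w j))
      (const_mul_mem_sliceBall (hK j) (1 - w j))
    refine sliceBall_mono ?_ j h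
    rw [mul_one, mul_one, ← NNReal.coe_le_coe, NNReal.coe_add, coe_nnnorm, coe_nnnorm,
      Real.norm_of_nonneg (hw0 j), Real.norm_of_nonneg (sub_nonneg.2 (hw1 j))]
    simp
  glue_mem E _ _ H hH K hKE hK0 := fun j => by
    by_cases hj : ∃ i, j ∈ E i
    · obtain ⟨i, hi⟩ := hj
      have : (fun x => K (j, x)) = fun x => H i (j, x) := funext fun x => hKE i (j, x) hi
      rw [this]
      exact hH i j
    · push Not at hj
      have : (fun x => K (j, x)) = fun _ => 0 := funext fun x => hK0 (j, x) hj
      rw [this]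
      exact zero_mem_sliceBall 1 j

lemma convex_layerBall : Convex ℝ (layerBall μ) := fun g hg g' hg' a b ha hb hab => by
  have := (isSectionBall_layerBall (μ := μ)).convex_mem (fun _ => a) measurable_const (fun _ => ha)
    (fun _ => by linarith) g hg g' hg'
  have e : b = 1 - a := by linarith
  rw [e]
  exact this

/-- The span of `layerBall`. -/
def layerSpace (μ : Measure Ω) : Submodule ℝ (ℤ × Ω → ℝ) where
  carrier := {H | ∃ c : ℝ≥0, ∀ j, (fun x => H (j, x)) ∈ sliceBall μ c j}
  zero_mem' := ⟨0, fun j => zero_mem_sliceBall 0 j⟩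
  add_mem' := by
    rintro H K ⟨c, hc⟩ ⟨d, hd⟩
    exact ⟨c + d, fun j => add_mem_sliceBall (hc j) (hd j)⟩
  smul_mem' := by
    rintro a H ⟨c, hc⟩
    exact ⟨‖a‖₊ * c, fun j => const_mul_mem_sliceBall (hc j) a⟩

/-- The synthesis operator from layers to functions, bounded on the layer ball. Outside `layerSpace`
it is an arbitrary algebraic extension, needed only because moduli take functionals on all
functions. -/
lemma IsDyadicGauge.exists_layerMap (hv : IsDyadicGauge ψ μ v q C) :
    ∃ (R : (ℤ × Ω → ℝ) →ₗ[ℝ] space ψ μ) (K : ℝ), ∀ H ∈ layerBall μ,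
      (∀ᵐ x ∂μ, Summable fun j => |(v j - v (j + 1)) * H (j, x)|) ∧
      (R H : Ω →ₘ[μ] ℝ) =ᵐ[μ] (fun x => ∑' j, (v j - v (j + 1)) * H (j, x)) ∧ ‖R H‖ ≤ K := by
  obtain ⟨K, hK⟩ := hv.exists_sum_layers
  have hm : ∀ H ∈ layerSpace μ, ∀ j, AEMeasurable (fun x => (v j - v (j + 1)) * H (j, x)) μ :=
    fun H hH j => ((hH.choose_spec j).1.const_mul _).aemeasurable
  have hs : ∀ H ∈ layerSpace μ,
      ∀ᵐ x ∂μ, Summable fun j => |(v j - v (j + 1)) * H (j, x)| := fun H hH =>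
    (hK _ (hm H hH) _ fun l j => hv.primitive_slice_le (hH.choose_spec j) l).1
  have hs' : ∀ H ∈ layerSpace μ,
      ∀ᵐ x ∂μ, Summable fun j => (v j - v (j + 1)) * H (j, x) := fun H hH => by
    filter_upwards [hs H hH] with x hx
    exact hx.of_abs
  have hn : ∀ H : ℤ × Ω → ℝ, ∀ c : ℝ≥0, (∀ j, (fun x => H (j, x)) ∈ sliceBall μ c j) →
      eNorm ψ μ (fun x => ∑' j, (v j - v (j + 1)) * H (j, x)) ≤ K * (2 * c : ℝ≥0) :=
    fun H c hc => (hK _ (hm H ⟨c, hc⟩) _ fun l j => hv.primitive_slice_le (hc j) l).2 _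
      (ae_of_all _ fun x => enorm_tsum_le_tsum_enorm)
  have hn' : ∀ H : ℤ × Ω → ℝ, ∀ c : ℝ≥0, (∀ j, (fun x => H (j, x)) ∈ sliceBall μ c j) →
      eNorm ψ μ (fun x => ∑' j, (v j - v (j + 1)) * H (j, x)) < ∞ := fun H c hc =>
    (hn H c hc).trans_lt (ENNReal.mul_lt_top ENNReal.coe_lt_top ENNReal.coe_lt_top)
  let R₀ : layerSpace μ →ₗ[ℝ] space ψ μ := toSpaceLinear
    (fun H x => ∑' j, (v j - v (j + 1)) * (H : ℤ × Ω → ℝ) (j, x))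
    (fun H => aemeasurable_tsum_of_summable (hm _ H.2) (hs' _ H.2))
    (fun H => hn' _ _ H.2.choose_spec)
    (fun H K => by
      filter_upwards [hs' _ H.2, hs' _ K.2] with x h1 h2
      simp only [Pi.add_apply, Submodule.coe_add, mul_add]
      exact h1.tsum_add h2)
    (fun a H => by
      refine ae_of_all _ fun x => ?_
      simp only [Pi.smul_apply, Submodule.coe_smul, smul_eq_mul, mul_left_comm _ a]
      exact tsum_mul_left)
  obtain ⟨R, hR⟩ := R₀.exists_extend
  refine ⟨R, (K * (2 * 1 : ℝ≥0) : ℝ≥0∞).toReal, fun H hH => ?_⟩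
  have hmem : H ∈ layerSpace μ := ⟨1, hH⟩
  have e : R H = R₀ ⟨H, hmem⟩ := congrArg (fun L => L ⟨H, hmem⟩) hR
  have e2 : (R H : Ω →ₘ[μ] ℝ) =ᵐ[μ] fun x => ∑' j, (v j - v (j + 1)) * H (j, x) := by
    rw [e]
    exact coe_toSpaceLinear _ _ _ _ _
  refine ⟨hs H hmem, e2, ?_⟩
  rw [norm_def, eNorm_congr e2]
  exact ENNReal.toReal_mono (ENNReal.mul_ne_top ENNReal.coe_ne_top ENNReal.coe_ne_top) (hn H 1 hH)

end Layers

/-! ### Decomposition into layers -/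

section Decomposition

/-- Truncation of a real number at height `c`. -/
def clamp (c y : ℝ) : ℝ := max (-c) (min c y)

lemma abs_clamp_le {c : ℝ} (hc : 0 ≤ c) (y : ℝ) : |clamp c y| ≤ c :=
  abs_le.2 ⟨le_max_left _ _, max_le (by linarith) (min_le_left _ _)⟩

lemma clamp_of_abs_le {c y : ℝ} (h : |y| ≤ c) : clamp c y = y := by
  rw [clamp, min_eq_right (abs_le.1 h).2, max_eq_right (abs_le.1 h).1]

lemma abs_clamp_sub_clamp_le {c d : ℝ} (h : d ≤ c) (y : ℝ) : |clamp c y - clamp d y| ≤ c - d := by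
  unfold clamp
  refine (abs_max_sub_max_le_max _ _ _ _).trans (max_le ?_ ?_)
  · rw [abs_le]; constructor <;> linarith
  · refine (abs_min_sub_min_le_max _ _ _ _).trans (max_le ?_ ?_)
    · rw [abs_of_nonneg (sub_nonneg.2 h)]
    · simpa using h

lemma measurable_clamp (c : ℝ) : Measurable (clamp c) :=
  measurable_const.max (measurable_const.min measurable_id)

lemma continuous_clamp_left (y : ℝ) : Continuous fun c => clamp c y := by
  unfold clamp
  fun_prop

variable {v : ℤ → ℝ}

/-- The series telescopes in both directions: for j → +∞ the levels decrease to their infimum, for j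
→ -∞ they eventually exceed |y| and truncation is trivial. -/
lemma hasSum_clamp (hv : Antitone v) (h0 : ∀ i, 0 < v i) {y : ℝ} (hy : ∃ i, |y| ≤ v i) :
    HasSum (fun j => clamp (v j) y - clamp (v (j + 1)) y)
      (y - clamp (⨅ n : ℕ, v n) y) := by
  have hanti : Antitone fun n : ℕ => v n := fun m n hmn => hv (by exact_mod_cast hmn)
  have hbdd : BddBelow (range fun n : ℕ => v n) := ⟨0, by rintro _ ⟨n, rfl⟩; exact (h0 n).le⟩
  have h1 : HasSum (fun n : ℕ => clamp (v n) y - clamp (v (n + 1)) y)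
      (clamp (v 0) y - clamp (⨅ n : ℕ, v n) y) := by
    have hs : Summable fun n : ℕ => v n - v (n + 1) := by
      refine summable_of_sum_range_le (c := v 0)
        (fun n => sub_nonneg.2 (hv (by omega))) fun N => ?_
      have h := Finset.sum_range_sub' (fun n : ℕ => v n) N
      push_cast at h
      rw [h]
      linarith [h0 N]
    have hs2 : Summable fun n : ℕ => clamp (v n) y - clamp (v (n + 1)) y :=
      Summable.of_norm_bounded hs fun n => abs_clamp_sub_clamp_le (hv (by omega)) y
    rw [hs2.hasSum_iff_tendsto_nat]
    have h := fun N => Finset.sum_range_sub' (fun n : ℕ => clamp (v n) y) N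
    push_cast at h
    simp only [h]
    exact tendsto_const_nhds.sub
      (((continuous_clamp_left y).tendsto _).comp (tendsto_atTop_ciInf hanti hbdd))
  have h2 : HasSum (fun n : ℕ => clamp (v (-((n : ℤ) + 1))) y - clamp (v (-((n : ℤ) + 1) + 1)) y)
      (y - clamp (v 0) y) := by
    obtain ⟨i, hi⟩ := hy
    have hN : ∀ n : ℕ, i.natAbs ≤ n → clamp (v (-(n : ℤ))) y = y := fun n hn =>
      clamp_of_abs_le (hi.trans (hv (by omega)))
    have hz : ∀ n ∉ Finset.range i.natAbs,
        clamp (v (-((n : ℤ) + 1))) y - clamp (v (-((n : ℤ) + 1) + 1)) y = 0 := by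
      intro n hn
      rw [Finset.mem_range, not_lt] at hn
      have e1 := hN n hn
      have e2 := hN (n + 1) (by omega)
      push_cast at e2
      have e3 : -((n : ℤ) + 1) + 1 = -n := by ring
      rw [e3, e1, e2, sub_self]
    have h3 := hasSum_sum_of_ne_finset_zero (L := SummationFilter.unconditional ℕ) hz
    have h4 := Finset.sum_range_sub (fun n : ℕ => clamp (v (-(n : ℤ))) y) i.natAbs
    rw [hN _ le_rfl] at h4
    have e4 : ∀ n : ℕ, -((n : ℤ) + 1) + 1 = -n := fun n => by ring
    push_cast at h4
    simp only [e4] at h3 ⊢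
    rw [h4] at h3
    simpa using h3
  have h3 := HasSum.of_nat_of_neg_add_one
    (f := fun j : ℤ => clamp (v j) y - clamp (v (j + 1)) y) h1 h2
  have e : clamp (v 0) y - clamp (⨅ n : ℕ, v n) y + (y - clamp (v 0) y) =
      y - clamp (⨅ n : ℕ, v n) y := by ring
  rwa [e] at h3

variable {Ω : Type*} [MeasurableSpace Ω] {μ : Measure Ω} {ψ : ℝ → ℝ} {q : ℝ} {C : ℝ≥0}

lemma IsDyadicGauge.iInf_le (hv : IsDyadicGauge ψ μ v q C) (i : ℤ) : ⨅ n : ℕ, v n ≤ v i :=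
  (ciInf_le ⟨0, by rintro _ ⟨n, rfl⟩; exact (hv.pos n).le⟩ i.natAbs).trans (hv.anti (by omega))

lemma IsDyadicGauge.iInf_nonneg (hv : IsDyadicGauge ψ μ v q C) : 0 ≤ ⨅ n : ℕ, v n :=
  le_ciInf fun n => (hv.pos n).le

lemma IsDyadicGauge.eNorm_const_lt_top (hv : IsDyadicGauge ψ μ v q C) :
    eNorm ψ μ (fun _ => ⨅ n : ℕ, v n) < ∞ := by
  refine lt_of_le_of_lt (hv.eNorm_le _ 1 fun i => ?_)
    (ENNReal.mul_lt_top ENNReal.coe_lt_top ENNReal.one_lt_top)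
  have h0 := hv.iInf_nonneg
  refine (primitive_le_of_bound (c := (⨅ n : ℕ, v n).toNNReal) (ae_of_all _ fun x => ?_) _).trans ?_
  · rw [abs_of_nonneg h0, Real.coe_toNNReal _ h0]
  · rw [one_mul, mul_comm, ENNReal.ofReal_mul (by positivity)]
    change _ * ENNReal.ofReal _ ≤ _
    gcongr
    exact hv.iInf_le i

/-- As f* is decreasing, 2^i f*(2^i) is at most the primitive at 2^i; hence f*(2^i) ≤ v i. -/
lemma IsDyadicGauge.distribution_le (hv : IsDyadicGauge ψ μ v q C) {f : Ω → ℝ}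
    (h : ∀ i : ℤ, primitive μ f (2 ^ i) ≤ ENNReal.ofReal (2 ^ i * v i)) (i : ℤ) :
    μ {x | v i < |f x|} ≤ ENNReal.ofReal (2 ^ i) := by
  have h1 := (mul_rearrangement_le_primitive (μ := μ) (f := f) (2 ^ i)).trans (h i)
  have h2 : (0 : ℝ) < 2 ^ i := by positivity
  rw [ENNReal.ofReal_mul h2.le, ENNReal.mul_le_mul_iff_right (ENNReal.ofReal_pos.2 h2).ne'
    ENNReal.ofReal_ne_top] at h1
  have h3 := rearrangement_le_iff.1 h1
  rwa [distribution, Real.coe_toNNReal _ (hv.pos i).le] at h3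

lemma IsDyadicGauge.exists_layers (hv : IsDyadicGauge ψ μ v q C) {f : Ω → ℝ} (hf : Measurable f)
    (h : ∀ i : ℤ, primitive μ f (2 ^ i) ≤ ENNReal.ofReal (2 ^ i * v i)) :
    ∃ H ∈ layerBall μ, ∀ᵐ x ∂μ,
      f x = ∑' j, (v j - v (j + 1)) * H (j, x) + clamp (⨅ n : ℕ, v n) (f x) := by
  -- The part of f between the levels v (j + 1) and v j, normalised to be bounded by 1. It vanishes
  -- off {|f| > v (j + 1)}, of measure at most 2^{j+1}, which explains the bound in `sliceBall`. If
  -- the levels coincide, 0 / 0 = 0 is the right value.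
  let H : ℤ × Ω → ℝ := fun s =>
    (clamp (v s.1) (f s.2) - clamp (v (s.1 + 1)) (f s.2)) / (v s.1 - v (s.1 + 1))
  have ha : ∀ j, 0 ≤ v j - v (j + 1) := fun j => sub_nonneg.2 (hv.anti (by omega))
  have hL : ∀ j x, |clamp (v j) (f x) - clamp (v (j + 1)) (f x)| ≤ v j - v (j + 1) := fun j x =>
    abs_clamp_sub_clamp_le (sub_nonneg.1 (ha j)) _
  have hH1 : ∀ j x, |H (j, x)| ≤ 1 := fun j x => by
    simp only [H]
    rw [abs_div, abs_of_nonneg (ha j)]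
    exact div_le_one_of_le₀ (hL j x) (ha j)
  have hHL : ∀ j x, (v j - v (j + 1)) * H (j, x) =
      clamp (v j) (f x) - clamp (v (j + 1)) (f x) := fun j x => by
    rcases (ha j).eq_or_lt with h0 | h0
    · have := hL j x
      rw [← h0, abs_nonpos_iff] at this
      rw [← h0, this, zero_mul]
    · exact mul_div_cancel₀ _ h0.ne'
  refine ⟨H, fun j => ⟨?_, fun x => by simpa using hH1 j x, ?_⟩, ?_⟩
  · exact (((measurable_clamp (v j)).comp hf).sub
      ((measurable_clamp (v (j + 1))).comp hf)).div_const (v j - v (j + 1))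
  · have hS : MeasurableSet {x | v (j + 1) < |f x|} := measurableSet_lt measurable_const hf.abs
    calc ∫⁻ x, ‖H (j, x)‖ₑ ∂μ ≤ ∫⁻ x, {x | v (j + 1) < |f x|}.indicator 1 x ∂μ := by
          refine lintegral_mono fun x => ?_
          by_cases hx : v (j + 1) < |f x|
          · rw [indicator_of_mem (by exact hx), Pi.one_apply, Real.enorm_eq_ofReal_abs,
              ← ENNReal.ofReal_one]
            exact ENNReal.ofReal_le_ofReal (hH1 j x)
          · have h1 : |f x| ≤ v (j + 1) := not_lt.1 hx
            have h2 : H (j, x) = 0 := by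
              simp only [H]
              rw [clamp_of_abs_le h1, clamp_of_abs_le (h1.trans (sub_nonneg.1 (ha j))), sub_self,
                zero_div]
            rw [h2, enorm_zero]
            exact zero_le
      _ = μ {x | v (j + 1) < |f x|} := lintegral_indicator_one hS
      _ ≤ ENNReal.ofReal (2 ^ (j + 1)) := hv.distribution_le h _
      _ = _ := by
          rw [zpow_add_one₀ two_ne_zero, mul_comm, ENNReal.coe_one, one_mul]
  · have hae : ∀ᵐ x ∂μ, ∃ i, |f x| ≤ v i := by
      rw [ae_iff]
      refine le_antisymm (ENNReal.le_of_forall_pos_le_add fun ε hε _ => ?_) zero_le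
      rw [zero_add]
      have hε' : (0 : ℝ) < ε := hε
      have h1 := Int.zpow_log_le_self (b := 2) one_lt_two hε'
      push_cast at h1
      calc μ {x | ¬ ∃ i, |f x| ≤ v i} ≤ μ {x | v (Int.log 2 (ε : ℝ)) < |f x|} := by
            refine measure_mono fun x hx => ?_
            simp only [mem_ofPred_eq, not_exists, not_le] at hx ⊢
            exact hx _
        _ ≤ ENNReal.ofReal (2 ^ Int.log 2 (ε : ℝ)) := hv.distribution_le h _
        _ ≤ ε := by
            rw [← ENNReal.ofReal_coe_nnreal]
            exact ENNReal.ofReal_le_ofReal h1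
    filter_upwards [hae] with x hx
    simp only [hHL]
    rw [(hasSum_clamp hv.anti hv.pos hx).tsum_eq]
    ring

end Decomposition

/-! ### Energies of layers -/

section Energy

variable {Ω : Type*} [MeasurableSpace Ω] {μ : Measure Ω} {ψ : ℝ → ℝ} {v : ℤ → ℝ} {q : ℝ}
  {C : ℝ≥0} {j : ℤ}

lemma integrable_of_mem_sliceBall {c : ℝ≥0} {h : Ω → ℝ} (hh : h ∈ sliceBall μ c j) :
    Integrable h μ :=
  ⟨hh.1.aestronglyMeasurable, hh.2.2.trans_lt
    (ENNReal.mul_lt_top ENNReal.coe_lt_top ENNReal.ofReal_lt_top)⟩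

lemma sq_le_abs_of_mem_sliceBall {h : Ω → ℝ} (hh : h ∈ sliceBall μ 1 j) (x : Ω) :
    h x ^ 2 ≤ |h x| := by
  have h1 : |h x| ≤ 1 := by simpa using hh.2.1 x
  rw [← sq_abs]
  nlinarith [abs_nonneg (h x)]

lemma integrable_sq_of_mem_sliceBall {h : Ω → ℝ} (hh : h ∈ sliceBall μ 1 j) :
    Integrable (fun x => h x ^ 2) μ := by
  refine (integrable_of_mem_sliceBall hh).mono (hh.1.pow_const 2).aestronglyMeasurable
    (ae_of_all _ fun x => ?_)
  rw [Real.norm_eq_abs, abs_of_nonneg (sq_nonneg _)]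
  exact sq_le_abs_of_mem_sliceBall hh x

/-- The normalised square integral of a layer. -/
def energy (μ : Measure Ω) (H : ℤ × Ω → ℝ) (j : ℤ) : ℝ := (∫ x, H (j, x) ^ 2 ∂μ) / 2 ^ j

lemma energy_nonneg (H : ℤ × Ω → ℝ) (j : ℤ) : 0 ≤ energy μ H j :=
  div_nonneg (integral_nonneg fun x => sq_nonneg _) (by positivity)

lemma energy_le_two {H : ℤ × Ω → ℝ} (hH : H ∈ layerBall μ) (j : ℤ) : energy μ H j ≤ 2 := by
  have h2 : (0 : ℝ) < 2 ^ j := by positivity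
  rw [energy, div_le_iff₀ h2]
  calc ∫ x, H (j, x) ^ 2 ∂μ ≤ ∫ x, |H (j, x)| ∂μ :=
        integral_mono (integrable_sq_of_mem_sliceBall (hH j))
          (integrable_of_mem_sliceBall (hH j)).abs (sq_le_abs_of_mem_sliceBall (hH j))
    _ = (∫⁻ x, ‖H (j, x)‖ₑ ∂μ).toReal := by
        rw [← integral_norm_eq_lintegral_enorm (hH j).1.aestronglyMeasurable]
        rfl
    _ ≤ 2 * 2 ^ j := by
        refine ENNReal.toReal_le_of_le_ofReal (by positivity) ?_
        have := (hH j).2.2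
        rwa [ENNReal.coe_one, one_mul] at this

lemma energy_parallelogram {G H : ℤ × Ω → ℝ} (hG : G ∈ layerBall μ) (hH : H ∈ layerBall μ)
    (j : ℤ) : energy μ ((1 / 2 : ℝ) • (G + H)) j + energy μ ((1 / 2 : ℝ) • (G - H)) j =
      (energy μ G j + energy μ H j) / 2 := by
  have hp : (1 / 2 : ℝ) • (G + H) ∈ layerBall μ := by
    rw [smul_add]
    exact convex_layerBall hG hH (by norm_num) (by norm_num) (by norm_num)
  have hm := half_sub_mem_layerBall hG hH
  have h1 := integral_add (integrable_sq_of_mem_sliceBall (hp j))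
    (integrable_sq_of_mem_sliceBall (hm j))
  have h2 := integral_add (integrable_sq_of_mem_sliceBall (hG j))
    (integrable_sq_of_mem_sliceBall (hH j))
  have h3 : ∫ x, (((1 / 2 : ℝ) • (G + H)) (j, x) ^ 2 + ((1 / 2 : ℝ) • (G - H)) (j, x) ^ 2) ∂μ =
      (∫ x, (G (j, x) ^ 2 + H (j, x) ^ 2) ∂μ) / 2 := by
    rw [← integral_div]
    congr 1
    ext x
    simp only [Pi.smul_apply, Pi.add_apply, Pi.sub_apply, smul_eq_mul]
    ring
  rw [h1, h2] at h3
  rw [energy, energy, energy, energy, ← add_div, h3]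
  ring

/-- Truncate at s = 2^{-i}: (|k| - s)⁺ ≤ k² / s, so the bounded part and the square integral each
contribute at most 2^l 2^{-i}. -/
lemma primitive_le_of_energy {k : Ω → ℝ} (hk : k ∈ sliceBall μ 1 j) {i : ℕ}
    (hki : ∫ x, k x ^ 2 ∂μ ≤ (1 / 4) ^ i * 2 ^ j) {l : ℤ} (hl : j ≤ l) :
    primitive μ k (2 ^ l) ≤ ENNReal.ofReal (2 * 2 ^ l * (1 / 2) ^ i) := by
  have hfin : ∫⁻ x, ‖k x‖ₑ ∂μ ≠ ∞ := (integrable_of_mem_sliceBall hk).2.ne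
  set s : ℝ≥0 := (1 / 2) ^ i with hs
  have hs' : (s : ℝ) = (1 / 2) ^ i := by rw [hs]; push_cast; rfl
  have hs0 : (0 : ℝ) < s := by rw [hs']; positivity
  have h1 := primitive_le hk.1.aemeasurable
    (fun r => rearrangement_lt_top_of_lintegral hk.1.aemeasurable hfin) s (2 ^ l)
  have h2 : ∫⁻ x, ENNReal.ofReal (|k x| - s) ∂μ ≤ ENNReal.ofReal (2 ^ l * (1 / 2) ^ i) := by
    calc ∫⁻ x, ENNReal.ofReal (|k x| - s) ∂μ ≤ ∫⁻ x, ENNReal.ofReal (k x ^ 2 / s) ∂μ := by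
          refine lintegral_mono fun x => ENNReal.ofReal_le_ofReal ?_
          rw [le_div_iff₀ hs0, ← sq_abs]
          nlinarith [sq_nonneg (|k x| - s), abs_nonneg (k x)]
      _ = ENNReal.ofReal ((∫ x, k x ^ 2 ∂μ) / s) := by
          rw [← integral_div, ofReal_integral_eq_lintegral_ofReal
            ((integrable_sq_of_mem_sliceBall hk).div_const _)]
          exact ae_of_all _ fun x => div_nonneg (sq_nonneg _) hs0.le
      _ ≤ ENNReal.ofReal (2 ^ l * (1 / 2) ^ i) := by
          refine ENNReal.ofReal_le_ofReal ?_
          rw [div_le_iff₀ hs0, hs', mul_assoc, ← mul_pow]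
          have h3 : (2 : ℝ) ^ j ≤ 2 ^ l := zpow_le_zpow_right₀ one_le_two hl
          have h4 : (1 / 2 * (1 / 2) : ℝ) = 1 / 4 := by norm_num
          rw [h4]
          refine hki.trans ?_
          rw [mul_comm]
          gcongr
  refine h1.trans ((add_le_add_right h2 _).trans (le_of_eq ?_))
  rw [← ENNReal.ofReal_coe_nnreal, ← ENNReal.ofReal_mul hs0.le, hs',
    ← ENNReal.ofReal_add (by positivity) (by positivity)]
  congr 1
  ring

/-- The first n functions are estimated by their integrals, the later ones by their energies, which
give a geometric series. So infinitely many differences cost only a factor linear in n = l - j. -/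
lemma tsum_primitive_le_of_energy {k : ℕ → Ω → ℝ} (hk : ∀ i, k i ∈ sliceBall μ 1 j)
    (hki : ∀ i, ∫ x, k i x ^ 2 ∂μ ≤ (1 / 4) ^ i * 2 ^ j) (n : ℕ) :
    ∑' i, primitive μ (k i) (2 ^ (j + n)) ≤ ENNReal.ofReal (2 * 2 ^ j * (n + 2)) := by
  have h2 : (0 : ℝ) < 2 ^ j := by positivity
  rw [← Summable.sum_add_tsum_nat_add' (k := n) ENNReal.summable, mul_add,
    ENNReal.ofReal_add (by positivity) (by positivity)]
  refine add_le_add ?_ ?_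
  · calc ∑ i ∈ Finset.range n, primitive μ (k i) (2 ^ (j + n))
        ≤ ∑ _i ∈ Finset.range n, ENNReal.ofReal (2 * 2 ^ j) := by
          refine Finset.sum_le_sum fun i _ => ?_
          refine (primitive_le_lintegral (hk i).1.aemeasurable _).trans ?_
          have := (hk i).2.2
          rwa [ENNReal.coe_one, one_mul] at this
      _ = ENNReal.ofReal (2 * 2 ^ j * n) := by
          rw [Finset.sum_const, Finset.card_range, nsmul_eq_mul, mul_comm,
            ENNReal.ofReal_mul (by positivity : (0 : ℝ) ≤ 2 * 2 ^ j), ENNReal.ofReal_natCast]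
  · calc ∑' i, primitive μ (k (i + n)) (2 ^ (j + n))
        ≤ ∑' i : ℕ, ENNReal.ofReal (2 * 2 ^ j * (1 / 2) ^ i) := by
          refine ENNReal.tsum_le_tsum fun i => ?_
          refine (primitive_le_of_energy (hk (i + n)) (hki (i + n)) (by omega)).trans
            (le_of_eq ?_)
          congr 1
          rw [zpow_add₀ two_ne_zero, zpow_natCast, pow_add]
          have : (2 : ℝ) ^ n * (1 / 2) ^ n = 1 := by rw [← mul_pow]; norm_num
          linear_combination (2 * 2 ^ j * (1 / 2 : ℝ) ^ i) * this
      _ = ENNReal.ofReal (2 * 2 ^ j * 2) := by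
          rw [← ENNReal.ofReal_tsum_of_nonneg (fun i => by positivity)
            (summable_geometric_two.mul_left _), tsum_mul_left, tsum_geometric_two]

lemma IsDyadicGauge.primitive_envelope_le (hv : IsDyadicGauge ψ μ v q C) {k : ℕ → Ω → ℝ}
    (hk : ∀ i, k i ∈ sliceBall μ 1 j) (hki : ∀ i, ∫ x, k i x ^ 2 ∂μ ≤ (1 / 4) ^ i * 2 ^ j)
    {g : Ω → ℝ} (hg : g ∈ sliceBall μ 1 j) {e : Ω → ℝ} (he1 : ∀ x, |e x| ≤ 1)
    (he : ∀ x, ‖e x‖ₑ ≤ ‖g x‖ₑ + ∑' i, ‖2 * k i x‖ₑ) (l : ℤ) :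
    primitive μ (fun x => (v j - v (j + 1)) * e x) (2 ^ l) ≤
      ((14 : ℝ≥0) : ℝ≥0∞) * ENNReal.ofReal (layerBound v l j) := by
  have ha : 0 ≤ v j - v (j + 1) := sub_nonneg.2 (hv.anti (by omega))
  have hvj := hv.pos (j + 1)
  have hvj' := hv.pos j
  have h2j : (0 : ℝ) < 2 ^ j := by positivity
  refine (primitive_const_mul_le _ _).trans ?_
  rw [Real.enorm_of_nonneg ha, layerBound]
  split_ifs with hlj
  · calc ENNReal.ofReal (v j - v (j + 1)) * primitive μ e (2 ^ l)
        ≤ ENNReal.ofReal (v j - v (j + 1)) * ((1 : ℝ≥0) * ENNReal.ofReal (2 ^ l)) := by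
          gcongr
          exact primitive_le_of_bound (ae_of_all _ fun x => by simpa using he1 x) _
      _ = 1 * ENNReal.ofReal (2 ^ l * (v j - v (j + 1))) := by
          rw [ENNReal.ofReal_mul (by positivity), ENNReal.coe_one]
          ring
      _ ≤ _ := by
          gcongr
          norm_num
  · obtain ⟨n, rfl⟩ := Int.le.dest (not_le.1 hlj).le
    have hn : (1 : ℝ) ≤ n := by exact_mod_cast (by omega : 1 ≤ n)
    let F : ℕ → Ω → ℝ := fun i => Nat.casesOn i g fun i x => 2 * k i x
    have hF : ∀ i, AEMeasurable (F i) μ := fun i => by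
      cases i with
      | zero => exact hg.1.aemeasurable
      | succ i => exact ((hk i).1.const_mul 2).aemeasurable
    have h1 : primitive μ e (2 ^ (j + n)) ≤ ∑' i, primitive μ (F i) (2 ^ (j + n)) := by
      refine primitive_le_tsum_nat hF (ae_of_all _ fun x => ?_) (by positivity)
      rw [tsum_eq_zero_add' ENNReal.summable]
      exact he x
    have h2 : ∑' i, primitive μ (F i) (2 ^ (j + n)) ≤ ENNReal.ofReal (14 * 2 ^ j * n) := by
      rw [tsum_eq_zero_add' ENNReal.summable]
      calc primitive μ g (2 ^ (j + n)) + ∑' i, primitive μ (fun x => 2 * k i x) (2 ^ (j + n))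
          ≤ ENNReal.ofReal (2 * 2 ^ j) + 2 * ENNReal.ofReal (2 * 2 ^ j * (n + 2)) := by
            refine add_le_add ?_ ?_
            · refine (primitive_le_lintegral hg.1.aemeasurable _).trans ?_
              have := hg.2.2
              rwa [ENNReal.coe_one, one_mul] at this
            · refine le_trans (ENNReal.tsum_le_tsum fun i => primitive_const_mul_le _ _) ?_
              rw [ENNReal.tsum_mul_left, Real.enorm_of_nonneg zero_le_two, ENNReal.ofReal_ofNat]
              gcongr
              exact tsum_primitive_le_of_energy hk hki n
        _ = ENNReal.ofReal (2 * 2 ^ j + 2 * (2 * 2 ^ j * (n + 2))) := by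
            rw [ENNReal.ofReal_add (by positivity) (by positivity),
              ENNReal.ofReal_mul (p := 2) (q := 2 * 2 ^ j * ((n : ℝ) + 2)) zero_le_two,
              ENNReal.ofReal_ofNat]
        _ ≤ _ := by
            -- 2 + 4(n + 2) ≤ 14 n for n ≥ 1, whence the constant 14.
            refine ENNReal.ofReal_le_ofReal ?_
            nlinarith
    calc ENNReal.ofReal (v j - v (j + 1)) * primitive μ e (2 ^ (j + n))
        ≤ ENNReal.ofReal (v j) * ENNReal.ofReal (14 * 2 ^ j * n) :=
          mul_le_mul' (ENNReal.ofReal_le_ofReal (by linarith)) (h1.trans h2)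
      _ = _ := by
          have e1 : ((14 : ℝ≥0) : ℝ≥0∞) = ENNReal.ofReal 14 := by
            rw [ENNReal.ofReal_ofNat]; rfl
          rw [e1, ← ENNReal.ofReal_mul hvj'.le, ← ENNReal.ofReal_mul (by norm_num)]
          congr 1
          push_cast
          ring

end Energy

/-! ### Weak* null sequences on bounded sequences of functions -/

section Main

/-- The least common bound, truncated at `1`, of the partial sums of a series. -/
def envelope {α : Type*} (g : α → ℝ) (k : ℕ → α → ℝ) (x : α) : ℝ :=
  (min 1 (‖g x‖ₑ + ∑' i, ‖2 * k i x‖ₑ)).toReal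

lemma enorm_envelope {α : Type*} (g : α → ℝ) (k : ℕ → α → ℝ) (x : α) :
    ‖envelope g k x‖ₑ = min 1 (‖g x‖ₑ + ∑' i, ‖2 * k i x‖ₑ) := by
  rw [envelope, Real.enorm_of_nonneg ENNReal.toReal_nonneg, ENNReal.ofReal_toReal]
  exact ne_top_of_le_ne_top ENNReal.one_ne_top (min_le_left _ _)

lemma abs_envelope_le_one {α : Type*} (g : α → ℝ) (k : ℕ → α → ℝ) (x : α) : |envelope g k x| ≤ 1 := by
  rw [envelope, abs_of_nonneg ENNReal.toReal_nonneg]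
  exact ENNReal.toReal_le_of_le_ofReal zero_le_one (by simp)

lemma abs_le_envelope {α : Type*} {g : α → ℝ} {k : ℕ → α → ℝ} {x : α} {y : ℝ} (hy : |y| ≤ 1) (N : ℕ)
    (h : y = g x + ∑ i ∈ Finset.range N, 2 * k i x) : |y| ≤ envelope g k x := by
  have h1 : ‖y‖ₑ ≤ ‖envelope g k x‖ₑ := by
    rw [enorm_envelope]
    refine le_min ?_ ?_
    · rw [Real.enorm_eq_ofReal_abs, ← ENNReal.ofReal_one]
      exact ENNReal.ofReal_le_ofReal hy
    · rw [h]
      refine (enorm_add_le _ _).trans (add_le_add_right ?_ _)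
      exact (enorm_sum_le _ _).trans (ENNReal.sum_le_tsum _)
  rw [Real.enorm_eq_ofReal_abs, Real.enorm_eq_ofReal_abs,
    ENNReal.ofReal_le_ofReal_iff (abs_nonneg _)] at h1
  rwa [abs_of_nonneg (show 0 ≤ envelope g k x from ENNReal.toReal_nonneg)] at h1

variable {Ω : Type*} [MeasurableSpace Ω] {μ : Measure Ω} {ψ : ℝ → ℝ} {v : ℤ → ℝ} {q : ℝ}
  {C : ℝ≥0}

lemma ae_abs_add_smul_le {β β' : space ψ μ} {c : ℝ}
    (hβ : ∀ᵐ x ∂μ, |(β : Ω →ₘ[μ] ℝ) x| ≤ c) (hβ' : ∀ᵐ x ∂μ, |(β' : Ω →ₘ[μ] ℝ) x| ≤ c)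
    {s t : ℝ} (hst : |s| + |t| ≤ 1) :
    ∀ᵐ x ∂μ, |((s • β + t • β' : space ψ μ) : Ω →ₘ[μ] ℝ) x| ≤ c := by
  filter_upwards [hβ, hβ', AEEqFun.coeFn_add ((s • β : space ψ μ) : Ω →ₘ[μ] ℝ)
    ((t • β' : space ψ μ) : Ω →ₘ[μ] ℝ), AEEqFun.coeFn_smul s (β : Ω →ₘ[μ] ℝ),
    AEEqFun.coeFn_smul t (β' : Ω →ₘ[μ] ℝ)] with x h1 h2 h3 h4 h5
  rw [Submodule.coe_add, h3, Pi.add_apply, Submodule.coe_smul, Submodule.coe_smul, h4, h5,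
    Pi.smul_apply, Pi.smul_apply, smul_eq_mul, smul_eq_mul]
  have h6 : 0 ≤ c := (abs_nonneg _).trans h1
  refine (abs_add_le _ _).trans ?_
  rw [abs_mul, abs_mul]
  nlinarith [mul_le_mul_of_nonneg_left h1 (abs_nonneg s),
    mul_le_mul_of_nonneg_left h2 (abs_nonneg t), mul_le_mul_of_nonneg_right hst h6]

lemma measurable_envelope {g : Ω → ℝ} {k : ℕ → Ω → ℝ} (hg : Measurable g)
    (hk : ∀ i, Measurable (k i)) : Measurable (envelope g k) :=
  (measurable_const.min (hg.enorm.add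
    (Measurable.tsum fun i => ((hk i).const_mul 2).enorm))).ennreal_toReal

/-- The envelopes of the layers satisfy the layer bounds, so their sum, plus the constant ⨅ v, is in
the space and dominates everything built from dominated layers. The exceptional null set does not
depend on H and b. -/
lemma IsDyadicGauge.exists_envelope (hv : IsDyadicGauge ψ μ v q C) {G : ℤ × Ω → ℝ}
    (hG : G ∈ layerBall μ) {k : ℕ → ℤ × Ω → ℝ} (hk : ∀ i, k i ∈ layerBall μ)
    (hki : ∀ i j, energy μ (k i) j ≤ (1 / 4) ^ i) :
    ∃ e : space ψ μ, ∀ᵐ x ∂μ, ∀ H : ℤ × Ω → ℝ, ∀ b : ℝ,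
      (∀ j, |H (j, x)| ≤ envelope (fun x => G (j, x)) (fun i x => k i (j, x)) x) →
      |b| ≤ ⨅ n : ℕ, v n →
      |∑' j, (v j - v (j + 1)) * H (j, x) + b| ≤ |(e : Ω →ₘ[μ] ℝ) x| := by
  obtain ⟨K, hK⟩ := hv.exists_sum_layers
  have ha : ∀ j, 0 ≤ v j - v (j + 1) := fun j => sub_nonneg.2 (hv.anti (by omega))
  let E : ℤ → Ω → ℝ := fun j => envelope (fun x => G (j, x)) (fun i x => k i (j, x))
  have hE0 : ∀ j x, 0 ≤ E j x := fun j x => ENNReal.toReal_nonneg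
  have hEm : ∀ j, AEMeasurable (fun x => (v j - v (j + 1)) * E j x) μ := fun j =>
    ((measurable_envelope (hG j).1 fun i => (hk i j).1).const_mul _).aemeasurable
  obtain ⟨hs, hn⟩ := hK (fun j x => (v j - v (j + 1)) * E j x) hEm 14 fun l j =>
    hv.primitive_envelope_le (fun i => hk i j) (fun i => by
      have := hki i j
      rwa [energy, div_le_iff₀ (by positivity)] at this) (hG j)
      (abs_envelope_le_one _ _) (fun x => by
        rw [enorm_envelope]
        exact min_le_right _ _) l
  have hs' : ∀ᵐ x ∂μ, Summable fun j => (v j - v (j + 1)) * E j x := by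
    filter_upwards [hs] with x hx
    exact hx.of_abs
  have hsm := aemeasurable_tsum_of_summable hEm hs'
  have hfin : eNorm ψ μ ((fun x => ∑' j, (v j - v (j + 1)) * E j x) +
      fun _ => ⨅ n : ℕ, v n) < ∞ := by
    refine (eNorm_add_le hsm aemeasurable_const).trans_lt
      (ENNReal.add_lt_top.2 ⟨?_, hv.eNorm_const_lt_top⟩)
    exact (hn _ (ae_of_all _ fun x => enorm_tsum_le_tsum_enorm)).trans_lt
      (ENNReal.mul_lt_top ENNReal.coe_lt_top ENNReal.coe_lt_top)
  refine ⟨toSpace _ (hsm.add aemeasurable_const) hfin, ?_⟩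
  filter_upwards [hs', coe_toSpace (hsm.add aemeasurable_const) hfin] with x h1 h2 H b hH hb
  rw [h2, Pi.add_apply]
  refine le_trans ?_ (le_abs_self _)
  refine (abs_add_le _ _).trans (add_le_add ?_ hb)
  rw [← Real.norm_eq_abs]
  refine tsum_of_norm_bounded h1.hasSum fun j => ?_
  rw [Real.norm_eq_abs, abs_mul, abs_of_nonneg (ha j)]
  exact mul_le_mul_of_nonneg_left (hH j) (ha j)

lemma IsDyadicGauge.not_forall_le (hv : IsDyadicGauge ψ μ v q C)
    {φ : ℕ → StrongDual ℝ (space ψ μ)} (hφ : ∀ f, Tendsto (fun n => φ n f) atTop (𝓝 0))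
    {M : ℝ} (hM : ∀ n, ‖φ n‖ ≤ M) {f : ℕ → space ψ μ}
    (hf : ∀ k, ∀ i : ℤ, primitive μ (f k : Ω →ₘ[μ] ℝ) (2 ^ i) ≤ ENNReal.ofReal (2 ^ i * v i))
    {ε : ℝ} (hε : 0 < ε) : ¬ ∀ n i, n ≤ i → ε ≤ φ n (f i) := by
  intro hcon
  obtain ⟨R, K, hR⟩ := hv.exists_layerMap
  set c := ⨅ n : ℕ, v n with hc
  have hc0 : 0 ≤ c := hv.iInf_nonneg
  have hM0 : 0 ≤ M := (norm_nonneg _).trans (hM 0)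
  have hfm : ∀ k, Measurable (f k : Ω →ₘ[μ] ℝ) := fun k => AEEqFun.measurable _
  choose H hHB hHf using fun k => hv.exists_layers (hfm k) (hf k)
  have hbm : ∀ k, AEMeasurable (fun x => clamp c ((f k : Ω →ₘ[μ] ℝ) x)) μ := fun k =>
    ((measurable_clamp c).comp (hfm k)).aemeasurable
  have hbn : ∀ k, eNorm ψ μ (fun x => clamp c ((f k : Ω →ₘ[μ] ℝ) x)) < ∞ := fun k =>
    (eNorm_mono (ae_of_all _ fun x => (abs_clamp_le hc0 _).trans (le_abs_self c))).trans_lt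
      hv.eNorm_const_lt_top
  let b : ℕ → space ψ μ := fun k => toSpace _ (hbm k) (hbn k)
  have hfb : ∀ k, f k = R (H k) + b k := fun k => by
    refine Subtype.ext (AEEqFun.ext ?_)
    rw [Submodule.coe_add]
    filter_upwards [hHf k, (hR _ (hHB k)).2.1, coe_toSpace (hbm k) (hbn k),
      AEEqFun.coeFn_add (R (H k) : Ω →ₘ[μ] ℝ) (b k : Ω →ₘ[μ] ℝ)] with x h1 h2 h3 h4
    rw [h4, Pi.add_apply, h2, h3, ← h1]
  -- Layers and bounded remainders are blocked together, with the same convex coefficients; the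
  -- energy ignores the remainder, which is order bounded anyway.
  let S : Set ((ℤ × Ω → ℝ) × space ψ μ) :=
    {p | p.1 ∈ layerBall μ ∧ ∀ᵐ x ∂μ, |(p.2 : Ω →ₘ[μ] ℝ) x| ≤ c}
  have hS : Convex ℝ S := fun p hp p' hp' s t hs ht hst =>
    ⟨convex_layerBall hp.1 hp'.1 hs ht hst, ae_abs_add_smul_le hp.2 hp'.2
      (by rw [abs_of_nonneg hs, abs_of_nonneg ht, hst])⟩
  have hS' : ∀ p ∈ S, ∀ p' ∈ S, (1 / 2 : ℝ) • (p - p') ∈ S := fun p hp p' hp' => by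
    refine ⟨half_sub_mem_layerBall hp.1 hp'.1, ?_⟩
    have h := ae_abs_add_smul_le hp.2 hp'.2 (s := 1 / 2) (t := -(1 / 2))
      (by rw [abs_neg, abs_of_pos (by norm_num)]; norm_num)
    rwa [neg_smul, ← sub_eq_add_neg, ← smul_sub] at h
  have hxS : ∀ k, (H k, b k) ∈ S := fun k => by
    refine ⟨hHB k, ?_⟩
    filter_upwards [coe_toSpace (hbm k) (hbn k)] with x hx
    rw [hx]
    exact abs_clamp_le hc0 _
  have hB := isSectionBall_layerBall (μ := μ)
  let ζ : ℕ → (ℤ × Ω → ℝ) →ₗ[ℝ] ℝ := fun n => (φ n : space ψ μ →ₗ[ℝ] ℝ) ∘ₗ R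
  have hζ : ∀ n, ∀ h ∈ layerBall μ, ζ n h ≤ M * K := fun n h hh =>
    (le_abs_self _).trans (((φ n).le_opNorm (R h)).trans
      (mul_le_mul (hM n) (hR h hh).2.2 (norm_nonneg _) hM0))
  have hlim : ∀ h ∈ layerBall μ, Tendsto (fun n => ζ n h) atTop (𝓝 0) := fun h _ => hφ (R h)
  set δ := min 1 (ε / 4) with hδ
  have hδ0 : 0 < δ := by positivity
  -- The base is now ℤ: off A i, the half difference of consecutive blocks has energy at most δ
  -- 4^{-i} in every layer.
  obtain ⟨g, A, hg, hA, hAη, hgA⟩ := hB.exists_convex_blocks hζ hlim hS hS' hxS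
    (q := fun p j => energy μ p.1 j) (D := 2) (fun _ _ => Measurable.of_discrete)
    (fun _ _ j => energy_nonneg _ j) (fun p hp j => energy_le_two hp.1 j)
    (fun p hp p' hp' j => energy_parallelogram hp.1 hp'.1 j)
    (η := fun i => δ * (1 / 4) ^ i) (fun i => by positivity)
  have hgS : ∀ i, g i ∈ S := fun i => by
    refine convexHull_min ?_ hS (hg i)
    rintro _ ⟨j, -, rfl⟩
    exact hxS j
  have hge : ∀ n i, n ≤ i → ε ≤ φ n (R (g i).1 + (g i).2) := fun n i hni => by
    refine apply_convexHull_ge ((φ n : space ψ μ →ₗ[ℝ] ℝ) ∘ₗ (R.coprod LinearMap.id))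
      (fun k hk => ?_) (hg i)
    change ε ≤ φ n (R (H k) + b k)
    rw [← hfb]
    exact hcon n k (hni.trans hk)
  classical
  -- half differences of consecutive blocks, cut off on the exceptional sets
  let k : ℕ → ℤ × Ω → ℝ := fun i s =>
    (A i)ᶜ.indicator 1 s.1 * ((1 / 2 : ℝ) • (g (i + 1) - g i)).1 s
  have hk : ∀ i, k i ∈ layerBall μ := fun i =>
    hB.mul_mem _ Measurable.of_discrete (fun j => by
      by_cases hj : j ∈ A i <;> simp [hj]) _ (hS' _ (hgS (i + 1)) _ (hgS i)).1
  have hkA : ∀ i j x, j ∉ A i → 2 * k i (j, x) = (g (i + 1)).1 (j, x) - (g i).1 (j, x) := by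
    intro i j x hj
    simp only [k, mem_compl_iff, hj, not_false_eq_true, indicator_of_mem, Pi.one_apply, one_mul,
      Prod.smul_fst, Prod.fst_sub, Pi.smul_apply, Pi.sub_apply, smul_eq_mul]
    ring
  have hkE : ∀ i j, energy μ (k i) j ≤ (1 / 4) ^ i := fun i j => by
    by_cases hj : j ∈ A i
    · have h0 : ∀ x, k i (j, x) = 0 := fun x => by simp [k, hj]
      simp only [energy, h0]
      simp
    · have h0 : ∀ x, k i (j, x) = ((1 / 2 : ℝ) • (g (i + 1) - g i)).1 (j, x) := fun x => by
        simp [k, hj]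
      have h1 := hgA i j hj
      simp only [energy, h0] at h1 ⊢
      refine h1.trans (mul_le_of_le_one_left (by positivity) (min_le_left _ _))
  obtain ⟨e, he⟩ := hv.exists_envelope (hgS 0).1 hk hkE
  -- The layers met by an exceptional set before step i; their total modulus stays below 2δ for all
  -- n.
  let U : ℕ → Set ℤ := fun i => {j | ∃ i' < i, j ∈ A i'}
  have hp := hB.uniformlyExhaustive hζ hlim
  have hU : ∀ n i, setModulus Prod.fst (layerBall μ) (ζ n) (U i) ≤ 2 * δ * (1 - (1 / 4) ^ i) := by
    intro n i
    induction i with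
    | zero =>
      have : U 0 = ∅ := by simp [U]
      rw [this]
      refine (hp.empty n).le.trans ?_
      simp
    | succ i ih =>
      have h1 : U (i + 1) = U i ∪ A i := by
        ext j
        simp only [U, mem_ofPred_eq, mem_union]
        constructor
        · rintro ⟨i', hi', hj⟩
          rcases Nat.lt_succ_iff_lt_or_eq.1 hi' with h | rfl
          · exact Or.inl ⟨i', h, hj⟩
          · exact Or.inr hj
        · rintro (⟨i', hi', hj⟩ | hj)
          · exact ⟨i', hi'.trans (Nat.lt_succ_self i), hj⟩
          · exact ⟨i, Nat.lt_succ_self i, hj⟩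
      rw [h1]
      have h2 := hp.subadd n (U i) (A i) (MeasurableSet.of_discrete) (hA i)
      have h3 := hAη n i
      have h4 : 0 < δ * (1 / 4) ^ i := by positivity
      rw [pow_succ]
      linarith
  -- P i is the part of the block on exceptional layers, of value below 2δ ≤ ε/2 for every
  -- functional. The rest N i is order bounded and inherits the lower bound ε/2.
  let P : ℕ → ℤ × Ω → ℝ := fun i s => (U i).indicator 1 s.1 * (g i).1 s
  let N : ℕ → ℤ × Ω → ℝ := fun i s => (U i)ᶜ.indicator 1 s.1 * (g i).1 s
  have hP : ∀ i, P i ∈ layerBall μ := fun i =>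
    hB.mul_mem _ Measurable.of_discrete (fun j => by
      by_cases hj : j ∈ U i <;> simp [hj]) _ (hgS i).1
  have hN : ∀ i, N i ∈ layerBall μ := fun i =>
    hB.mul_mem _ Measurable.of_discrete (fun j => by
      by_cases hj : j ∈ U i <;> simp [hj]) _ (hgS i).1
  have hPN : ∀ i, (g i).1 = P i + N i := fun i => by
    ext s
    by_cases hj : s.1 ∈ U i <;> simp [P, N, hj]
  have hNe : ∀ i j x, |N i (j, x)| ≤
      envelope (fun x => (g 0).1 (j, x)) (fun i x => k i (j, x)) x := by
    intro i j x
    by_cases hj : j ∈ U i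
    · have : N i (j, x) = 0 := by simp [N, hj]
      rw [this, abs_zero]
      exact ENNReal.toReal_nonneg
    · have h1 : N i (j, x) = (g i).1 (j, x) := by simp [N, hj]
      rw [h1]
      refine abs_le_envelope (by simpa using ((hgS i).1 j).2.1 x) i ?_
      -- On a layer outside U i no cut-off has occurred before step i, so the block is g 0 plus the
      -- telescoping sum of the 2 k i', which the envelope dominates.
      have h2 : ∀ m ≤ i, (g m).1 (j, x) =
          (g 0).1 (j, x) + ∑ i' ∈ Finset.range m, 2 * k i' (j, x) := by
        intro m hm
        induction m with
        | zero => simp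
        | succ m ih =>
          rw [Finset.sum_range_succ, ← add_assoc, ← ih (by omega),
            hkA m j x fun h => hj ⟨m, by omega, h⟩]
          ring
      exact h2 i le_rfl
  refine not_forall_le_of_order_bounded hφ hM e (x := fun i => R (N i) + (g i).2) (fun i => ?_)
    (half_pos hε) fun n i hni => ?_
  · filter_upwards [he, (hR _ (hN i)).2.1, (hgS i).2,
      AEEqFun.coeFn_add (R (N i) : Ω →ₘ[μ] ℝ) ((g i).2 : Ω →ₘ[μ] ℝ)] with x h1 h2 h3 h4
    rw [Submodule.coe_add, h4, Pi.add_apply, h2]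
    exact h1 _ _ (fun j => hNe i j x) h3
  · have h1 := hge n i hni
    rw [hPN i, map_add, map_add, map_add] at h1
    have h2 : ζ n (P i) ≤ _ := hB.apply_le_setModulus (hζ n) (A := U i) MeasurableSet.of_discrete
      (hP i) fun s hs => by simp [P, hs]
    have h3 := hU n i
    have h4 : 0 < 2 * δ * (1 / 4) ^ i := by positivity
    have h5 : δ ≤ ε / 4 := min_le_right _ _
    change φ n (R (P i)) ≤ _ at h2
    rw [map_add]
    linarith

end Main

/-! ### The Grothendieck property -/

section Grothendieck

/-- Helly's theorem: an element of the bidual can be imitated on finitely many functionals by a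
vector of nearly the same norm. -/
lemma exists_norm_le_forall_lt {X : Type*} [NormedAddCommGroup X] [NormedSpace ℝ X]
    (F : StrongDual ℝ (StrongDual ℝ X)) (θ : ℕ → StrongDual ℝ X) {ε : ℝ} (hε : 0 < ε) (k : ℕ) :
    ∃ f : X, ‖f‖ ≤ ‖F‖ + 1 ∧ ∀ j ≤ k, F (θ j) - ε < θ j f := by
  set ρ := ‖F‖ + 1 with hρ
  have hρ0 : 0 < ρ := by positivity
  let T : X →L[ℝ] Fin (k + 1) → ℝ := ContinuousLinearMap.pi fun j => θ j
  let y : Fin (k + 1) → ℝ := fun j => F (θ j)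
  have hy : y ∈ closure (T '' Metric.closedBall 0 ρ) := by
    by_contra hy
    have hconv : Convex ℝ (closure (T '' Metric.closedBall (0 : X) ρ)) :=
      ((convex_closedBall (0 : X) ρ).linear_image (T : X →ₗ[ℝ] Fin (k + 1) → ℝ)).closure
    -- A separating functional pulls back to a combination L of the θ j with ‖L‖ ≤ u / ρ, whereas F
    -- L > u; this is incompatible with ‖F‖ < ρ.
    obtain ⟨g, u, hgu, huy⟩ := geometric_hahn_banach_closed_point hconv isClosed_closure hy
    let c : Fin (k + 1) → ℝ := fun j => g (Pi.single j 1)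
    have hg : ∀ a, g a = ∑ j, c j * a j := fun a => by
      have := LinearMap.pi_apply_eq_sum_univ (g : (Fin (k + 1) → ℝ) →ₗ[ℝ] ℝ) a
      simp only [ContinuousLinearMap.coe_coe, smul_eq_mul] at this
      rw [this]
      refine Finset.sum_congr rfl fun j _ => ?_
      rw [mul_comm]
      congr 2
      ext i
      simp [Pi.single_apply, eq_comm]
    let L : StrongDual ℝ X := ∑ j, c j • θ j
    have hgT : ∀ f, g (T f) = L f := fun f => by
      rw [hg]
      simp [L, T]
    have hgy : g y = F L := by
      rw [hg]
      simp [L, y, map_sum]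
    have hL : ∀ f : X, ‖f‖ ≤ ρ → L f < u := fun f hf => by
      rw [← hgT]
      exact hgu _ (subset_closure ⟨f, by simpa using hf, rfl⟩)
    have hu : 0 < u := by simpa using hL 0 (by simpa using hρ0.le)
    have hLn : ‖L‖ ≤ u / ρ := by
      refine L.opNorm_le_bound (by positivity) fun f => ?_
      rcases eq_or_ne f 0 with rfl | hf
      · simp
      have hf0 : 0 < ‖f‖ := norm_pos_iff.2 hf
      have key : ∀ f : X, f ≠ 0 → L f ≤ u / ρ * ‖f‖ := fun f hf => by
        have hf0 : 0 < ‖f‖ := norm_pos_iff.2 hf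
        have h1 := hL ((ρ / ‖f‖) • f) (by
          rw [norm_smul, Real.norm_of_nonneg (by positivity), div_mul_cancel₀ _ hf0.ne'])
        rw [map_smul, smul_eq_mul, div_mul_eq_mul_div, div_lt_iff₀ hf0] at h1
        rw [div_mul_eq_mul_div, le_div_iff₀ hρ0]
        linarith
      rw [Real.norm_eq_abs]
      refine abs_le'.2 ⟨key f hf, ?_⟩
      have := key (-f) (neg_ne_zero.2 hf)
      rwa [map_neg, norm_neg] at this
    have h1 : F L ≤ ‖F‖ * ‖L‖ := (le_abs_self _).trans (F.le_opNorm L)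
    have h2 : ‖F‖ * ‖L‖ ≤ ρ * (u / ρ) :=
      mul_le_mul (by linarith) hLn (norm_nonneg _) hρ0.le
    rw [mul_div_cancel₀ _ hρ0.ne'] at h2
    rw [hgy] at huy
    linarith
  obtain ⟨_, ⟨f, hf, rfl⟩, hd⟩ := Metric.mem_closure_iff.1 hy ε hε
  refine ⟨f, by simpa using hf, fun j hj => ?_⟩
  have h1 := (dist_le_pi_dist y (T f) ⟨j, Nat.lt_succ_of_le hj⟩).trans_lt hd
  rw [Real.dist_eq] at h1
  have h2 := (abs_lt.1 h1).2
  change F (θ j) - θ j f < ε at h2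
  linarith

variable {Ω : Type*} [MeasurableSpace Ω] {μ : Measure Ω} {ψ : ℝ → ℝ} {v : ℤ → ℝ} {q : ℝ}
  {C : ℝ≥0}

lemma IsDyadicGauge.not_forall_le_bidual [CompleteSpace (space ψ μ)]
    (hv : IsDyadicGauge ψ μ v q C) {θ : ℕ → StrongDual ℝ (space ψ μ)}
    (hθ : ∀ f, Tendsto (fun n => θ n f) atTop (𝓝 0)) (F : StrongDual ℝ (StrongDual ℝ (space ψ μ)))
    {ε : ℝ} (hε : 0 < ε) : ¬ ∀ n, ε ≤ F (θ n) := by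
  intro hF
  obtain ⟨M, hM⟩ := banach_steinhaus (g := θ) fun f => by
    obtain ⟨c, hc⟩ := (hθ f).norm.bddAbove_range
    exact ⟨c, fun n => hc ⟨n, rfl⟩⟩
  choose f hfn hfθ using exists_norm_le_forall_lt F θ (half_pos hε)
  -- Scaling by s turns the norm bound ‖F‖ + 1 into the normalised dyadic bound on primitives.
  set s : ℝ := 1 / (C * (‖F‖ + 1) + 1) with hs
  have hs0 : 0 < s := by positivity
  refine hv.not_forall_le hθ hM (f := fun k => s • f k) (fun k i => ?_)
    (show 0 < s * (ε / 2) by positivity) fun n i hni => ?_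
  · refine (hv.primitive_le _ (AEEqFun.aemeasurable _) i).trans ?_
    refine mul_le_of_le_one_left zero_le ?_
    rw [← enorm_eq_eNorm, ← ofReal_norm, norm_smul, Real.norm_of_nonneg hs0.le,
      ← ENNReal.ofReal_coe_nnreal, ← ENNReal.ofReal_mul C.coe_nonneg, ← ENNReal.ofReal_one]
    refine ENNReal.ofReal_le_ofReal ?_
    have h1 : (C : ℝ) * ‖f k‖ ≤ C * (‖F‖ + 1) := mul_le_mul_of_nonneg_left (hfn k) C.coe_nonneg
    rw [hs, mul_left_comm, one_div_mul_eq_div]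
    exact div_le_one_of_le₀ (by linarith) (by positivity)
  · rw [map_smul, smul_eq_mul]
    have h1 := hfθ i n hni
    have h2 := hF n
    exact mul_le_mul_of_nonneg_left (by linarith) hs0.le

lemma IsDyadicGauge.tendsto_bidual [CompleteSpace (space ψ μ)]
    (hv : IsDyadicGauge ψ μ v q C) {θ : ℕ → StrongDual ℝ (space ψ μ)}
    (hθ : ∀ f, Tendsto (fun n => θ n f) atTop (𝓝 0))
    (F : StrongDual ℝ (StrongDual ℝ (space ψ μ))) :
    Tendsto (fun n => F (θ n)) atTop (𝓝 0) := by
  have key : ∀ F : StrongDual ℝ (StrongDual ℝ (space ψ μ)), ∀ ε > 0,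
      ∀ᶠ n in atTop, F (θ n) < ε := by
    intro F ε hε
    by_contra h
    rw [not_eventually] at h
    -- Subsequences of weak-* null sequences are weak-* null, so a frequent lower bound becomes a
    -- bound for all n; applying this to F and -F gives convergence.
    obtain ⟨σ, hσ, hσε⟩ := extraction_of_frequently_atTop h
    exact hv.not_forall_le_bidual (θ := fun n => θ (σ n))
      (fun f => (hθ f).comp hσ.tendsto_atTop) F hε fun n => not_lt.1 (hσε n)
  rw [Metric.tendsto_nhds]
  intro ε hε
  filter_upwards [key F ε hε, key (-F) ε hε] with n h1 h2
  rw [Real.dist_eq, sub_zero, abs_lt]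
  have h3 : (-F) (θ n) = -F (θ n) := rfl
  rw [h3] at h2
  constructor <;> linarith

lemma isGrothendieckSpace_space (hψ : IsWeight (μ univ) ψ)
    (hAB : ConditionA (μ univ) ψ ∨ ConditionB (μ univ) ψ) :
    IsGrothendieckSpace (space ψ μ) := by
  have hcomp := completeSpace_space (μ := μ) hψ
  refine ⟨hcomp, fun φ φ₀ hφ => ?_⟩
  obtain ⟨v, q, C, hv⟩ := exists_isDyadicGauge hψ hAB
  rw [tendsto_iff_forall_eval_tendsto_topDualPairing] at hφ
  have hθ : ∀ f, Tendsto (fun n => (φ n - φ₀) f) atTop (𝓝 0) := fun f => by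
    have h1 : Tendsto (fun n => φ n f) atTop (𝓝 (φ₀ f)) := hφ f
    have h2 := h1.sub_const (φ₀ f)
    rwa [sub_self] at h2
  -- The criterion requires the bidual to separate the points of the dual, which is Hahn–Banach.
  refine (WeakBilin.tendsto_iff_forall_eval_tendsto
    (B := (topDualPairing ℝ (StrongDual ℝ (space ψ μ))).flip) fun a b hab => ?_).2 fun F => ?_
  · by_contra hne
    obtain ⟨F, hF⟩ := SeparatingDual.exists_separating_of_ne (R := ℝ) hne
    exact hF (congrArg (fun L => L F) hab)
  · have h1 := (hv.tendsto_bidual hθ F).add_const (F φ₀)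
    simp only [map_sub, sub_add_cancel, zero_add] at h1
    exact h1

end Grothendieck

end Marcinkiewicz

end

theorem theorem5 {Ω : Type*} [MeasurableSpace Ω] (μ : MeasureTheory.Measure Ω)
    [MeasureTheory.SigmaFinite μ] (ψ : ℝ → ℝ)
    (hψ : Marcinkiewicz.IsWeight (μ Set.univ) ψ)
    (hAB : Marcinkiewicz.ConditionA (μ Set.univ) ψ ∨ Marcinkiewicz.ConditionB (μ Set.univ) ψ) :
    Marcinkiewicz.IsGrothendieckSpace (Marcinkiewicz.space ψ μ) :=
  Marcinkiewicz.isGrothendieckSpace_space hψ hAB
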